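/- **Setting.** Let $n,d\ge 1$, let $|\cdot|$ be the Euclidean norm of vectors and the induced 2-norm of matrices, $|\cdot|_F$ the Frobenius norm, $\mathbb N=\{1,2,\dots\}$, $\mathbb N_0=\mathbb N\cup\{0\}$. Let $\mathbb X,\mathbb W\subseteq\mathbb R^n$, $\mathbb U\subseteq\mathbb R^m$, $\mathbb S\subseteq\mathbb R^q$, let $f:\mathbb X\times\mathbb U\to\mathbb R^n$, $\psi:\mathbb X\times\mathbb U\to\mathbb R^d$ and $\alpha:\mathbb X\times\mathbb S\times\mathbb R^{d\times n}\to\mathbb U$ be Borel measurable, $\theta_*,\vartheta_0\in\mathbb R^{d\times n}$, $\gamma>0$, and put $g(x,u,w)=f(x,u)+\theta_*^\top\psi(x,u)+w$; assume $g(x,u,w)\in\mathbb X$ for all $x\in\mathbb X$, $u\in\mathbb U$, $w\in\mathbb W\cup\{0\}$. On a probability space let $\{W(t)\}_{t\in\mathbb N}$ be i.i.d. in $\mathbb W$ with law $\mu_w$ and $\{S(t)\}_{t\in\mathbb N_0}$ i.i.d. in $\mathbb S$ with law $\mu_s$, the two sequences being independent, with $W(t)$ zero-mean and $\mathbb E[\exp(\lambda\zeta^\top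 W(t))]\le\exp(\lambda^2\sigma_w^2/2)$ for all $\lambda\in\mathbb R$ and unit vectors $\zeta$, where $\sigma_w\ge 0$. For $x_0\in\mathbb X$ define, for $t\in\mathbb N_0$, $X(0)=x_0$, $X(t+1)=g(X(t),U(t),W(t+1))$, $U(t)=\alpha(X(t),S(t),\hat\theta(t-1))$, where $\hat\theta(-1)=\hat\theta(0)=\vartheta_0$ and, for $t\in\mathbb N$, with $Z(s)=\psi(X(s-1),U(s-1))$, $$\hat\theta(t)=\operatorname*{argmin}_{\theta\in\mathbb R^{d\times n}}\ \sum_{s=1}^t\big|X(s)-\theta^\top Z(s)-f(X(s-1),U(s-1))\big|^2+\gamma|\theta|_F^2 .$$ **Assumptions.** Let $\mathcal K_\infty$ be the set of continuous strictly increasing unbounded $h:[0,\infty)\to[0,\infty)$ with $h(0)=0$, and call $h$ $k$-SE if $\ln h(r^k)=o(r)$ as $r\to\infty$. (a) There are $\chi_1,\chi_3,\sigma_2\in\mathcal K_\infty$ that are $1$-SE, $\chi_4\in\mathcal K_\infty$ that is $2$-SE, $\chi_2,\sigma_1\in\mathcal K_\infty$ and $c_1\ge0$ such that for all $t\in\mathbb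 N$, $\xi\in\mathbb X$, $u(i)\in\mathbb U$, $w(i)\in\mathbb W$, the solution $\phi$ at time $t$ of $x(i+1)=g(x(i),u(i),w(i+1))$, $x(0)=\xi$, satisfies $$|\phi|\le\chi_1(t)+\chi_2(|\xi|)+\chi_3\Big(\sum_{i=0}^{t-1}\sigma_1(|u(i)|)\Big)+\chi_4\Big(\sum_{i=1}^{t}\sigma_2(|w(i)|)\Big)+c_1 .$$ (b) $|\alpha(x,s,\vartheta)|\le u_{\max}$ for all $x\in\mathbb X,s\in\mathbb S,\vartheta\in\mathbb R^{d\times n}$, with $u_{\max}\ge0$. (c) $|\psi(x,u)|\le\chi_5\big(\sqrt{|x|^2+|u|^2}\big)$ for all $x\in\mathbb X,u\in\mathbb U$, where $\chi_5:[0,\infty)\to[0,\infty)$ is nondecreasing and $\chi_5(r)=O(r^k)$ as $r\to\infty$ for some $k\in\mathbb N$. (d) (Global excitation) There are $c_{\rm PE},p_{\rm PE}>0$ such that for all $\vartheta\in\mathbb R^{d\times n}$, $x\in\mathbb X$ and unit $\zeta\in\mathbb R^d$, for $(S,W)\sim\mu_s\times\mu_w$, with probability at least $p_{\rm PE}$ one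 has $x+W\in\mathbb X$ and $|\zeta^\top\psi(x+W,\alpha(x+W,S,\vartheta))|^2\ge c_{\rm PE}$. **Bounds.** For $\delta\in(0,1)$ put $\overline w(0,\delta)=0$ and $\overline w(t,\delta)=\sigma_w\sqrt{2n\ln\frac{n\pi^2t^2}{3\delta}}$ for $t\in\mathbb N$, and $$\overline x(t,\delta,x_0)=\chi_1(t)+\chi_2(|x_0|)+\chi_3(t\,\sigma_1(u_{\max}))+\chi_4(t\,\sigma_2(\overline w(t,\delta)))+c_1,$$ $$\overline z(t,\delta,x_0)=\chi_5\Big(\sqrt{\overline x(t-1,\delta,x_0)^2+u_{\max}^2}\Big),\qquad \beta_{\max}(t,\delta,x_0)=\sum_{i=1}^t\overline z(i,\delta,x_0)^2+\gamma .$$ With $\Gamma(\mathcal X)=\{g(x,u,0): x\in\mathcal X,\ u\in\mathbb U,\ |u|\le u_{\max}\}$ for $\mathcal X\subseteq\mathbb X$, let $T_{\rm excited}(\delta,x_0)$ be the supremum in $\mathbb N\cup\{\infty\}$ of all $T\in\mathbb N$ with $\Gamma(\{x\in\mathbb X:|x|\le\overline x(T-1,\delta/3,x_0)\})\subseteq\mathbb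 X$ (the excited region being $\mathbb X$), and let $T_{\text{burn-in}}(\delta,x_0)$ be the infimum in $\mathbb N\cup\{\infty\}$ of all $T\in\mathbb N$ such that for all integers $t\ge T$ $$t\ge\frac{2}{(1-\ln2)p_{\rm PE}}\left(d\ln\Big(1+\frac{16\sum_{i=1}^t\overline z(i,\delta/3,x_0)^2}{c_{\rm PE}\,p_{\rm PE}\,(t-1)}\Big)+\ln\frac{\pi^2(t-T+1)^2}{2\delta}\right)+1$$ (the condition counts as failing at $t=1$). Finally let $$e(t,\delta,x_0)=\frac{\gamma^{1/2}|\theta_*|_F+\sigma_w\sqrt{2n\big(\ln(3n/\delta)+\tfrac d2\ln(\beta_{\max}(t,\delta/3,x_0)\gamma^{-1})\big)}}{\sqrt{\tfrac{c_{\rm PE}p_{\rm PE}}4(t-1)+\gamma}} .$$ **Result.** For every $x_0\in\mathbb X$ and $\delta\in(0,1)$: 1. $T_{\text{burn-in}}(\delta,x_0)<\infty$; 2. $T_{\rm excited}(\delta,x_0)=\infty$; 3. $\mathbb P\big(|\hat\theta(t)-\theta_*|\le e(t,\delta,x_0)\ \text{for all } t\ge T_{\text{burn-in}}(\delta,x_0)\big)\ge1-\delta$;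 4. $\lim_{t\to\infty}e(t,\delta,x_0)=0$. -/

import Mathlib

open MeasureTheory ProbabilityTheory Filter Topology Asymptotics
open scoped ENNReal NNReal

noncomputable section

/-! ### Norms and comparison functions -/

/-- Induced 2-norm of a rectangular real matrix. -/
def matOpNorm {a b : ℕ} (A : Matrix (Fin a) (Fin b) ℝ) : ℝ :=
  ‖(Matrix.toEuclideanLin A).toContinuousLinearMap‖

/-- Frobenius norm of a rectangular real matrix. -/
def matFrobNorm {a b : ℕ} (A : Matrix (Fin a) (Fin b) ℝ) : ℝ :=
  Real.sqrt (∑ i, ∑ j, A i j ^ 2)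

/-- Class `𝒦` on `[0, ∞)`; values at negative arguments are irrelevant. -/
structure ClassK (h : ℝ → ℝ) : Prop where
  continuousOn : ContinuousOn h (Set.Ici 0)
  strictMonoOn : StrictMonoOn h (Set.Ici 0)
  map_zero : h 0 = 0

/-- Class `𝒦_∞`: class `𝒦` and unbounded. -/
structure ClassKInfty (h : ℝ → ℝ) : Prop extends ClassK h where
  tendsto_atTop : Tendsto h atTop atTop

/-- `h` is `k`-order sub-exponential: `ln (h (r ^ k)) = o(r)` as `r → ∞`. -/
def SubExpOrder (k : ℕ) (h : ℝ → ℝ) : Prop :=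
  (fun r : ℝ => Real.log (h (r ^ k))) =o[atTop] (fun r : ℝ => r)

/-- Asymptotically polynomially bounded: `h r = O(r ^ k)` for some `k ∈ {1, 2, …}`. -/
def IsAPB (h : ℝ → ℝ) : Prop :=
  ∃ k : ℕ, 1 ≤ k ∧ h =O[atTop] (fun r : ℝ => r ^ k)

/-! ### The closed-loop system -/

/-- Data of the closed loop: state, control, process noise and exploratory noise spaces, the
nominal model `f`, basis functions `ψ`, true parameter `θ_*`, policy `α`, regularisation `γ`
and initial estimate `ϑ₀`.  The map `g (x, u, w) = f (x, u) + θ_*ᵀ ψ (x, u) + w`, for `w` a value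
of the process noise or `w = 0`, has codomain the state space. -/
structure ClosedLoopSystem (n m d q : ℕ) where
  stateSet : Set (EuclideanSpace ℝ (Fin n))
  ctrlSet : Set (EuclideanSpace ℝ (Fin m))
  noiseSet : Set (EuclideanSpace ℝ (Fin n))
  explSet : Set (EuclideanSpace ℝ (Fin q))
  f : stateSet → ctrlSet → EuclideanSpace ℝ (Fin n)
  ψ : stateSet → ctrlSet → EuclideanSpace ℝ (Fin d)
  θstar : Matrix (Fin d) (Fin n) ℝ
  α : stateSet → explSet → Matrix (Fin d) (Fin n) ℝ → ctrlSet
  γ : ℝ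
  γ_pos : 0 < γ
  ϑ₀ : Matrix (Fin d) (Fin n) ℝ
  g_mem : ∀ (x : stateSet) (u : ctrlSet) (w : EuclideanSpace ℝ (Fin n)),
    w ∈ noiseSet ∨ w = 0 → f x u + Matrix.toEuclideanLin θstar.transpose (ψ x u) + w ∈ stateSet

namespace ClosedLoopSystem

variable {n m d q : ℕ} (sys : ClosedLoopSystem n m d q)

/-- `g (x, u, w) = f (x, u) + θ_*ᵀ ψ (x, u) + w` as a vector. -/
def g (x : sys.stateSet) (u : sys.ctrlSet) (w : EuclideanSpace ℝ (Fin n)) :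
    EuclideanSpace ℝ (Fin n) :=
  sys.f x u + Matrix.toEuclideanLin sys.θstar.transpose (sys.ψ x u) + w

/-- One step of the dynamics, as a map into the state space. -/
def next (x : sys.stateSet) (u : sys.ctrlSet) (w : sys.noiseSet) : sys.stateSet :=
  ⟨sys.g x u w, sys.g_mem x u w (Or.inl w.2)⟩

/-- The deterministic solution `φ (t, ξ, u, w)`; only `u 0, …, u (t - 1)` and `w 1, …, w t`
are used. -/
def detSol (ξ : sys.stateSet) (u : ℕ → sys.ctrlSet) (w : ℕ → sys.noiseSet) : ℕ → sys.stateSet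
  | 0 => ξ
  | t + 1 => sys.next (detSol ξ u w t) (u t) (w (t + 1))

/-- The regressor `Z (s) = ψ (X (s - 1), U (s - 1))`, `s ≥ 1`, along a state-control path. -/
def regressor (path : ℕ → sys.stateSet × sys.ctrlSet) (s : ℕ) : EuclideanSpace ℝ (Fin d) :=
  sys.ψ (path (s - 1)).1 (path (s - 1)).2

/-- The regularised least squares cost at time `t` along a state-control path. -/
def rlsCost (path : ℕ → sys.stateSet × sys.ctrlSet) (t : ℕ) (θ : Matrix (Fin d) (Fin n) ℝ) : ℝ :=
  ∑ s ∈ Finset.Icc 1 t,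
    ‖((path s).1 : EuclideanSpace ℝ (Fin n))
      - Matrix.toEuclideanLin θ.transpose (sys.regressor path s)
      - sys.f (path (s - 1)).1 (path (s - 1)).2‖ ^ 2
    + sys.γ * matFrobNorm θ ^ 2

/-- The estimate `θ̂ (t)` along a path: `ϑ₀` at `t = 0`, and a minimiser of the regularised least
squares cost for `t ≥ 1`. -/
def estimate (path : ℕ → sys.stateSet × sys.ctrlSet) (t : ℕ) : Matrix (Fin d) (Fin n) ℝ :=
  if t = 0 then sys.ϑ₀
  else Classical.epsilon fun θ => ∀ θ', sys.rlsCost path t θ ≤ sys.rlsCost path t θ'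

/-- The cost has a minimiser, so the estimate is one. -/
theorem estimate_isMin (path : ℕ → sys.stateSet × sys.ctrlSet) {t : ℕ} (ht : t ≠ 0)
    (θ' : Matrix (Fin d) (Fin n) ℝ) :
    sys.rlsCost path t (sys.estimate path t) ≤ sys.rlsCost path t θ' := by
  have hex : ∃ θ : Fin d → Fin n → ℝ, ∀ θ' : Fin d → Fin n → ℝ,
      sys.rlsCost path t (Matrix.of θ) ≤ sys.rlsCost path t (Matrix.of θ') := by
    refine Continuous.exists_forall_le (f := fun θ : Fin d → Fin n → ℝ =>
      sys.rlsCost path t (Matrix.of θ)) ?_ ?_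
    · have h1 : ∀ z : EuclideanSpace ℝ (Fin d), Continuous fun θ : Fin d → Fin n → ℝ =>
          Matrix.toEuclideanLin (Matrix.of θ).transpose z := by
        intro z
        simp only [Matrix.toLpLin_apply]
        refine (PiLp.continuous_toLp 2 _).comp (continuous_pi fun j => ?_)
        simp only [Matrix.mulVec, dotProduct, Matrix.transpose_apply, Matrix.of_apply]
        fun_prop
      unfold rlsCost matFrobNorm
      refine Continuous.add (continuous_finsetSum _ fun s _ => ?_) ?_
      · exact ((((continuous_const.sub (h1 _))).sub continuous_const).norm).pow 2
      · simp only [Matrix.of_apply]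
        fun_prop
    · have hb : ∀ θ : Fin d → Fin n → ℝ, sys.γ * ‖θ‖ ^ 2 ≤ sys.rlsCost path t (Matrix.of θ) := by
        intro θ
        have h2 : ‖θ‖ ^ 2 ≤ matFrobNorm (Matrix.of θ) ^ 2 := by
          refine pow_le_pow_left₀ (norm_nonneg _) ?_ 2
          refine (pi_norm_le_iff_of_nonneg (Real.sqrt_nonneg _)).2 fun i =>
            (pi_norm_le_iff_of_nonneg (Real.sqrt_nonneg _)).2 fun j => ?_
          rw [Real.norm_eq_abs]
          refine Real.abs_le_sqrt ?_
          refine (Finset.single_le_sum (f := fun j => θ i j ^ 2)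
            (fun _ _ => sq_nonneg _) (Finset.mem_univ j)).trans ?_
          exact Finset.single_le_sum (f := fun i => ∑ j, θ i j ^ 2)
            (fun _ _ => Finset.sum_nonneg fun _ _ => sq_nonneg _) (Finset.mem_univ i)
        have h3 := mul_le_mul_of_nonneg_left h2 sys.γ_pos.le
        unfold rlsCost
        have h4 : 0 ≤ ∑ s ∈ Finset.Icc 1 t,
            ‖((path s).1 : EuclideanSpace ℝ (Fin n))
              - Matrix.toEuclideanLin (Matrix.of θ).transpose (sys.regressor path s)
              - sys.f (path (s - 1)).1 (path (s - 1)).2‖ ^ 2 :=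
          Finset.sum_nonneg fun _ _ => sq_nonneg _
        linarith
      refine tendsto_atTop_mono hb ?_
      exact ((tendsto_pow_atTop (two_ne_zero)).comp
        tendsto_norm_cocompact_atTop).const_mul_atTop sys.γ_pos
  obtain ⟨θ, hθ⟩ := hex
  have hex' : ∃ θ : Matrix (Fin d) (Fin n) ℝ, ∀ θ',
      sys.rlsCost path t θ ≤ sys.rlsCost path t θ' := ⟨Matrix.of θ, fun θ' => hθ θ'⟩
  unfold estimate
  rw [if_neg ht]
  exact Classical.epsilon_spec hex' θ'

/-- The closed-loop path up to time `t` (constant dummy values after `t`), for given noise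
sequences `w 1, w 2, …` and `s 0, s 1, …`. -/
def hist (x₀ : sys.stateSet) (w : ℕ → sys.noiseSet) (s : ℕ → sys.explSet) :
    ℕ → ℕ → sys.stateSet × sys.ctrlSet
  | 0 => fun _ => (x₀, sys.α x₀ (s 0) sys.ϑ₀)
  | t + 1 =>
    let past := hist x₀ w s t
    let x := sys.next (past t).1 (past t).2 (w (t + 1))
    Function.update past (t + 1) (x, sys.α x (s (t + 1)) (sys.estimate past t))

/-- The closed-loop path `t ↦ (X (t), U (t))`. -/
def path (x₀ : sys.stateSet) (w : ℕ → sys.noiseSet) (s : ℕ → sys.explSet) (t : ℕ) :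
    sys.stateSet × sys.ctrlSet :=
  sys.hist x₀ w s t t

theorem hist_eq_path (x₀ : sys.stateSet) (w : ℕ → sys.noiseSet) (s : ℕ → sys.explSet)
    {i t : ℕ} (h : i ≤ t) : sys.hist x₀ w s t i = sys.path x₀ w s i := by
  induction t with
  | zero => obtain rfl : i = 0 := by omega
            rfl
  | succ t ih =>
    rcases Nat.lt_or_ge i (t + 1) with h1 | h1
    · rw [← ih (by omega)]
      simp only [hist]
      exact Function.update_of_ne (by omega) _ _
    · obtain rfl : i = t + 1 := by omega
      rfl

theorem estimate_congr {p p' : ℕ → sys.stateSet × sys.ctrlSet} {t : ℕ}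
    (h : ∀ i ≤ t, p i = p' i) : sys.estimate p t = sys.estimate p' t := by
  have hc : sys.rlsCost p t = sys.rlsCost p' t := by
    funext θ
    unfold rlsCost regressor
    congr 1
    refine Finset.sum_congr rfl fun i hi => ?_
    rw [Finset.mem_Icc] at hi
    rw [h i hi.2, h (i - 1) (by omega)]
  unfold estimate
  rw [hc]

section Processes

variable {Ω : Type*} (x₀ : sys.stateSet) (W : ℕ → Ω → sys.noiseSet) (S : ℕ → Ω → sys.explSet)

/-- The state process. -/
def X (t : ℕ) (ω : Ω) : sys.stateSet := (sys.path x₀ (fun i => W i ω) (fun i => S i ω) t).1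

/-- The control process. -/
def U (t : ℕ) (ω : Ω) : sys.ctrlSet := (sys.path x₀ (fun i => W i ω) (fun i => S i ω) t).2

/-- The process of parameter estimates. -/
def θhat (t : ℕ) (ω : Ω) : Matrix (Fin d) (Fin n) ℝ :=
  sys.estimate (sys.path x₀ (fun i => W i ω) (fun i => S i ω)) t

theorem X_zero (ω : Ω) : sys.X x₀ W S 0 ω = x₀ := rfl

theorem X_succ (t : ℕ) (ω : Ω) :
    (sys.X x₀ W S (t + 1) ω : EuclideanSpace ℝ (Fin n)) =
      sys.f (sys.X x₀ W S t ω) (sys.U x₀ W S t ω)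
        + Matrix.toEuclideanLin sys.θstar.transpose
            (sys.ψ (sys.X x₀ W S t ω) (sys.U x₀ W S t ω))
        + W (t + 1) ω := by
  unfold X U path
  simp only [hist, Function.update_self]
  rfl

/-- At `t = 0` the policy is fed `ϑ₀`. -/
theorem U_zero (ω : Ω) : sys.U x₀ W S 0 ω = sys.α (sys.X x₀ W S 0 ω) (S 0 ω) sys.ϑ₀ := rfl

theorem U_succ (t : ℕ) (ω : Ω) :
    sys.U x₀ W S (t + 1) ω =
      sys.α (sys.X x₀ W S (t + 1) ω) (S (t + 1) ω) (sys.θhat x₀ W S t ω) := by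
  have h : sys.θhat x₀ W S t ω
      = sys.estimate (sys.hist x₀ (fun i => W i ω) (fun i => S i ω) t) t :=
    sys.estimate_congr fun i hi => (sys.hist_eq_path x₀ _ _ hi).symm
  rw [h]
  unfold X U path
  simp only [hist, Function.update_self]

end Processes

/-! ### Assumptions -/

/-- `f`, `ψ` and `α` are Borel measurable. -/
structure MeasurableMaps : Prop where
  f : Measurable fun p : sys.stateSet × sys.ctrlSet => sys.f p.1 p.2
  ψ : Measurable fun p : sys.stateSet × sys.ctrlSet => sys.ψ p.1 p.2
  α : Measurable fun p : sys.stateSet × sys.explSet × (Fin d → Fin n → ℝ) =>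
    sys.α p.1 p.2.1 (Matrix.of p.2.2)

/-- The exploratory noise `S 0, S 1, …` is i.i.d. with distribution `μs`. -/
structure ExplNoise {Ω : Type*} [MeasurableSpace Ω] (P : Measure Ω)
    (S : ℕ → Ω → sys.explSet) (μs : Measure sys.explSet) : Prop where
  measurable : ∀ t, Measurable (S t)
  indep : iIndepFun S P
  law : ∀ t, P.map (S t) = μs

/-- The process noise `W 1, W 2, …` is i.i.d. with distribution `μw`, independent of the sequence
`S 0, S 1, …`, zero-mean and `σw ^ 2`-sub-Gaussian in every unit direction.
(`W 0` plays no role.) -/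
structure ProcessNoise {Ω : Type*} [MeasurableSpace Ω] (P : Measure Ω)
    (W : ℕ → Ω → sys.noiseSet) (S : ℕ → Ω → sys.explSet) (μw : Measure sys.noiseSet)
    (σw : ℝ) : Prop where
  measurable : ∀ t, 1 ≤ t → Measurable (W t)
  indep : iIndepFun (fun t : ℕ => W (t + 1)) P
  law : ∀ t, 1 ≤ t → P.map (W t) = μw
  indep_expl : IndepFun (fun ω (t : ℕ) => W (t + 1) ω) (fun ω (t : ℕ) => S t ω) P
  zero_mean : ∀ t, 1 ≤ t → ∫ ω, (W t ω : EuclideanSpace ℝ (Fin n)) ∂P = 0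
  subGaussian : ∀ t, 1 ≤ t → ∀ ζ : EuclideanSpace ℝ (Fin n), ‖ζ‖ = 1 →
    HasSubgaussianMGF (fun ω => inner ℝ ζ (W t ω : EuclideanSpace ℝ (Fin n)))
      ⟨σw ^ 2, sq_nonneg σw⟩ P

end ClosedLoopSystem

/-- Comparison functions and constants of the growth assumptions. -/
structure GrowthData where
  χ₁ : ℝ → ℝ
  χ₂ : ℝ → ℝ
  χ₃ : ℝ → ℝ
  χ₄ : ℝ → ℝ
  χ₅ : ℝ → ℝ
  σ₁ : ℝ → ℝ
  σ₂ : ℝ → ℝ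
  c₁ : ℝ
  umax : ℝ

namespace ClosedLoopSystem

variable {n m d q : ℕ} (sys : ClosedLoopSystem n m d q) (D : GrowthData)

/-- Sub-exponential input-to-state bound on reachable states. -/
structure InputToStateBound : Prop where
  χ₁ : ClassKInfty D.χ₁ ∧ SubExpOrder 1 D.χ₁
  χ₂ : ClassKInfty D.χ₂
  χ₃ : ClassKInfty D.χ₃ ∧ SubExpOrder 1 D.χ₃
  χ₄ : ClassKInfty D.χ₄ ∧ SubExpOrder 2 D.χ₄
  σ₁ : ClassKInfty D.σ₁
  σ₂ : ClassKInfty D.σ₂ ∧ SubExpOrder 1 D.σ₂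
  c₁ : 0 ≤ D.c₁
  bound : ∀ (t : ℕ), 1 ≤ t → ∀ (ξ : sys.stateSet) (u : ℕ → sys.ctrlSet) (w : ℕ → sys.noiseSet),
    ‖(sys.detSol ξ u w t : EuclideanSpace ℝ (Fin n))‖ ≤
      D.χ₁ t + D.χ₂ ‖(ξ : EuclideanSpace ℝ (Fin n))‖
        + D.χ₃ (∑ i ∈ Finset.range t, D.σ₁ ‖(u i : EuclideanSpace ℝ (Fin m))‖)
        + D.χ₄ (∑ i ∈ Finset.Icc 1 t, D.σ₂ ‖(w i : EuclideanSpace ℝ (Fin n))‖) + D.c₁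

/-- The policy has values of magnitude at most `umax`. -/
structure ConstrainedControls : Prop where
  umax : 0 ≤ D.umax
  bound : ∀ (x : sys.stateSet) (s : sys.explSet) (ϑ : Matrix (Fin d) (Fin n) ℝ),
    ‖(sys.α x s ϑ : EuclideanSpace ℝ (Fin m))‖ ≤ D.umax

/-- The basis functions are bounded by a nonnegative, nondecreasing, asymptotically polynomially
bounded function of the magnitude of the stacked vector `(x, u)`. -/
structure APBFeatures : Prop where
  nonneg : ∀ r, 0 ≤ r → 0 ≤ D.χ₅ r
  mono : MonotoneOn D.χ₅ (Set.Ici 0)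
  apb : IsAPB D.χ₅
  bound : ∀ (x : sys.stateSet) (u : sys.ctrlSet),
    ‖sys.ψ x u‖ ≤ D.χ₅ (Real.sqrt (‖(x : EuclideanSpace ℝ (Fin n))‖ ^ 2
      + ‖(u : EuclideanSpace ℝ (Fin m))‖ ^ 2))

/-- `(𝒳, c, p)`-regional excitation, for `𝒳` a subset of the state space: for all `ϑ`, `x ∈ 𝒳` and
unit `ζ`, the probability under `μs × μw` that `|ζᵀ ψ (x + W, α (x + W, S, ϑ))|² ≥ c` is at least
`p`.  (The expression is defined when `x + W` is a state, so this is part of the event.) -/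
def RegionallyExcited (μs : Measure sys.explSet) (μw : Measure sys.noiseSet)
    (𝒳 : Set (EuclideanSpace ℝ (Fin n))) (c p : ℝ) : Prop :=
  ∀ (ϑ : Matrix (Fin d) (Fin n) ℝ), ∀ x ∈ 𝒳, ∀ ζ : EuclideanSpace ℝ (Fin d), ‖ζ‖ = 1 →
    ENNReal.ofReal p ≤ (μs.prod μw) {sw : sys.explSet × sys.noiseSet |
      ∃ h : x + (sw.2 : EuclideanSpace ℝ (Fin n)) ∈ sys.stateSet,
        c ≤ |inner ℝ ζ (sys.ψ ⟨x + sw.2, h⟩ (sys.α ⟨x + sw.2, h⟩ sw.1 ϑ))| ^ 2}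

/-- `(c, p)`-global excitation. -/
def GloballyExcited (μs : Measure sys.explSet) (μw : Measure sys.noiseSet) (c p : ℝ) : Prop :=
  sys.RegionallyExcited μs μw sys.stateSet c p

/-! ### Bounds -/

/-- Process noise bound `w̄ (t, δ)` in dimension `n`. -/
def wBar (n : ℕ) (σw : ℝ) (t : ℕ) (δ : ℝ) : ℝ :=
  if t = 0 then 0
  else σw * Real.sqrt (2 * n * Real.log (n * Real.pi ^ 2 * (t : ℝ) ^ 2 / (3 * δ)))

/-- State bound `x̄ (t, δ, x₀)`. -/
def xBar (σw : ℝ) (t : ℕ) (δ : ℝ) (x₀ : sys.stateSet) : ℝ :=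
  D.χ₁ t + D.χ₂ ‖(x₀ : EuclideanSpace ℝ (Fin n))‖ + D.χ₃ (t * D.σ₁ D.umax)
    + D.χ₄ (t * D.σ₂ (wBar n σw t δ)) + D.c₁

/-- Regressor bound `z̄ (t, δ, x₀)`, for `t ≥ 1`. -/
def zBar (σw : ℝ) (t : ℕ) (δ : ℝ) (x₀ : sys.stateSet) : ℝ :=
  D.χ₅ (Real.sqrt (sys.xBar D σw (t - 1) δ x₀ ^ 2 + D.umax ^ 2))

/-- Gramian upper bound. -/
def βmax (σw : ℝ) (t : ℕ) (δ : ℝ) (x₀ : sys.stateSet) : ℝ :=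
  ∑ i ∈ Finset.Icc 1 t, sys.zBar D σw i δ x₀ ^ 2 + sys.γ

/-- One-step predicted reachable set `Γ (𝒳)`. -/
def reachPred (𝒳 : Set (EuclideanSpace ℝ (Fin n))) : Set (EuclideanSpace ℝ (Fin n)) :=
  {y | ∃ (x : sys.stateSet) (u : sys.ctrlSet), (x : EuclideanSpace ℝ (Fin n)) ∈ 𝒳 ∧
    ‖(u : EuclideanSpace ℝ (Fin m))‖ ≤ D.umax ∧ y = sys.g x u 0}

/-- Excited time bound for the excited region `XPE`, in `ℕ ∪ {∞}`. -/
def Texcited (σw : ℝ) (XPE : Set (EuclideanSpace ℝ (Fin n))) (δ : ℝ) (x₀ : sys.stateSet) : ℕ∞ :=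
  sSup {T' : ℕ∞ | ∃ T : ℕ, T' = T ∧ 1 ≤ T ∧
    sys.reachPred D (Metric.closedBall 0 (sys.xBar D σw (T - 1) (δ / 3) x₀) ∩ sys.stateSet) ⊆ XPE}

/-- Burn-in time bound, in `ℕ ∪ {∞}`. The infimum of the empty set is `∞`. No `T = 1` satisfies
the condition, whatever value is given to the quotient by `t - 1` at `t = 1`, because
`π ^ 2 / (2 δ) > 1`. -/
def Tburnin (σw c p : ℝ) (δ : ℝ) (x₀ : sys.stateSet) : ℕ∞ :=
  sInf {T' : ℕ∞ | ∃ T : ℕ, T' = T ∧ 1 ≤ T ∧ ∀ t : ℕ, T ≤ t →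
    2 / ((1 - Real.log 2) * p) *
        (d * Real.log (1 + 16 * (∑ i ∈ Finset.Icc 1 t, sys.zBar D σw i (δ / 3) x₀ ^ 2)
            / (c * p * ((t : ℝ) - 1)))
          + Real.log (Real.pi ^ 2 * ((t : ℝ) - T + 1) ^ 2 / (2 * δ))) + 1 ≤ (t : ℝ)}

/-- Error bound `e (t, δ, x₀)`. -/
def errBound (σw c p : ℝ) (t : ℕ) (δ : ℝ) (x₀ : sys.stateSet) : ℝ :=
  1 / Real.sqrt (c * p / 4 * ((t : ℝ) - 1) + sys.γ) *
    (Real.sqrt sys.γ * matFrobNorm sys.θstar +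
      σw * Real.sqrt (2 * n * (Real.log (3 * n / δ)
        + (d : ℝ) / 2 * Real.log (sys.βmax D σw t (δ / 3) x₀ * sys.γ⁻¹))))

end ClosedLoopSystem

end

noncomputable section

/-! ### Linear algebra of regularised Gram matrices -/

section GramMatrix

open Matrix

variable {d : ℕ}

/-! Divide the regressors by `√γ`. The estimation error `E` of ridge regression then satisfies,
column by column, `V Eⱼ = γ^(-1/2) Sⱼ - θⱼ`, where `V = 1 + ∑ z zᵀ` and `Sⱼ` is the noise-weighted
sum of the regressors. The error is small once `V` is large in every direction and `Sⱼ` is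
controlled in the metric of `V`. Three events, each failing with probability at most `δ/3`, provide
this at all times after the burn-in.

Noise. A sub-Gaussian tail and `∑ 1/k² = π²/6` bound all `W(t)` by `w̄(t)`. The input-to-state bound
then gives `|X(t)| ≤ x̄(t)` for `t ≥ 1`, hence `|Z(s)| ≤ z̄(s)` for `s ≥ 2`.

Excitation. Given the past up to `t`, the state, control and estimate are frozen and `(S(t+1),
W(t+1))` is fresh. The predicted state `g(X(t), U(t), 0)` is again a state, so global excitation
applies: in any fixed direction `Z(t+2)` is exciting with conditional probability at least `p`. The
Chernoff bound `measure_count_lt_le` treats one direction and a sphere net treats all of them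
(`gram_lower_bound_of_net`). The burn-in inequality says exactly that net size times Chernoff tail
is summable over time to `δ/3`.

Self-normalisation. Mixing exponential tilts over a Gaussian parameter gives a nonnegative
supermartingale, and Ville's inequality makes the resulting bound on `Sⱼ` uniform in time
(`self_normalized_bound`).

The delicate point is the first regressor. The state bound is assumed only at positive times, so
`z̄(1)` need not dominate `Z(1)`, and the usual bound through `log det V` would let `Z(1)` into the
result. But `Z(1)` is known at time `0`, so the prior precision of the mixture may depend on it.
With the choice `priorMat`, an oversized first regressor either cancels in the determinant ratio or
is paid for by the square of `V` (`inv_mulVec_sq_le_of_priorMat`). No constant in the stated bound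
is lost.

Finally, the growth classes make `x̄`, `z̄` and `∑ z̄²` grow more slowly than every exponential
(`SubExpSeq`), so their logarithms are `o(t)`. Therefore the burn-in inequality eventually holds and
the error bound tends to zero. -/

theorem Matrix.vecMulVec_mulVec_eq_smul (u v w : Fin d → ℝ) :
    vecMulVec u v *ᵥ w = (v ⬝ᵥ w) • u := by
  ext i
  simp [Matrix.mulVec, dotProduct, vecMulVec_apply, Finset.mul_sum, mul_comm, mul_left_comm]

theorem Matrix.isHermitian_vecMulVec_self (z : Fin d → ℝ) : (vecMulVec z z).IsHermitian := by
  ext i j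
  simp [vecMulVec_apply, mul_comm]

theorem Matrix.dotProduct_vecMulVec_self (z x : Fin d → ℝ) :
    x ⬝ᵥ vecMulVec z z *ᵥ x = (z ⬝ᵥ x) ^ 2 := by
  rw [vecMulVec_mulVec_eq_smul, dotProduct_smul, dotProduct_comm x z, smul_eq_mul, sq]

theorem Matrix.IsHermitian.dotProduct_mulVec_comm {A : Matrix (Fin d) (Fin d) ℝ}
    (hA : A.IsHermitian) (x y : Fin d → ℝ) : x ⬝ᵥ A *ᵥ y = y ⬝ᵥ A *ᵥ x := by
  have h : Aᵀ = A := by simpa [Matrix.IsHermitian, conjTranspose] using hA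
  rw [dotProduct_mulVec, ← mulVec_transpose, h, dotProduct_comm]

theorem dotProduct_self_nonneg' (x : Fin d → ℝ) : 0 ≤ x ⬝ᵥ x :=
  Finset.sum_nonneg fun i _ => mul_self_nonneg (x i)

theorem dotProduct_sq_le (x y : Fin d → ℝ) : (x ⬝ᵥ y) ^ 2 ≤ (x ⬝ᵥ x) * (y ⬝ᵥ y) := by
  have := Finset.sum_mul_sq_le_sq_mul_sq Finset.univ x y
  simpa [dotProduct, sq] using this

theorem Matrix.posDef_of_le {A : Matrix (Fin d) (Fin d) ℝ} (hA : A.IsHermitian) {r : ℝ}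
    (hr : 0 < r) (h : ∀ x, r * (x ⬝ᵥ x) ≤ x ⬝ᵥ A *ᵥ x) : A.PosDef := by
  refine Matrix.PosDef.of_dotProduct_mulVec_pos hA fun x hx => ?_
  have h1 : 0 < x ⬝ᵥ x := by
    refine lt_of_le_of_ne (dotProduct_self_nonneg' x) fun h0 => hx ?_
    exact dotProduct_self_eq_zero.1 h0.symm
  simpa using (mul_pos hr h1).trans_le (h x)

theorem Matrix.PosDef.dotProduct_nonneg {A : Matrix (Fin d) (Fin d) ℝ} (hA : A.PosDef)
    (x : Fin d → ℝ) : 0 ≤ x ⬝ᵥ A *ᵥ x := by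
  simpa using hA.posSemidef.dotProduct_mulVec_nonneg x

theorem Matrix.PosDef.mulVec_inv {A : Matrix (Fin d) (Fin d) ℝ} (hA : A.PosDef)
    (x : Fin d → ℝ) : A *ᵥ (A⁻¹ *ᵥ x) = x := by
  rw [mulVec_mulVec, mul_nonsing_inv _ ((isUnit_iff_isUnit_det A).1 hA.isUnit), one_mulVec]

theorem Matrix.PosDef.inv_mulVec {A : Matrix (Fin d) (Fin d) ℝ} (hA : A.PosDef)
    (x : Fin d → ℝ) : A⁻¹ *ᵥ (A *ᵥ x) = x := by
  rw [mulVec_mulVec, nonsing_inv_mul _ ((isUnit_iff_isUnit_det A).1 hA.isUnit), one_mulVec]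

theorem Matrix.PosDef.det_add_vecMulVec {A : Matrix (Fin d) (Fin d) ℝ} (hA : A.PosDef)
    (z : Fin d → ℝ) : (A + vecMulVec z z).det = A.det * (1 + z ⬝ᵥ A⁻¹ *ᵥ z) := by
  rw [vecMulVec_eq Unit, det_add_replicateCol_mul_replicateRow
    ((isUnit_iff_isUnit_det A).1 hA.isUnit), Matrix.mul_assoc, ]
  congr 1
  rw [det_unique]
  simp [Matrix.mul_apply, dotProduct, mulVec, replicateRow, replicateCol]

/-- Rank-one update of the quadratic form of the inverse. -/
theorem Matrix.PosDef.dotProduct_inv_add_vecMulVec {A : Matrix (Fin d) (Fin d) ℝ} (hA : A.PosDef)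
    (z S : Fin d → ℝ) (w : ℝ) :
    (S + w • z) ⬝ᵥ (A + vecMulVec z z)⁻¹ *ᵥ (S + w • z) =
      S ⬝ᵥ A⁻¹ *ᵥ S + (2 * w * (z ⬝ᵥ A⁻¹ *ᵥ S) + (z ⬝ᵥ A⁻¹ *ᵥ z) * w ^ 2
        - (z ⬝ᵥ A⁻¹ *ᵥ S) ^ 2) / (1 + z ⬝ᵥ A⁻¹ *ᵥ z) := by
  set q := z ⬝ᵥ A⁻¹ *ᵥ z with hq
  set b := z ⬝ᵥ A⁻¹ *ᵥ S with hb
  have hq0 : 0 ≤ q := hA.inv.dotProduct_nonneg z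
  have hA' : (A + vecMulVec z z).PosDef :=
    hA.add_posSemidef (by simpa using posSemidef_vecMulVec_self_star z)
  -- The Sherman–Morrison solution of the updated system, verified by multiplying back. The
  -- correction along `A⁻¹ z` is the innovation `w - b` discounted by `1 + q`.
  have hx : (A + vecMulVec z z)⁻¹ *ᵥ (S + w • z)
      = A⁻¹ *ᵥ S + ((w - b) / (1 + q)) • A⁻¹ *ᵥ z := by
    rw [← hA'.inv_mulVec (A⁻¹ *ᵥ S + ((w - b) / (1 + q)) • A⁻¹ *ᵥ z)]
    congr 1
    rw [add_mulVec, mulVec_add, mulVec_smul, hA.mulVec_inv, hA.mulVec_inv,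
      vecMulVec_mulVec_eq_smul, dotProduct_add, dotProduct_smul, ← hq, ← hb, add_assoc,
      ← add_smul, smul_eq_mul]
    congr 2
    field_simp
    ring
  have hs : S ⬝ᵥ A⁻¹ *ᵥ z = b := hA.inv.isHermitian.dotProduct_mulVec_comm S z
  rw [hx, dotProduct_add, add_dotProduct, add_dotProduct, dotProduct_smul, dotProduct_smul,
    smul_dotProduct, smul_dotProduct, hs, ← hq, ← hb]
  simp only [smul_eq_mul]
  field_simp
  ring

/-- Cauchy–Schwarz between the dual norms of `A` and `A⁻¹`: the form of `A` at `x - τ A⁻¹ S` is a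
nonnegative quadratic in `τ`, so its discriminant is nonpositive. -/
theorem Matrix.PosDef.sq_dotProduct_le {A : Matrix (Fin d) (Fin d) ℝ} (hA : A.PosDef)
    (x S : Fin d → ℝ) : (x ⬝ᵥ S) ^ 2 ≤ (x ⬝ᵥ A *ᵥ x) * (S ⬝ᵥ A⁻¹ *ᵥ S) := by
  have key : ∀ τ : ℝ, 0 ≤ (S ⬝ᵥ A⁻¹ *ᵥ S) * (τ * τ) + (-2 * (x ⬝ᵥ S)) * τ + x ⬝ᵥ A *ᵥ x := by
    intro τ
    have h := hA.dotProduct_nonneg (x - τ • A⁻¹ *ᵥ S)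
    rw [mulVec_sub, mulVec_smul, hA.mulVec_inv, dotProduct_sub, sub_dotProduct, sub_dotProduct,
      dotProduct_smul, dotProduct_smul, smul_dotProduct, smul_dotProduct] at h
    have h2 : (A⁻¹ *ᵥ S) ⬝ᵥ A *ᵥ x = x ⬝ᵥ S := by
      rw [hA.isHermitian.dotProduct_mulVec_comm, hA.mulVec_inv]
    rw [h2, dotProduct_comm (A⁻¹ *ᵥ S) S] at h
    simp only [smul_eq_mul] at h
    nlinarith [h]
  have := discrim_le_zero key
  unfold discrim at this
  nlinarith [this]

/-- This changes metric: the supermartingale controls `S` through `A⁻¹`, while the estimator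
involves `V⁻¹ S`. With `y = V⁻¹ S` one has `|y|² = ⟨V⁻¹ y, S⟩`. The dual Cauchy–Schwarz inequality
and the comparison of `A` with `V²` at `V⁻¹ y` then finish after cancelling `|y|²`. -/
theorem Matrix.PosDef.inv_mulVec_sq_le {A V : Matrix (Fin d) (Fin d) ℝ} (hA : A.PosDef)
    (hV : V.PosDef) {h φ : ℝ} (hφ : 0 ≤ φ)
    (hle : ∀ x, h * (x ⬝ᵥ A *ᵥ x) ≤ φ * ((V *ᵥ x) ⬝ᵥ (V *ᵥ x))) (S : Fin d → ℝ) :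
    h * ((V⁻¹ *ᵥ S) ⬝ᵥ (V⁻¹ *ᵥ S)) ≤ φ * (S ⬝ᵥ A⁻¹ *ᵥ S) := by
  set y := V⁻¹ *ᵥ S with hy
  set Q := S ⬝ᵥ A⁻¹ *ᵥ S
  have hQ : 0 ≤ Q := hA.inv.dotProduct_nonneg S
  have h1 := hA.sq_dotProduct_le (V⁻¹ *ᵥ y) S
  have h2 := hle (V⁻¹ *ᵥ y)
  have h3 : (V⁻¹ *ᵥ y) ⬝ᵥ S = y ⬝ᵥ y := by
    rw [dotProduct_comm, hV.inv.isHermitian.dotProduct_mulVec_comm]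
  rw [hV.mulVec_inv] at h2
  rw [h3] at h1
  rcases (dotProduct_self_nonneg' y).eq_or_lt with h0 | h0
  · rw [← h0, mul_zero]
    positivity
  · rcases le_or_gt h 0 with hh | hh
    · exact (mul_nonpos_of_nonpos_of_nonneg hh h0.le).trans (by positivity)
    have h4 : h * (y ⬝ᵥ y) ^ 2 ≤ φ * (y ⬝ᵥ y) * Q := by
      calc h * (y ⬝ᵥ y) ^ 2 ≤ h * ((V⁻¹ *ᵥ y ⬝ᵥ A *ᵥ (V⁻¹ *ᵥ y)) * Q) := by gcongr
        _ = (h * (V⁻¹ *ᵥ y ⬝ᵥ A *ᵥ (V⁻¹ *ᵥ y))) * Q := by ring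
        _ ≤ φ * (y ⬝ᵥ y) * Q := by gcongr
    nlinarith [h4, h0]

/-- The determinant of a positive semidefinite matrix is at most the `d`-th power of the mean of
its eigenvalues. -/
theorem Matrix.PosSemidef.det_le_trace_div_pow {A : Matrix (Fin d) (Fin d) ℝ}
    (hA : A.PosSemidef) (hd : 1 ≤ d) : A.det ≤ (A.trace / d) ^ d := by
  rw [hA.isHermitian.det_eq_prod_eigenvalues, hA.isHermitian.trace_eq_sum_eigenvalues]
  have hd' : (0 : ℝ) < d := by exact_mod_cast hd
  have h := Real.geom_mean_le_arith_mean Finset.univ (fun _ : Fin d => (1 : ℝ))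
    hA.isHermitian.eigenvalues (fun _ _ => zero_le_one) (by simpa using hd')
    (fun i _ => hA.eigenvalues_nonneg i)
  simp only [Real.rpow_one, Finset.sum_const, Finset.card_univ, Fintype.card_fin, nsmul_eq_mul,
    mul_one, one_mul] at h
  have hp : 0 ≤ ∏ i, hA.isHermitian.eigenvalues i :=
    Finset.prod_nonneg fun i _ => hA.eigenvalues_nonneg i
  have h2 := pow_le_pow_left₀ (Real.rpow_nonneg hp _) h d
  rw [← Real.rpow_natCast, ← Real.rpow_mul hp, inv_mul_cancel₀ hd'.ne', Real.rpow_one] at h2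
  simpa using h2

end GramMatrix

/-! ### Mixture prior and elimination of the first regressor. -/

section PriorComparison

open Matrix

variable {d : ℕ}

/-- Prior precision of the method of mixtures, as a function of the first regressor `z`. Its choice
makes the confidence bound insensitive to the size of `z`. -/
def priorMat (d : ℕ) (z : Fin d → ℝ) : Matrix (Fin d) (Fin d) ℝ :=
  if d = 1 then 1
  else if z ⬝ᵥ z ≤ 1 then (1 / 2 : ℝ) • 1
  else (3 / 4 : ℝ) • 1 + vecMulVec z z

theorem dotProduct_smul_one_mulVec (r : ℝ) (x : Fin d → ℝ) :
    x ⬝ᵥ (r • (1 : Matrix (Fin d) (Fin d) ℝ)) *ᵥ x = r * (x ⬝ᵥ x) := by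
  rw [smul_mulVec, one_mulVec, dotProduct_smul, smul_eq_mul]

theorem isHermitian_smul_one (r : ℝ) : (r • (1 : Matrix (Fin d) (Fin d) ℝ)).IsHermitian := by
  ext i j
  by_cases h : i = j
  · simp [h]
  · simp [h, Ne.symm h]

theorem priorMat_isHermitian (z : Fin d → ℝ) : (priorMat d z).IsHermitian := by
  unfold priorMat
  split_ifs
  · exact isHermitian_one
  · exact isHermitian_smul_one _
  · exact (isHermitian_smul_one _).add (isHermitian_vecMulVec_self z)

theorem half_le_priorMat (z x : Fin d → ℝ) :
    (1 / 2 : ℝ) * (x ⬝ᵥ x) ≤ x ⬝ᵥ priorMat d z *ᵥ x := by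
  have h0 := dotProduct_self_nonneg' x
  unfold priorMat
  split_ifs
  · rw [one_mulVec]; linarith
  · rw [dotProduct_smul_one_mulVec]
  · rw [add_mulVec, dotProduct_add, dotProduct_smul_one_mulVec, dotProduct_vecMulVec_self]
    nlinarith [sq_nonneg (z ⬝ᵥ x)]

theorem priorMat_posDef (z : Fin d → ℝ) : (priorMat d z).PosDef :=
  posDef_of_le (priorMat_isHermitian z) (by norm_num : (0 : ℝ) < 1 / 2) (half_le_priorMat z)

variable {G : Matrix (Fin d) (Fin d) ℝ} {z : Fin d → ℝ} {g κ : ℝ}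

theorem posDef_smul_one_add_vecMulVec_add (hG : G.IsHermitian)
    (hg : ∀ x, g * (x ⬝ᵥ x) ≤ x ⬝ᵥ G *ᵥ x) (hg0 : 0 ≤ g) {r k : ℝ} (hr : 0 < r) (hk : 0 ≤ k) :
    (r • (1 : Matrix (Fin d) (Fin d) ℝ) + k • vecMulVec z z + G).PosDef := by
  refine posDef_of_le (((isHermitian_smul_one r).add ?_).add hG) hr fun x => ?_
  · ext i j
    simp [vecMulVec_apply, mul_comm]
  · rw [add_mulVec, add_mulVec, dotProduct_add, dotProduct_add, dotProduct_smul_one_mulVec,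
      smul_mulVec, dotProduct_smul, dotProduct_vecMulVec_self, smul_eq_mul]
    have h1 := hg x
    have h2 := mul_nonneg hg0 (dotProduct_self_nonneg' x)
    have h3 := mul_nonneg hk (sq_nonneg (z ⬝ᵥ x))
    linarith

theorem quadForm_smul_one_add_vecMulVec_add (r k : ℝ) (x : Fin d → ℝ) :
    x ⬝ᵥ (r • (1 : Matrix (Fin d) (Fin d) ℝ) + k • vecMulVec z z + G) *ᵥ x =
      r * (x ⬝ᵥ x) + k * (z ⬝ᵥ x) ^ 2 + x ⬝ᵥ G *ᵥ x := by
  rw [add_mulVec, add_mulVec, dotProduct_add, dotProduct_add, dotProduct_smul_one_mulVec,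
      smul_mulVec, dotProduct_smul, dotProduct_vecMulVec_self, smul_eq_mul]

/-- With `N = G - g` and `s = ⟨z, x⟩`, the squared norm of `(1 + z zᵀ + G) x`. -/
theorem one_add_vecMulVec_add_mulVec_sq (x : Fin d → ℝ) :
    (((1 : Matrix (Fin d) (Fin d) ℝ) + vecMulVec z z + G) *ᵥ x) ⬝ᵥ
        ((1 + vecMulVec z z + G) *ᵥ x) =
      (1 + g) * ((1 + g) * (x ⬝ᵥ x) + 2 * (z ⬝ᵥ x) ^ 2
        + 2 * (x ⬝ᵥ G *ᵥ x - g * (x ⬝ᵥ x)))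
      + ((z ⬝ᵥ x) • z + (G *ᵥ x - g • x)) ⬝ᵥ ((z ⬝ᵥ x) • z + (G *ᵥ x - g • x)) := by
  have h1 : ((1 : Matrix (Fin d) (Fin d) ℝ) + vecMulVec z z + G) *ᵥ x
      = (1 + g) • x + ((z ⬝ᵥ x) • z + (G *ᵥ x - g • x)) := by
    rw [add_mulVec, add_mulVec, one_mulVec, vecMulVec_mulVec_eq_smul]
    module
  rw [h1]
  generalize hu : (z ⬝ᵥ x) • z + (G *ᵥ x - g • x) = u
  have hxu : x ⬝ᵥ u = (z ⬝ᵥ x) ^ 2 + (x ⬝ᵥ G *ᵥ x - g * (x ⬝ᵥ x)) := by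
    rw [← hu, dotProduct_add, dotProduct_sub, dotProduct_smul, dotProduct_smul,
      dotProduct_comm x z, smul_eq_mul, smul_eq_mul]
    ring
  rw [add_dotProduct, dotProduct_add, dotProduct_add, smul_dotProduct, smul_dotProduct,
    dotProduct_smul, dotProduct_smul, dotProduct_comm u x, hxu]
  simp only [smul_eq_mul]
  ring

/-- For `N = G - g` positive semidefinite with `N ≤ ν`, one has `|N x|² ≤ ν ⟨x, N x⟩`. -/
theorem mulVec_sub_sq_le (hG : G.IsHermitian) (hg : ∀ x, g * (x ⬝ᵥ x) ≤ x ⬝ᵥ G *ᵥ x)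
    (hκ : ∀ x, x ⬝ᵥ G *ᵥ x ≤ κ * (x ⬝ᵥ x)) (x : Fin d → ℝ) :
    (G *ᵥ x - g • x) ⬝ᵥ (G *ᵥ x - g • x) ≤ (κ - g) * (x ⬝ᵥ G *ᵥ x - g * (x ⬝ᵥ x)) := by
  set y := G *ᵥ x - g • x with hy
  have key : ∀ τ : ℝ, 0 ≤ (y ⬝ᵥ G *ᵥ y - g * (y ⬝ᵥ y)) * (τ * τ) + (2 * (y ⬝ᵥ y)) * τ
      + (x ⬝ᵥ G *ᵥ x - g * (x ⬝ᵥ x)) := by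
    intro τ
    have h := hg (x + τ • y)
    simp only [mulVec_add, mulVec_smul, add_dotProduct, dotProduct_add, dotProduct_smul,
      smul_dotProduct, smul_eq_mul, hG.dotProduct_mulVec_comm x y, dotProduct_comm x y] at h
    have h2 : y ⬝ᵥ y = y ⬝ᵥ G *ᵥ x - g * (y ⬝ᵥ x) := by
      rw [← smul_eq_mul, ← dotProduct_smul, ← dotProduct_sub]
    have h4 : (y ⬝ᵥ y) * τ = (y ⬝ᵥ G *ᵥ x - g * (y ⬝ᵥ x)) * τ := by rw [← h2]
    nlinarith [h, h4]
  have h1 := discrim_le_zero key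
  unfold discrim at h1
  have h2 : y ⬝ᵥ G *ᵥ y - g * (y ⬝ᵥ y) ≤ (κ - g) * (y ⬝ᵥ y) := by
    linarith [hκ y]
  have h3 : 0 ≤ x ⬝ᵥ G *ᵥ x - g * (x ⬝ᵥ x) := by linarith [hg x]
  rcases (dotProduct_self_nonneg' y).eq_or_lt with h0 | h0
  · rw [← h0]
    rcases (dotProduct_self_nonneg' x).eq_or_lt with hx | hx
    · have : x = 0 := dotProduct_self_eq_zero.1 hx.symm
      simp [this]
    · have : g ≤ κ := le_of_mul_le_mul_right ((hg x).trans (hκ x)) hx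
      exact mul_nonneg (by linarith) h3
  · have h4 : (y ⬝ᵥ y) ^ 2 ≤ (κ - g) * (y ⬝ᵥ y) * (x ⬝ᵥ G *ᵥ x - g * (x ⬝ᵥ x)) := by
      nlinarith [mul_le_mul_of_nonneg_right h2 h3]
    nlinarith [h4, h0]

theorem card_mul_le_trace (hg : ∀ x, g * (x ⬝ᵥ x) ≤ x ⬝ᵥ G *ᵥ x) : d * g ≤ G.trace := by
  have : ∀ i : Fin d, g ≤ G i i := by
    intro i
    have := hg (Pi.single i 1)
    simpa using this
  calc (d : ℝ) * g = ∑ _i : Fin d, g := by simp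
    _ ≤ G.trace := Finset.sum_le_sum fun i _ => this i

/-- Linearising `log` at `1 + κ` shows that, for `d ≥ 2` and `ℓ ≤ 1`, the determinant bound exceeds
`d log (1 + κ)` by at most `2 / (1 + κ)`. Since `a ≥ 2`, this is a relative excess of at most `1 /
(1 + κ)`, and the prefactor is the reciprocal of `1 + 1 / (1 + κ)`. -/
theorem two_mul_log_le {a κ ℓ : ℝ} {d : ℕ} (hd : 2 ≤ d) (hκ : 0 ≤ κ) (hℓ0 : 0 ≤ ℓ) (hℓ : ℓ ≤ 1)
    (ha : 2 ≤ a) :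
    (1 + κ) / (2 + κ) * (a + d * Real.log (1 + 2 * (κ + ℓ) / d)) ≤
      a + d * Real.log (1 + κ) := by
  have hd' : (2 : ℝ) ≤ d := by exact_mod_cast hd
  have h1 : Real.log (1 + 2 * (κ + ℓ) / d) ≤ Real.log (1 + κ) +
      ((1 + 2 * (κ + ℓ) / d) / (1 + κ) - 1) := by
    have := Real.log_le_sub_one_of_pos (x := (1 + 2 * (κ + ℓ) / d) / (1 + κ)) (by positivity)
    rw [Real.log_div (by positivity) (by positivity)] at this
    linarith
  have h2 : d * ((1 + 2 * (κ + ℓ) / d) / (1 + κ) - 1) ≤ 2 / (1 + κ) := by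
    have : d * ((1 + 2 * (κ + ℓ) / d) / (1 + κ) - 1) = (2 * (κ + ℓ) - d * κ) / (1 + κ) := by
      field_simp
      ring
    rw [this]
    gcongr
    nlinarith
  have hL : 0 ≤ Real.log (1 + κ) := Real.log_nonneg (by linarith)
  have h3 : a + d * Real.log (1 + 2 * (κ + ℓ) / d) ≤ a + d * Real.log (1 + κ) + 2 / (1 + κ) := by
    have := mul_le_mul_of_nonneg_left h1 (by linarith : (0 : ℝ) ≤ d)
    linarith
  have h4 : (0 : ℝ) ≤ d * Real.log (1 + κ) := by positivity
  have h5 : 2 / (1 + κ) ≤ (a + d * Real.log (1 + κ)) / (1 + κ) := by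
    gcongr
    linarith
  calc _ ≤ (1 + κ) / (2 + κ) * (a + d * Real.log (1 + κ) + (a + d * Real.log (1 + κ)) / (1 + κ)) := by
        exact mul_le_mul_of_nonneg_left (by linarith) (by positivity)
    _ = a + d * Real.log (1 + κ) := by
        field_simp
        ring

/-- Numerical core of the large-regressor case, used with `q = 1 + κ`: it absorbs the factor `2`
left over in the determinant ratio. -/
theorem log_two_le_of_one_le {q : ℝ} (hq : 1 ≤ q) :
    Real.log 2 ≤ (2 * Real.log 3 + 2 * Real.log q) / (4 * q - 1)
      + 2 * Real.log (3 * q / (1 + 2 * q)) := by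
  have h2 := Real.log_two_lt_d9
  have h3 : (1.0986 : ℝ) ≤ Real.log 3 := by
    have := Real.log_three_gt_d9
    linarith
  have hlq : 0 ≤ Real.log q := Real.log_nonneg hq
  have hq1 : 0 < 4 * q - 1 := by linarith
  -- Beyond `8.3` one has `(3q / (1 + 2q))² ≥ 2`, so the last term suffices alone. Below it,
  -- elementary lower bounds for the logarithms leave a concave quadratic that is positive on the
  -- interval.
  rcases le_or_gt q 8.3 with h | h
  · have h4 : (q - 1) / (3 * q) ≤ Real.log (3 * q / (1 + 2 * q)) := by
      have := Real.log_le_sub_one_of_pos (x := (1 + 2 * q) / (3 * q)) (by positivity)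
      rw [← inv_div (1 + 2 * q), Real.log_inv]
      have h5 : (1 + 2 * q) / (3 * q) - 1 = -((q - 1) / (3 * q)) := by
        field_simp
        ring
      linarith
    have h5 : 1 - 1 / q ≤ Real.log q := by
      have := Real.one_sub_inv_le_log_of_pos (by linarith : 0 < q)
      simpa using this
    have h6 : (2 * 1.0986 + 2 * (1 - 1 / q)) / (4 * q - 1) + 2 * ((q - 1) / (3 * q)) ≥ 0.6931471808 := by
      rw [ge_iff_le, ← sub_nonneg]
      have : (2 * 1.0986 + 2 * (1 - 1 / q)) / (4 * q - 1) + 2 * ((q - 1) / (3 * q)) - 0.6931471808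
         = ((2 * 1.0986 * q + 2 * (q - 1)) * 3 + 2 * (q - 1) * (4 * q - 1)
            - 0.6931471808 * (3 * q) * (4 * q - 1)) / (3 * q * (4 * q - 1)) := by
        have hr : 4 * q - 1 ≠ 0 := hq1.ne'
        generalize 4 * q - 1 = r at hr ⊢
        have : q ≠ 0 := by positivity
        field_simp
      rw [this]
      apply div_nonneg _ (by positivity)
      nlinarith
    have h7 : (2 * 1.0986 + 2 * (1 - 1 / q)) / (4 * q - 1) ≤
        (2 * Real.log 3 + 2 * Real.log q) / (4 * q - 1) := by
      gcongr
    linarith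
  · have h4 : 0 ≤ (2 * Real.log 3 + 2 * Real.log q) / (4 * q - 1) := by positivity
    have h5 : Real.log 2 ≤ Real.log ((3 * q / (1 + 2 * q)) ^ 2) := by
      apply Real.log_le_log (by norm_num)
      rw [div_pow, le_div_iff₀ (by positivity)]
      nlinarith
    rw [Real.log_pow] at h5
    push_cast at h5
    linarith

/-- The prefactor equals `(4q - 1) / (4q)` with `q = 1 + κ`, the reciprocal of `1 + 1 / (4q - 1)`.
So it is enough that the bracket exceeds the target by a relative `1 / (4q - 1)`. Since `d ≥ 2`, two
of the logarithms are available for paying `log 2`, and `a ≥ 2 log 3` pays the rest. -/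
theorem three_quarters_log_le {a κ : ℝ} {d : ℕ} (hd : 2 ≤ d) (hκ : 0 ≤ κ)
    (ha : 2 * Real.log 3 ≤ a) :
    (3 / 4 + κ) / (1 + κ) * (a + (Real.log 2 + d * Real.log (1 + 4 * κ / (3 * d)))) ≤
      a + d * Real.log (1 + κ) := by
  have hd' : (2 : ℝ) ≤ d := by exact_mod_cast hd
  have hL : 0 ≤ Real.log (1 + κ) := Real.log_nonneg (by linarith)
  have hL3 : 0 < Real.log 3 := Real.log_pos (by norm_num)
  set φ := (3 / 4 + κ) / (1 + κ) with hφ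
  have hφ0 : 0 < φ := by positivity
  have h1 := log_two_le_of_one_le (q := 1 + κ) (by linarith)
  have h2 : Real.log (1 + 4 * κ / (3 * d)) ≤ Real.log ((1 + 2 * (1 + κ)) / 3) := by
    apply Real.log_le_log (by positivity)
    have : 4 * κ / (3 * d) ≤ 2 * κ / 3 := by
      rw [div_le_div_iff₀ (by positivity) (by positivity)]
      nlinarith
    linarith
  have h3 : Real.log (3 * (1 + κ) / (1 + 2 * (1 + κ)))
      = Real.log (1 + κ) - Real.log ((1 + 2 * (1 + κ)) / 3) := by
    rw [← Real.log_div (by positivity) (by positivity)]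
    congr 1
    field_simp
  rw [h3] at h1
  have h4 : Real.log ((1 + 2 * (1 + κ)) / 3) ≤ Real.log (1 + κ) := by
    apply Real.log_le_log (by positivity)
    linarith
  have h5 : Real.log 2 + d * Real.log (1 + 4 * κ / (3 * d)) ≤
      (2 * Real.log 3 + 2 * Real.log (1 + κ)) / (4 * (1 + κ) - 1) + d * Real.log (1 + κ) := by
    have h6 := mul_le_mul_of_nonneg_left h2 (by linarith : (0 : ℝ) ≤ d)
    nlinarith
  have h6 : (2 * Real.log 3 + 2 * Real.log (1 + κ)) / (4 * (1 + κ) - 1) ≤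
      (a + d * Real.log (1 + κ)) / (4 * (1 + κ) - 1) := by
    apply div_le_div_of_nonneg_right _ (by linarith)
    nlinarith
  calc φ * (a + (Real.log 2 + d * Real.log (1 + 4 * κ / (3 * d))))
      ≤ φ * (a + d * Real.log (1 + κ) + (a + d * Real.log (1 + κ)) / (4 * (1 + κ) - 1)) := by
        exact mul_le_mul_of_nonneg_left (by linarith) (by positivity)
    _ = a + d * Real.log (1 + κ) := by
        have : 4 * (1 + κ) - 1 ≠ 0 := by linarith
        rw [hφ]
        field_simp
        ring


theorem trace_smul_one_add_vecMulVec_add (r k : ℝ) :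
    (r • (1 : Matrix (Fin d) (Fin d) ℝ) + k • vecMulVec z z + G).trace
      = r * d + k * (z ⬝ᵥ z) + G.trace := by
  rw [trace_add, trace_add, trace_smul, trace_smul, trace_one, trace_vecMulVec]
  simp

/-- With prior `1/2`, a first regressor of norm at most `1` raises the trace by at most `1`, and the
arithmetic–geometric mean inequality for eigenvalues bounds the determinant. The halved prior gains
the factor `φ` in the metric comparison. That comparison needs `2 g ≤ κ`, which follows from `d g ≤
tr G` and `d ≥ 2`. -/
theorem inv_mulVec_sq_le_of_small (hd : 2 ≤ d) (hG : G.IsHermitian) (hg0 : 0 ≤ g)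
    (hg : ∀ x, g * (x ⬝ᵥ x) ≤ x ⬝ᵥ G *ᵥ x) (htr : G.trace ≤ κ) (hz : z ⬝ᵥ z ≤ 1)
    {a s : ℝ} (ha : 2 ≤ a) (hs : 0 ≤ s) {S : Fin d → ℝ}
    (hS : S ⬝ᵥ ((1 / 2 : ℝ) • 1 + vecMulVec z z + G)⁻¹ *ᵥ S ≤
      s * (a + Real.log (((1 / 2 : ℝ) • 1 + vecMulVec z z + G).det
        / ((1 / 2 : ℝ) • (1 : Matrix (Fin d) (Fin d) ℝ)).det))) :
    (1 + g) * (((1 + vecMulVec z z + G)⁻¹ *ᵥ S) ⬝ᵥ ((1 + vecMulVec z z + G)⁻¹ *ᵥ S)) ≤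
      s * (a + d * Real.log (1 + κ)) := by
  have hd' : (2 : ℝ) ≤ d := by exact_mod_cast hd
  have hdg := (card_mul_le_trace hg).trans htr
  have hgκ : 2 * g ≤ κ := by nlinarith
  have hκ : 0 ≤ κ := by linarith
  have hz0 := dotProduct_self_nonneg' z
  have hA : ((1 / 2 : ℝ) • (1 : Matrix (Fin d) (Fin d) ℝ) + vecMulVec z z + G).PosDef := by
    simpa using posDef_smul_one_add_vecMulVec_add (z := z) hG hg hg0 (by norm_num : (0 : ℝ) < 1 / 2)
      zero_le_one
  have hV : ((1 : Matrix (Fin d) (Fin d) ℝ) + vecMulVec z z + G).PosDef := by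
    simpa using posDef_smul_one_add_vecMulVec_add (z := z) hG hg hg0 zero_lt_one zero_le_one
  set φ := (1 + κ) / (2 + κ) with hφ
  have hφ0 : 0 < φ := by positivity
  have hφ1 : 1 / 2 ≤ φ := by
    rw [hφ, div_le_div_iff₀ (by norm_num) (by positivity)]
    linarith
  have hφ2 : 1 / 2 + g ≤ φ * (1 + g) := by
    rw [hφ, div_mul_eq_mul_div, le_div_iff₀ (by positivity)]
    nlinarith
  have hle : ∀ x, (1 + g) * (x ⬝ᵥ ((1 / 2 : ℝ) • 1 + vecMulVec z z + G) *ᵥ x) ≤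
      φ * (((1 + vecMulVec z z + G) *ᵥ x) ⬝ᵥ ((1 + vecMulVec z z + G) *ᵥ x)) := by
    intro x
    have h1 := quadForm_smul_one_add_vecMulVec_add (G := G) (z := z) (1 / 2) 1 x
    rw [one_smul] at h1
    rw [h1, one_add_vecMulVec_add_mulVec_sq (g := g)]
    have h2 := dotProduct_self_nonneg' ((z ⬝ᵥ x) • z + (G *ᵥ x - g • x))
    have h3 : 0 ≤ x ⬝ᵥ G *ᵥ x - g * (x ⬝ᵥ x) := sub_nonneg.2 (hg x)
    have h4 := dotProduct_self_nonneg' x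
    have h5 : 1 / 2 * (x ⬝ᵥ x) + 1 * (z ⬝ᵥ x) ^ 2 + x ⬝ᵥ G *ᵥ x ≤
        φ * ((1 + g) * (x ⬝ᵥ x) + 2 * (z ⬝ᵥ x) ^ 2 + 2 * (x ⬝ᵥ G *ᵥ x - g * (x ⬝ᵥ x))) := by
      have h6 := mul_le_mul_of_nonneg_right hφ2 h4
      have h7 := mul_le_mul_of_nonneg_right hφ1 h3
      have h8 := mul_le_mul_of_nonneg_right hφ1 (sq_nonneg (z ⬝ᵥ x))
      linarith
    have h6 := mul_le_mul_of_nonneg_left h5 (by linarith : 0 ≤ 1 + g)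
    have h7 := mul_nonneg hφ0.le h2
    linarith
  refine (hA.inv_mulVec_sq_le hV hφ0.le hle S).trans ?_
  have hdet : Real.log (((1 / 2 : ℝ) • 1 + vecMulVec z z + G).det
        / ((1 / 2 : ℝ) • (1 : Matrix (Fin d) (Fin d) ℝ)).det) ≤
      d * Real.log (1 + 2 * (κ + z ⬝ᵥ z) / d) := by
    rw [← Real.log_pow]
    have hpow : ((1 / 2 : ℝ) • (1 : Matrix (Fin d) (Fin d) ℝ)).det = (1 / 2) ^ d := by
      rw [det_smul, det_one, Fintype.card_fin, mul_one]
    rw [hpow]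
    apply Real.log_le_log (div_pos hA.det_pos (by positivity))
    rw [div_le_iff₀ (by positivity), ← mul_pow]
    refine (hA.posSemidef.det_le_trace_div_pow (by omega)).trans ?_
    have htr' := trace_smul_one_add_vecMulVec_add (G := G) (z := z) (1 / 2) 1
    rw [one_smul] at htr'
    rw [htr']
    have htr0 : 0 ≤ G.trace := le_trans (by positivity) (card_mul_le_trace hg)
    apply pow_le_pow_left₀ (by positivity)
    have : (1 + 2 * (κ + z ⬝ᵥ z) / d) * (1 / 2) = (1 / 2 * d + 1 * (z ⬝ᵥ z) + κ) / d := by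
      field_simp
      ring
    rw [this]
    gcongr
  calc φ * (S ⬝ᵥ ((1 / 2 : ℝ) • 1 + vecMulVec z z + G)⁻¹ *ᵥ S)
      ≤ φ * (s * (a + d * Real.log (1 + 2 * (κ + z ⬝ᵥ z) / d))) := by
        refine mul_le_mul_of_nonneg_left (hS.trans ?_) hφ0.le
        exact mul_le_mul_of_nonneg_left (by linarith) hs
    _ = s * (φ * (a + d * Real.log (1 + 2 * (κ + z ⬝ᵥ z) / d))) := by ring
    _ ≤ _ := mul_le_mul_of_nonneg_left (two_mul_log_le hd hκ hz0 hz ha) hs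

theorem dotProduct_inv_smul_one_add_le (hB : ((3 / 4 : ℝ) • (1 : Matrix (Fin d) (Fin d) ℝ) + G).PosDef)
    (hg0 : 0 ≤ g) (hg : ∀ x, g * (x ⬝ᵥ x) ≤ x ⬝ᵥ G *ᵥ x) (z : Fin d → ℝ) :
    z ⬝ᵥ ((3 / 4 : ℝ) • (1 : Matrix (Fin d) (Fin d) ℝ) + G)⁻¹ *ᵥ z ≤ 4 / 3 * (z ⬝ᵥ z) := by
  have h0 := hB.inv.dotProduct_nonneg z
  have h3 := hB.mulVec_inv z
  generalize ((3 / 4 : ℝ) • (1 : Matrix (Fin d) (Fin d) ℝ) + G)⁻¹ *ᵥ z = y at h0 h3 ⊢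
  have h1 : 3 / 4 * (y ⬝ᵥ y) ≤ z ⬝ᵥ y := by
    rw [dotProduct_comm z, ← h3, add_mulVec, dotProduct_add, dotProduct_smul_one_mulVec]
    have := (mul_nonneg hg0 (dotProduct_self_nonneg' y)).trans (hg y)
    linarith
  have h2 := dotProduct_sq_le z y
  have hz := dotProduct_self_nonneg' z
  rcases h0.eq_or_lt with h0 | h0
  · rw [← h0]; linarith
  · have h4 := mul_le_mul_of_nonneg_left h1 hz
    have h5 : (z ⬝ᵥ y) * (z ⬝ᵥ y) ≤ (4 / 3 * (z ⬝ᵥ z)) * (z ⬝ᵥ y) := by nlinarith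
    exact le_of_mul_le_mul_right h5 h0

/-- The first regressor also sits in the prior, so by the determinant lemma it contributes `(1 + 2q)
/ (1 + (4/3)|z|²)` with `q = ⟨z, (3/4 + G)⁻¹ z⟩ ≤ (4/3)|z|²`. This is at most `2` however large `z`
is. -/
theorem log_det_div_det_le (hd : 1 ≤ d) (hG : G.IsHermitian) (hg0 : 0 ≤ g)
    (hg : ∀ x, g * (x ⬝ᵥ x) ≤ x ⬝ᵥ G *ᵥ x) (htr : G.trace ≤ κ) :
    Real.log (((3 / 4 : ℝ) • 1 + (2 : ℝ) • vecMulVec z z + G).det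
        / ((3 / 4 : ℝ) • (1 : Matrix (Fin d) (Fin d) ℝ) + vecMulVec z z).det) ≤
      Real.log 2 + d * Real.log (1 + 4 * κ / (3 * d)) := by
  have htr0 : 0 ≤ G.trace := le_trans (by positivity) (card_mul_le_trace hg)
  have hκ0 : 0 ≤ κ := htr0.trans htr
  have hd' : (1 : ℝ) ≤ d := by exact_mod_cast hd
  have hB : ((3 / 4 : ℝ) • (1 : Matrix (Fin d) (Fin d) ℝ) + G).PosDef := by
    simpa using posDef_smul_one_add_vecMulVec_add (z := z) hG hg hg0
      (by norm_num : (0 : ℝ) < 3 / 4) le_rfl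
  have hΛ : ((3 / 4 : ℝ) • (1 : Matrix (Fin d) (Fin d) ℝ)).PosDef :=
    posDef_of_le (isHermitian_smul_one _) (by norm_num : (0 : ℝ) < 3 / 4)
      fun x => (dotProduct_smul_one_mulVec _ x).ge
  have hpow : ((3 / 4 : ℝ) • (1 : Matrix (Fin d) (Fin d) ℝ)).det = (3 / 4) ^ d := by
    rw [det_smul, det_one, Fintype.card_fin, mul_one]
  have hΛz : z ⬝ᵥ ((3 / 4 : ℝ) • (1 : Matrix (Fin d) (Fin d) ℝ))⁻¹ *ᵥ z = 4 / 3 * (z ⬝ᵥ z) := by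
    have h1 := hΛ.inv_mulVec ((4 / 3 : ℝ) • z)
    rw [smul_mulVec, one_mulVec, smul_smul] at h1
    norm_num at h1
    rw [h1, dotProduct_smul, smul_eq_mul]
  have hq := dotProduct_inv_smul_one_add_le hB hg0 hg z
  have hq0 := hB.inv.dotProduct_nonneg z
  have hdA : ((3 / 4 : ℝ) • (1 : Matrix (Fin d) (Fin d) ℝ) + (2 : ℝ) • vecMulVec z z + G).det =
      ((3 / 4 : ℝ) • (1 : Matrix (Fin d) (Fin d) ℝ) + G).det *
        (1 + 2 * (z ⬝ᵥ ((3 / 4 : ℝ) • (1 : Matrix (Fin d) (Fin d) ℝ) + G)⁻¹ *ᵥ z)) := by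
    have h1 := hB.det_add_vecMulVec (Real.sqrt 2 • z)
    rw [smul_vecMulVec, vecMulVec_smul, smul_smul, Real.mul_self_sqrt (by norm_num), mulVec_smul,
      dotProduct_smul, smul_dotProduct, smul_eq_mul, smul_eq_mul, ← mul_assoc,
      Real.mul_self_sqrt (by norm_num)] at h1
    rw [← h1, add_right_comm]
  have hz0 := dotProduct_self_nonneg' z
  have hdB := hB.det_pos
  have hdB' : ((3 / 4 : ℝ) • (1 : Matrix (Fin d) (Fin d) ℝ) + G).det / (3 / 4) ^ d
      ≤ (1 + 4 * κ / (3 * d)) ^ d := by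
    rw [div_le_iff₀ (by positivity), ← mul_pow]
    refine (hB.posSemidef.det_le_trace_div_pow hd).trans ?_
    rw [trace_add, trace_smul, trace_one, Fintype.card_fin, smul_eq_mul]
    apply pow_le_pow_left₀ (by positivity)
    have : (1 + 4 * κ / (3 * d)) * (3 / 4) = (3 / 4 * d + κ) / d := by
      field_simp
    rw [this]
    gcongr
  rw [hdA, hΛ.det_add_vecMulVec, hΛz, hpow, ← Real.log_pow, mul_div_mul_comm,
    ← Real.log_mul (by norm_num) (by positivity),
    mul_comm 2 ((1 + 4 * κ / (3 * d)) ^ d)]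
  apply Real.log_le_log (by positivity)
  refine mul_le_mul hdB' ?_ (by positivity) (by positivity)
  rw [div_le_iff₀ (by positivity)]
  linarith

/-- The form on the left carries `2⟨z, x⟩²`, more than the terms linear in `V` can match once `φ <
1`. The deficit `2(1 - φ)⟨z, x⟩²` is covered by the square of `⟨z, x⟩ z + (G - g) x` inside `|V
x|²`, because `|z| ≥ 1`. -/
theorem quadForm_le_of_large (hG : G.IsHermitian) (hg0 : 0 ≤ g) (hgκ : g ≤ κ)
    (hg : ∀ x, g * (x ⬝ᵥ x) ≤ x ⬝ᵥ G *ᵥ x) (hκ : ∀ x, x ⬝ᵥ G *ᵥ x ≤ κ * (x ⬝ᵥ x))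
    (hz : 1 ≤ z ⬝ᵥ z) (x : Fin d → ℝ) :
    (1 + g) * (x ⬝ᵥ ((3 / 4 : ℝ) • 1 + (2 : ℝ) • vecMulVec z z + G) *ᵥ x) ≤
      (3 / 4 + κ) / (1 + κ) *
        (((1 + vecMulVec z z + G) *ᵥ x) ⬝ᵥ ((1 + vecMulVec z z + G) *ᵥ x)) := by
  have hκ0 : 0 ≤ κ := hg0.trans hgκ
  have hφ1 : 3 / 4 ≤ (3 / 4 + κ) / (1 + κ) := by
    rw [div_le_div_iff₀ (by norm_num) (by positivity)]
    linarith
  have hφ2 : 3 / 4 + g ≤ (3 / 4 + κ) / (1 + κ) * (1 + g) := by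
    rw [div_mul_eq_mul_div, le_div_iff₀ (by positivity)]
    nlinarith
  have hφ3 : 2 * (1 - (3 / 4 + κ) / (1 + κ)) * (1 + κ) = 1 / 2 := by
    field_simp
    ring
  have hφ4 : (3 / 4 + κ) / (1 + κ) ≤ 1 := by
    rw [div_le_one (by positivity)]
    linarith
  generalize (3 / 4 + κ) / (1 + κ) = φ at *
  rw [quadForm_smul_one_add_vecMulVec_add, one_add_vecMulVec_add_mulVec_sq (g := g)]
  have hN := mulVec_sub_sq_le hG hg hκ x
  generalize hn : G *ᵥ x - g • x = n at hN ⊢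
  have h3 : 0 ≤ x ⬝ᵥ G *ᵥ x - g * (x ⬝ᵥ x) := sub_nonneg.2 (hg x)
  have h4 := dotProduct_self_nonneg' x
  have h6 := mul_le_mul_of_nonneg_right hφ2 h4
  generalize hr : x ⬝ᵥ G *ᵥ x - g * (x ⬝ᵥ x) = r at hN h3 ⊢
  have hGx : x ⬝ᵥ G *ᵥ x = r + g * (x ⬝ᵥ x) := by linarith
  rw [hGx]
  generalize hu : (z ⬝ᵥ x) • z + n = u
  have hp := dotProduct_self_nonneg' u
  have hn0 := dotProduct_self_nonneg' n
  -- Here `z` and `n = (G - g) x` may cancel in `u`. Weighted AM–GM, with weights chosen so that the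
  -- coefficients below add up to `1 + κ`, bounds the cross term using `|n|² ≤ (κ - g) r`.
  have hun : -2 * (1 + g) * (u ⬝ᵥ n) ≤ (κ - g) * (u ⬝ᵥ u) + (1 + g) ^ 2 * r := by
    have h7 := (dotProduct_sq_le u n).trans (mul_le_mul_of_nonneg_left hN hp)
    generalize u ⬝ᵥ n = un at h7
    generalize u ⬝ᵥ u = uu at h7 hp
    refine le_of_abs_le (abs_le_of_sq_le_sq ?_ ?_)
    · have h8 := mul_le_mul_of_nonneg_left h7 (sq_nonneg (1 + g))
      have h9 := sq_nonneg ((κ - g) * uu - (1 + g) ^ 2 * r)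
      linarith
    · have := mul_nonneg (sub_nonneg.2 hgκ) hp
      positivity
  have hs2 : (z ⬝ᵥ x) ^ 2 ≤ (u - n) ⬝ᵥ (u - n) := by
    have : u - n = (z ⬝ᵥ x) • z := by rw [← hu]; abel
    rw [this, dotProduct_smul, smul_dotProduct, smul_eq_mul, smul_eq_mul]
    have := mul_le_mul_of_nonneg_left hz (sq_nonneg (z ⬝ᵥ x))
    linarith
  rw [dotProduct_sub, sub_dotProduct, sub_dotProduct, dotProduct_comm n u] at hs2
  generalize u ⬝ᵥ n = un at *
  generalize u ⬝ᵥ u = uu at *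
  generalize n ⬝ᵥ n = nn at *
  generalize z ⬝ᵥ x = s at *
  generalize x ⬝ᵥ x = xx at *
  have h8 : (1 + g) * s ^ 2 ≤ (1 + κ) * (uu + (1 + g) * r) := by
    have e1 := mul_le_mul_of_nonneg_left hs2 (by linarith : 0 ≤ 1 + g)
    have e2 := mul_le_mul_of_nonneg_left hN (by linarith : 0 ≤ 1 + g)
    linarith
  have h9 : (1 + g) * (2 * (1 - φ) * s ^ 2) ≤ 1 / 2 * (uu + (1 + g) * r) := by
    rw [← hφ3]
    have e1 := mul_le_mul_of_nonneg_left h8 (by linarith : 0 ≤ 2 * (1 - φ))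
    linarith
  have h10 := mul_le_mul_of_nonneg_left h6 (by linarith : 0 ≤ 1 + g)
  have h11 := mul_le_mul_of_nonneg_right hφ1 hp
  have h12 := mul_le_mul_of_nonneg_right hφ1 (mul_nonneg (by linarith : 0 ≤ 1 + g) h3)
  linarith

/-- For a long first regressor the prior contains a copy of `z zᵀ`. The determinant ratio then loses
its dependence on `z`, and the doubled term in the metric is affordable since `|z| ≥ 1`. -/
theorem inv_mulVec_sq_le_of_large (hd : 2 ≤ d) (hG : G.IsHermitian) (hg0 : 0 ≤ g)
    (hg : ∀ x, g * (x ⬝ᵥ x) ≤ x ⬝ᵥ G *ᵥ x) (hκ : ∀ x, x ⬝ᵥ G *ᵥ x ≤ κ * (x ⬝ᵥ x))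
    (htr : G.trace ≤ κ) (hz : 1 ≤ z ⬝ᵥ z)
    {a s : ℝ} (ha : 2 * Real.log 3 ≤ a) (hs : 0 ≤ s) {S : Fin d → ℝ}
    (hS : S ⬝ᵥ ((3 / 4 : ℝ) • 1 + (2 : ℝ) • vecMulVec z z + G)⁻¹ *ᵥ S ≤
      s * (a + Real.log (((3 / 4 : ℝ) • 1 + (2 : ℝ) • vecMulVec z z + G).det
        / ((3 / 4 : ℝ) • (1 : Matrix (Fin d) (Fin d) ℝ) + vecMulVec z z).det))) :
    (1 + g) * (((1 + vecMulVec z z + G)⁻¹ *ᵥ S) ⬝ᵥ ((1 + vecMulVec z z + G)⁻¹ *ᵥ S)) ≤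
      s * (a + d * Real.log (1 + κ)) := by
  have hd' : (2 : ℝ) ≤ d := by exact_mod_cast hd
  have hdg := (card_mul_le_trace hg).trans htr
  have hgκ : g ≤ κ := by nlinarith
  have hκ0 : 0 ≤ κ := by linarith
  have hA : ((3 / 4 : ℝ) • (1 : Matrix (Fin d) (Fin d) ℝ) + (2 : ℝ) • vecMulVec z z + G).PosDef :=
    posDef_smul_one_add_vecMulVec_add (z := z) hG hg hg0 (by norm_num) (by norm_num)
  have hV : ((1 : Matrix (Fin d) (Fin d) ℝ) + vecMulVec z z + G).PosDef := by
    simpa using posDef_smul_one_add_vecMulVec_add (z := z) hG hg hg0 zero_lt_one zero_le_one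
  have hφ0 : 0 ≤ (3 / 4 + κ) / (1 + κ) := by positivity
  refine (hA.inv_mulVec_sq_le hV hφ0 (quadForm_le_of_large hG hg0 hgκ hg hκ hz) S).trans ?_
  have hdet := log_det_div_det_le (z := z) (by omega) hG hg0 hg htr
  calc (3 / 4 + κ) / (1 + κ) * (S ⬝ᵥ ((3 / 4 : ℝ) • 1 + (2 : ℝ) • vecMulVec z z + G)⁻¹ *ᵥ S)
      ≤ (3 / 4 + κ) / (1 + κ) * (s * (a + (Real.log 2 + d * Real.log (1 + 4 * κ / (3 * d))))) := by
        refine mul_le_mul_of_nonneg_left (hS.trans ?_) hφ0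
        exact mul_le_mul_of_nonneg_left (by linarith) hs
    _ = s * ((3 / 4 + κ) / (1 + κ) * (a + (Real.log 2 + d * Real.log (1 + 4 * κ / (3 * d))))) := by
        ring
    _ ≤ _ := mul_le_mul_of_nonneg_left (three_quarters_log_le hd hκ0 ha) hs

/-- In dimension one everything is scalar: with `v = 1 + G` and `ℓ = z²`, the metric comparison
gains `v / (v + ℓ)`. This outweighs the growth `log (v + ℓ) ≤ log v + ℓ / v` because `a + log v ≥
1`, so the prior can stay equal to `1`. -/
theorem inv_mulVec_sq_le_of_dim_one (hd : d = 1) (hG : G.IsHermitian) (hg0 : 0 ≤ g)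
    (hg : ∀ x, g * (x ⬝ᵥ x) ≤ x ⬝ᵥ G *ᵥ x) (htr : G.trace ≤ κ)
    {a s : ℝ} (ha : 1 ≤ a) (hs : 0 ≤ s) {S : Fin d → ℝ}
    (hS : S ⬝ᵥ (1 + vecMulVec z z + G)⁻¹ *ᵥ S ≤
      s * (a + Real.log ((1 + vecMulVec z z + G).det / (1 : Matrix (Fin d) (Fin d) ℝ).det))) :
    (1 + g) * (((1 + vecMulVec z z + G)⁻¹ *ᵥ S) ⬝ᵥ ((1 + vecMulVec z z + G)⁻¹ *ᵥ S)) ≤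
      s * (a + d * Real.log (1 + κ)) := by
  subst hd
  have hV : ((1 : Matrix (Fin 1) (Fin 1) ℝ) + vecMulVec z z + G).PosDef := by
    simpa using posDef_smul_one_add_vecMulVec_add (z := z) hG hg hg0 zero_lt_one zero_le_one
  have hgG : g ≤ G 0 0 := by
    have := hg (Pi.single 0 1)
    simpa using this
  have hGκ : G 0 0 ≤ κ := by simpa [Matrix.trace] using htr
  set v := 1 + G 0 0 with hv
  set ℓ := z 0 * z 0 with hℓ
  have hℓ0 : 0 ≤ ℓ := mul_self_nonneg _
  have hv1 : 1 ≤ v := by linarith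
  have hdet : ((1 : Matrix (Fin 1) (Fin 1) ℝ) + vecMulVec z z + G).det = v + ℓ := by
    simp [vecMulVec_apply, hv, hℓ]
    ring
  have hmul : ∀ x : Fin 1 → ℝ, (1 + vecMulVec z z + G) *ᵥ x = (v + ℓ) • x := by
    intro x
    ext i
    fin_cases i
    simp only [Matrix.mulVec, dotProduct, vecMulVec_apply, hv, hℓ, Finset.univ_unique,
      Finset.sum_singleton, Matrix.add_apply, Matrix.one_apply, Pi.smul_apply, smul_eq_mul]
    simp only [Fin.default_eq_zero, Fin.zero_eta, if_true]
    ring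
  rw [hdet, det_one, div_one] at hS
  have hle : ∀ x, (1 + g) * (x ⬝ᵥ (1 + vecMulVec z z + G) *ᵥ x) ≤
      v / (v + ℓ) * (((1 + vecMulVec z z + G) *ᵥ x) ⬝ᵥ ((1 + vecMulVec z z + G) *ᵥ x)) := by
    intro x
    rw [hmul, dotProduct_smul, dotProduct_smul, smul_dotProduct]
    have h4 := dotProduct_self_nonneg' x
    simp only [smul_eq_mul]
    have : v / (v + ℓ) * ((v + ℓ) * ((v + ℓ) * (x ⬝ᵥ x))) = v * ((v + ℓ) * (x ⬝ᵥ x)) := by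
      field_simp
    rw [this]
    gcongr
    linarith
  refine (hV.inv_mulVec_sq_le hV (by positivity) hle S).trans ?_
  have hlog : Real.log (v + ℓ) ≤ Real.log v + ℓ / v := by
    have := Real.log_le_sub_one_of_pos (x := (v + ℓ) / v) (by positivity)
    rw [Real.log_div (by positivity) (by positivity)] at this
    have h2 : (v + ℓ) / v - 1 = ℓ / v := by
      field_simp
      ring
    linarith
  have hlv : 0 ≤ Real.log v := Real.log_nonneg hv1
  have hlκ : Real.log v ≤ Real.log (1 + κ) := Real.log_le_log (by positivity) (by linarith)
  calc v / (v + ℓ) * (S ⬝ᵥ (1 + vecMulVec z z + G)⁻¹ *ᵥ S)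
      ≤ v / (v + ℓ) * (s * (a + (Real.log v + ℓ / v))) := by
        refine mul_le_mul_of_nonneg_left (hS.trans ?_) (by positivity)
        exact mul_le_mul_of_nonneg_left (by linarith) hs
    _ = s * ((v * (a + Real.log v) + ℓ) / (v + ℓ)) := by
        field_simp
        ring
    _ ≤ s * (a + (1 : ℕ) * Real.log (1 + κ)) := by
        refine mul_le_mul_of_nonneg_left ?_ hs
        rw [div_le_iff₀ (by positivity), Nat.cast_one, one_mul]
        have h1 := mul_le_mul_of_nonneg_right (show 1 ≤ a + Real.log v by linarith) hℓ0
        have h2 := mul_le_mul_of_nonneg_right hlκ (by positivity : 0 ≤ v + ℓ)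
        nlinarith

/-- A bound on the self-normalised martingale in the metric of the mixture prior gives a bound on
the regularised least squares error which does not depend on the first regressor. -/
theorem inv_mulVec_sq_le_of_priorMat (hd : 1 ≤ d) (hG : G.IsHermitian) (hg0 : 0 ≤ g)
    (hg : ∀ x, g * (x ⬝ᵥ x) ≤ x ⬝ᵥ G *ᵥ x) (hκ : ∀ x, x ⬝ᵥ G *ᵥ x ≤ κ * (x ⬝ᵥ x))
    (htr : G.trace ≤ κ)
    {a s : ℝ} (ha : 2 * Real.log 3 ≤ a) (hs : 0 ≤ s) {S : Fin d → ℝ}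
    (hS : S ⬝ᵥ (priorMat d z + vecMulVec z z + G)⁻¹ *ᵥ S ≤
      s * (a + Real.log ((priorMat d z + vecMulVec z z + G).det / (priorMat d z).det))) :
    (1 + g) * (((1 + vecMulVec z z + G)⁻¹ *ᵥ S) ⬝ᵥ ((1 + vecMulVec z z + G)⁻¹ *ᵥ S)) ≤
      s * (a + d * Real.log (1 + κ)) := by
  have h3 := Real.log_three_gt_d9
  unfold priorMat at hS
  split_ifs at hS with h1 h2
  · exact inv_mulVec_sq_le_of_dim_one h1 hG hg0 hg htr (by linarith) hs hS
  · exact inv_mulVec_sq_le_of_small (by omega) hG hg0 hg htr h2 (by linarith) hs hS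
  · refine inv_mulVec_sq_le_of_large (by omega) hG hg0 hg hκ htr (not_le.1 h2).le ha hs ?_
    rw [two_smul, ← add_assoc ((3 / 4 : ℝ) • (1 : Matrix (Fin d) (Fin d) ℝ))]
    exact hS

end PriorComparison

/-! ### Freezing and maximal inequality. -/

section Independence

variable {Ω α β : Type*} {m mΩ : MeasurableSpace Ω} [MeasurableSpace α] [MeasurableSpace β]
  {P : Measure Ω}

/-- Freezing lemma: integrate out a variable independent of the past. -/
theorem lintegral_comp_of_indep [IsProbabilityMeasure P] (hm : m ≤ mΩ) {T : Ω → α} {Y : Ω → β}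
    (hT : Measurable[m] T) (hY : Measurable Y) (hind : Indep m (MeasurableSpace.comap Y ‹_›) P)
    {Φ : α × β → ℝ≥0∞} (hΦ : Measurable Φ) :
    ∫⁻ ω, Φ (T ω, Y ω) ∂P = ∫⁻ ω, ∫⁻ y, Φ (T ω, y) ∂(P.map Y) ∂P := by
  have hT' : Measurable T := hT.mono hm le_rfl
  have hTY : IndepFun T Y P := indep_of_indep_of_le_left hind hT.comap_le
  have : IsProbabilityMeasure (P.map Y) := Measure.isProbabilityMeasure_map hY.aemeasurable
  have h := (indepFun_iff_map_prod_eq_prod_map_map hT'.aemeasurable hY.aemeasurable).1 hTY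
  rw [← lintegral_map (f := Φ) (g := fun ω => (T ω, Y ω)) hΦ (hT'.prodMk hY), h,
    lintegral_prod _ hΦ.aemeasurable, lintegral_map _ hT']
  exact hΦ.lintegral_prod_right'

/-- **Ville's inequality** for nonnegative supermartingales. -/
theorem ville_inequality (ℱ : Filtration ℕ mΩ) {M : ℕ → Ω → ℝ≥0∞}
    (hM : ∀ t, Measurable[ℱ t] (M t))
    (hstep : ∀ t, ∀ F, MeasurableSet[ℱ t] F → ∫⁻ ω in F, M (t + 1) ω ∂P ≤ ∫⁻ ω in F, M t ω ∂P)
    (L : ℝ≥0∞) : L * P {ω | ∃ t, L ≤ M t ω} ≤ ∫⁻ ω, M 0 ω ∂P := by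
  set H : ℕ → Set Ω := fun t => {ω | ∃ s ≤ t, L ≤ M s ω} with hH
  have hHm : ∀ t, MeasurableSet[ℱ t] (H t) := by
    intro t
    have : H t = ⋃ s ∈ Finset.range (t + 1), {ω | L ≤ M s ω} := by
      ext ω
      simp [hH]
    rw [this]
    refine Finset.measurableSet_biUnion _ fun s hs => ?_
    have hs' : s ≤ t := Nat.lt_succ_iff.1 (Finset.mem_range.1 hs)
    exact ((hM s).mono (ℱ.mono hs') le_rfl) measurableSet_Ici
  -- Stopping at the first crossing of `L`: the mass that has crossed counts `L`, the remainder
  -- still carries the process, and the total never increases.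
  have hmain : ∀ t, L * P (H t) + ∫⁻ ω in (H t)ᶜ, M t ω ∂P ≤ ∫⁻ ω, M 0 ω ∂P := by
    intro t
    induction t with
    | zero =>
      have h0 : L * P (H 0) ≤ ∫⁻ ω in H 0, M 0 ω ∂P := by
        rw [← setLIntegral_const]
        refine setLIntegral_mono' (ℱ.le 0 _ (hHm 0)) fun ω hω => ?_
        obtain ⟨s, hs, h⟩ := hω
        obtain rfl : s = 0 := by omega
        exact h
      rw [← lintegral_add_compl (μ := P) (M 0) (ℱ.le 0 _ (hHm 0))]
      exact add_le_add_left h0 _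
    | succ t ih =>
      refine le_trans ?_ ih
      set K : Set Ω := {ω | L ≤ M (t + 1) ω} with hK
      have hKm : MeasurableSet K := ℱ.le (t + 1) _ ((hM (t + 1)) measurableSet_Ici)
      have hHt := ℱ.le t _ (hHm t)
      have hsucc : H (t + 1) = H t ∪ ((H t)ᶜ ∩ K) := by
        ext ω
        simp only [hH, hK, Set.mem_ofPred_eq, Set.mem_union, Set.mem_inter_iff, Set.mem_compl_iff]
        constructor
        · rintro ⟨s, hs, h⟩
          by_cases h' : ∃ s ≤ t, L ≤ M s ω
          · exact Or.inl h'
          · refine Or.inr ⟨h', ?_⟩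
            rcases Nat.lt_or_ge s (t + 1) with h1 | h1
            · exact absurd ⟨s, by omega, h⟩ h'
            · obtain rfl : s = t + 1 := by omega
              exact h
        · rintro (⟨s, hs, h⟩ | ⟨-, h⟩)
          · exact ⟨s, by omega, h⟩
          · exact ⟨t + 1, le_rfl, h⟩
      have hcompl : (H (t + 1))ᶜ = (H t)ᶜ \ K := by
        rw [hsucc]
        ext ω
        simp only [Set.mem_compl_iff, Set.mem_union, Set.mem_inter_iff, Set.mem_sdiff]
        tauto
      have h1 : L * P ((H t)ᶜ ∩ K) ≤ ∫⁻ ω in (H t)ᶜ ∩ K, M (t + 1) ω ∂P := by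
        rw [← setLIntegral_const]
        exact setLIntegral_mono' (hHt.compl.inter hKm) fun ω hω => hω.2
      calc L * P (H (t + 1)) + ∫⁻ ω in (H (t + 1))ᶜ, M (t + 1) ω ∂P
          ≤ L * (P (H t) + P ((H t)ᶜ ∩ K)) + ∫⁻ ω in (H t)ᶜ \ K, M (t + 1) ω ∂P := by
            rw [hcompl]
            gcongr
            rw [hsucc]
            exact measure_union_le _ _
        _ = L * P (H t) + (L * P ((H t)ᶜ ∩ K) + ∫⁻ ω in (H t)ᶜ \ K, M (t + 1) ω ∂P) := by
            rw [mul_add, add_assoc]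
        _ ≤ L * P (H t) + (∫⁻ ω in (H t)ᶜ ∩ K, M (t + 1) ω ∂P
              + ∫⁻ ω in (H t)ᶜ \ K, M (t + 1) ω ∂P) := by gcongr
        _ = L * P (H t) + ∫⁻ ω in (H t)ᶜ, M (t + 1) ω ∂P := by
            rw [lintegral_inter_add_sdiff _ _ hKm]
        _ ≤ _ := add_le_add_right (hstep t _ (hHm t).compl) _
  have hU : {ω | ∃ t, L ≤ M t ω} = ⋃ t, H t := by
    ext ω
    simp only [hH, Set.mem_ofPred_eq, Set.mem_iUnion]
    exact ⟨fun ⟨t, h⟩ => ⟨t, t, le_rfl, h⟩, fun ⟨_, s, _, h⟩ => ⟨s, h⟩⟩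
  have hmono : Monotone H := fun s t hst ω ⟨r, hr, h⟩ => ⟨r, hr.trans hst, h⟩
  rw [hU, hmono.measure_iUnion, ENNReal.mul_iSup]
  exact iSup_le fun t => le_self_add.trans (hmain t)

end Independence

/-! ### One step of the method of mixtures. -/

section GaussianMixture

/-- Gaussian mixture of the exponential tilts `exp ((l w - l² / 2) / σ²)`. -/
theorem lintegral_gaussianReal_exp {σ q b : ℝ} (hσ : 0 < σ) (hq : 0 < q) (w : ℝ) :
    ∫⁻ l, ENNReal.ofReal (Real.exp ((l * w - l ^ 2 / 2) / σ ^ 2))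
        ∂(gaussianReal b (q * σ ^ 2).toNNReal) =
      ENNReal.ofReal ((Real.sqrt (1 + q))⁻¹ *
        Real.exp ((2 * w * b + q * w ^ 2 - b ^ 2) / (1 + q) / (2 * σ ^ 2))) := by
  set v : ℝ≥0 := (q * σ ^ 2).toNNReal with hv
  set v' : ℝ≥0 := (q * σ ^ 2 / (1 + q)).toNNReal with hv'
  have e1 : (v : ℝ) = q * σ ^ 2 := Real.coe_toNNReal _ (by positivity)
  have e2 : (v' : ℝ) = q * σ ^ 2 / (1 + q) := Real.coe_toNNReal _ (by positivity)
  have hv0 : v ≠ 0 := (Real.toNNReal_pos.2 (by positivity)).ne'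
  have hv0' : v' ≠ 0 := (Real.toNNReal_pos.2 (by positivity)).ne'
  rw [gaussianReal_of_var_ne_zero _ hv0,
    lintegral_withDensity_eq_lintegral_mul _ (measurable_gaussianPDF _ _) (by fun_prop)]
  -- Completing the square in `l`: prior density times tilt is the evidence times the posterior
  -- density, with mean `(b + q w) / (1 + q)` and variance `q σ² / (1 + q)`.
  have hpt : ∀ l : ℝ, (gaussianPDF b v * fun l => ENNReal.ofReal
      (Real.exp ((l * w - l ^ 2 / 2) / σ ^ 2))) l =
      ENNReal.ofReal ((Real.sqrt (1 + q))⁻¹ *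
        Real.exp ((2 * w * b + q * w ^ 2 - b ^ 2) / (1 + q) / (2 * σ ^ 2)))
        * gaussianPDF ((b + q * w) / (1 + q)) v' l := by
    intro l
    rw [Pi.mul_apply, gaussianPDF, gaussianPDF, ← ENNReal.ofReal_mul (gaussianPDFReal_nonneg _ _ _),
      ← ENNReal.ofReal_mul (by positivity)]
    congr 1
    rw [gaussianPDFReal, gaussianPDFReal]
    rw [e1, e2]
    have e3 : Real.sqrt (2 * Real.pi * (q * σ ^ 2 / (1 + q)))
        = Real.sqrt (2 * Real.pi * (q * σ ^ 2)) / Real.sqrt (1 + q) := by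
      rw [← Real.sqrt_div (by positivity)]
      congr 1
      field_simp
    rw [e3, mul_assoc, ← Real.exp_add, inv_div]
    have h4 : Real.sqrt (1 + q) ≠ 0 := (Real.sqrt_pos.2 (by positivity)).ne'
    have e5 : (Real.sqrt (1 + q))⁻¹ *
        Real.exp ((2 * w * b + q * w ^ 2 - b ^ 2) / (1 + q) / (2 * σ ^ 2)) *
        (Real.sqrt (1 + q) / Real.sqrt (2 * Real.pi * (q * σ ^ 2)) *
          Real.exp (-(l - (b + q * w) / (1 + q)) ^ 2 / (2 * (q * σ ^ 2 / (1 + q))))) =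
        (Real.sqrt (2 * Real.pi * (q * σ ^ 2)))⁻¹ *
          Real.exp ((2 * w * b + q * w ^ 2 - b ^ 2) / (1 + q) / (2 * σ ^ 2) +
          -(l - (b + q * w) / (1 + q)) ^ 2 / (2 * (q * σ ^ 2 / (1 + q)))) := by
      rw [Real.exp_add]
      field_simp
    rw [e5]
    congr 2
    field_simp
    ring
  rw [lintegral_congr hpt, lintegral_const_mul _ (measurable_gaussianPDF _ _),
    lintegral_gaussianPDF_eq_one _ hv0', mul_one]

/-- One-step supermartingale inequality for the method of mixtures. -/
theorem lintegral_mixture_le_one {σ q b : ℝ} (hσ : 0 < σ) (hq : 0 ≤ q) (hqb : q = 0 → b = 0)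
    (ν : Measure ℝ) [IsProbabilityMeasure ν]
    (hν : ∀ l : ℝ, ∫⁻ y, ENNReal.ofReal (Real.exp (l * y)) ∂ν
      ≤ ENNReal.ofReal (Real.exp (σ ^ 2 * l ^ 2 / 2))) :
    ∫⁻ w, ENNReal.ofReal ((Real.sqrt (1 + q))⁻¹ *
        Real.exp ((2 * w * b + q * w ^ 2 - b ^ 2) / (1 + q) / (2 * σ ^ 2))) ∂ν ≤ 1 := by
  -- For `q = 0` the Gaussian has no density, but then `b = 0` and the integrand is identically `1`.
  rcases hq.eq_or_lt with h0 | h0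
  · simp [← h0, hqb h0.symm]
  · simp_rw [← lintegral_gaussianReal_exp hσ h0]
    -- By Tonelli the noise is integrated first for a fixed tilt `l`. The sub-Gaussian bound at `l /
    -- σ²` cancels the factor `exp (-l² / (2σ²))` exactly.
    rw [lintegral_lintegral_swap (by fun_prop)]
    calc _ ≤ ∫⁻ _l : ℝ, 1 ∂(gaussianReal b (q * σ ^ 2).toNNReal) := by
          refine lintegral_mono fun l => ?_
          have h1 : ∀ w : ℝ, ENNReal.ofReal (Real.exp ((l * w - l ^ 2 / 2) / σ ^ 2)) =
              ENNReal.ofReal (Real.exp (-(l ^ 2 / 2) / σ ^ 2)) *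
                ENNReal.ofReal (Real.exp (l / σ ^ 2 * w)) := by
            intro w
            rw [← ENNReal.ofReal_mul (Real.exp_nonneg _), ← Real.exp_add]
            congr 2
            ring
          simp_rw [h1]
          rw [lintegral_const_mul _ (by fun_prop)]
          refine (mul_le_mul_right (hν _) _).trans ?_
          rw [← ENNReal.ofReal_mul (Real.exp_nonneg _), ← Real.exp_add]
          have : -(l ^ 2 / 2) / σ ^ 2 + σ ^ 2 * (l / σ ^ 2) ^ 2 / 2 = 0 := by
            field_simp
            ring
          rw [this, Real.exp_zero, ENNReal.ofReal_one]
      _ = 1 := by simp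

end GaussianMixture

/-! ### Self-normalised bound, uniform in time. -/

section SelfNormalized

open Matrix

variable {d : ℕ}

theorem measurable_det_of : Measurable fun A : Fin d → Fin d → ℝ => (Matrix.of A).det := by
  refine Continuous.measurable ?_
  exact Continuous.matrix_det (continuous_id)

/-- Inversion is not continuous at singular matrices, but the adjugate is polynomial and the scalar
inverse of the determinant is measurable, with value `0` on singular matrices. -/
theorem measurable_inv_of (i j : Fin d) :
    Measurable fun A : Fin d → Fin d → ℝ => (Matrix.of A)⁻¹ i j := by
  have h : (fun A : Fin d → Fin d → ℝ => (Matrix.of A)⁻¹ i j) =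
      fun A => ((Matrix.of A).det)⁻¹ * (Matrix.of A).adjugate i j := by
    funext A
    rw [Matrix.inv_def, Matrix.smul_apply, Ring.inverse_eq_inv', smul_eq_mul]
  rw [h]
  refine measurable_det_of.inv.mul (Continuous.measurable ?_)
  exact (Continuous.matrix_adjugate (continuous_id)).matrix_elem i j

theorem measurable_dotProduct_inv_mulVec :
    Measurable fun p : (Fin d → Fin d → ℝ) × (Fin d → ℝ) × (Fin d → ℝ) =>
      p.2.1 ⬝ᵥ (Matrix.of p.1)⁻¹ *ᵥ p.2.2 := by
  simp only [dotProduct, mulVec]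
  refine Finset.measurable_sum _ fun i _ => Measurable.mul (by fun_prop) ?_
  refine Finset.measurable_sum _ fun j _ => Measurable.mul ?_ (by fun_prop)
  exact (measurable_inv_of i j).comp measurable_fst

/-- Precision matrix after `t` regressors, starting from `Λ`. -/
def gramMat (Λ : Matrix (Fin d) (Fin d) ℝ) (z : ℕ → Fin d → ℝ) (t : ℕ) :
    Matrix (Fin d) (Fin d) ℝ :=
  Λ + ∑ s ∈ Finset.range t, vecMulVec (z s) (z s)

/-- Noise-weighted sum of the regressors. -/
def noiseSum (z : ℕ → Fin d → ℝ) (w : ℕ → ℝ) (t : ℕ) : Fin d → ℝ :=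
  ∑ s ∈ Finset.range t, w s • z s

theorem gramMat_succ (Λ : Matrix (Fin d) (Fin d) ℝ) (z : ℕ → Fin d → ℝ) (t : ℕ) :
    gramMat Λ z (t + 1) = gramMat Λ z t + vecMulVec (z t) (z t) := by
  rw [gramMat, Finset.sum_range_succ, ← add_assoc, gramMat]

theorem noiseSum_succ (z : ℕ → Fin d → ℝ) (w : ℕ → ℝ) (t : ℕ) :
    noiseSum z w (t + 1) = noiseSum z w t + w t • z t := by
  rw [noiseSum, Finset.sum_range_succ, noiseSum]

theorem gramMat_posDef {Λ : Matrix (Fin d) (Fin d) ℝ} (hΛ : Λ.PosDef) (z : ℕ → Fin d → ℝ) (t : ℕ) :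
    (gramMat Λ z t).PosDef := by
  induction t with
  | zero => simpa [gramMat] using hΛ
  | succ t ih =>
    rw [gramMat_succ]
    exact ih.add_posSemidef (by simpa using posSemidef_vecMulVec_self_star (z t))

/-- The self-normalised exponential process. -/
def mixtureProcess (σ : ℝ) (Λ : Matrix (Fin d) (Fin d) ℝ) (z : ℕ → Fin d → ℝ) (w : ℕ → ℝ) (t : ℕ) :
    ℝ :=
  Real.sqrt (Λ.det / (gramMat Λ z t).det) *
    Real.exp (noiseSum z w t ⬝ᵥ (gramMat Λ z t)⁻¹ *ᵥ noiseSum z w t / (2 * σ ^ 2))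

/-- The growth factor is the mixture integral for one noise value: if the parameter has law `N(A⁻¹
S, σ² A⁻¹)`, its component along the new regressor has mean `b = ⟨z, A⁻¹ S⟩` and variance `q σ²`
with `q = ⟨z, A⁻¹ z⟩`. -/
theorem mixtureProcess_succ (σ : ℝ) {Λ : Matrix (Fin d) (Fin d) ℝ} (hΛ : Λ.PosDef)
    (z : ℕ → Fin d → ℝ) (w : ℕ → ℝ) (t : ℕ) :
    mixtureProcess σ Λ z w (t + 1) = mixtureProcess σ Λ z w t *
      ((Real.sqrt (1 + z t ⬝ᵥ (gramMat Λ z t)⁻¹ *ᵥ z t))⁻¹ *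
        Real.exp ((2 * w t * (z t ⬝ᵥ (gramMat Λ z t)⁻¹ *ᵥ noiseSum z w t)
          + (z t ⬝ᵥ (gramMat Λ z t)⁻¹ *ᵥ z t) * w t ^ 2
          - (z t ⬝ᵥ (gramMat Λ z t)⁻¹ *ᵥ noiseSum z w t) ^ 2)
          / (1 + z t ⬝ᵥ (gramMat Λ z t)⁻¹ *ᵥ z t) / (2 * σ ^ 2))) := by
  have hA := gramMat_posDef hΛ z t
  unfold mixtureProcess
  rw [gramMat_succ, noiseSum_succ, hA.dotProduct_inv_add_vecMulVec, hA.det_add_vecMulVec, add_div,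
    Real.exp_add, ← div_div, Real.sqrt_div' _
      (by linarith [hA.inv.dotProduct_nonneg (z t)])]
  ring

variable {Ω : Type*} {mΩ : MeasurableSpace Ω} {P : Measure Ω} [IsProbabilityMeasure P]

section measurability

variable {m : MeasurableSpace Ω} {Λ : Ω → Fin d → Fin d → ℝ} {z : ℕ → Ω → Fin d → ℝ}
  {w : ℕ → Ω → ℝ} {t : ℕ}

theorem measurable_gramMat (hΛ : Measurable Λ) (hz : ∀ s < t, Measurable (z s)) :
    Measurable fun ω => (fun i j => gramMat (Matrix.of (Λ ω)) (fun s => z s ω) t i j :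
      Fin d → Fin d → ℝ) := by
  refine measurable_pi_lambda _ fun i => measurable_pi_lambda _ fun j => ?_
  have h : (fun ω => gramMat (Matrix.of (Λ ω)) (fun s => z s ω) t i j) =
      fun ω => Λ ω i j + ∑ s ∈ Finset.range t, z s ω i * z s ω j := by
    funext ω
    rw [gramMat, Matrix.add_apply, Matrix.sum_apply]
    rfl
  rw [h]
  refine Measurable.add (by fun_prop) (Finset.measurable_sum _ fun s hs => ?_)
  have := hz s (Finset.mem_range.1 hs)
  fun_prop

theorem measurable_noiseSum (hz : ∀ s < t, Measurable (z s)) (hw : ∀ s < t, Measurable (w s)) :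
    Measurable fun ω => noiseSum (fun s => z s ω) (fun s => w s ω) t := by
  unfold noiseSum
  refine Finset.measurable_sum _ fun s hs => ?_
  have h1 := hz s (Finset.mem_range.1 hs)
  have h2 := hw s (Finset.mem_range.1 hs)
  fun_prop

theorem measurable_mixtureProcess (σ : ℝ) (hΛ : Measurable Λ) (hz : ∀ s < t, Measurable (z s))
    (hw : ∀ s < t, Measurable (w s)) :
    Measurable fun ω =>
      mixtureProcess σ (Matrix.of (Λ ω)) (fun s => z s ω) (fun s => w s ω) t := by
  have h1 := measurable_gramMat hΛ hz
  have h2 := measurable_noiseSum hz hw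
  unfold mixtureProcess
  refine Measurable.mul ?_ ?_
  · exact ((measurable_det_of.comp hΛ).div (measurable_det_of.comp h1)).sqrt
  · exact ((measurable_dotProduct_inv_mulVec.comp (h1.prodMk (h2.prodMk h2))).div_const _).exp

end measurability

/-- Self-normalised bound, uniform in time, for vector-valued martingales driven by independent
sub-Gaussian noise, with an `ℱ 0`-measurable prior precision. -/
theorem self_normalized_bound (ℱ : Filtration ℕ mΩ) {σ : ℝ} (hσ : 0 < σ)
    {Λ : Ω → Fin d → Fin d → ℝ} (hΛm : Measurable[ℱ 0] Λ) (hΛ : ∀ ω, (Matrix.of (Λ ω)).PosDef)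
    {z : ℕ → Ω → Fin d → ℝ} (hz : ∀ t, Measurable[ℱ t] (z t))
    {w : ℕ → Ω → ℝ} (hw : ∀ t, Measurable[ℱ (t + 1)] (w t))
    (hind : ∀ t, Indep (ℱ t) (MeasurableSpace.comap (w t) inferInstance) P)
    (hsub : ∀ t, ∀ l : ℝ, ∫⁻ ω, ENNReal.ofReal (Real.exp (l * w t ω)) ∂P
      ≤ ENNReal.ofReal (Real.exp (σ ^ 2 * l ^ 2 / 2))) (a : ℝ) :
    P {ω | ∃ t, σ ^ 2 * (a + Real.log ((gramMat (Matrix.of (Λ ω)) (fun s => z s ω) t).det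
          / (Matrix.of (Λ ω)).det)) <
        noiseSum (fun s => z s ω) (fun s => w s ω) t ⬝ᵥ
          (gramMat (Matrix.of (Λ ω)) (fun s => z s ω) t)⁻¹ *ᵥ
            noiseSum (fun s => z s ω) (fun s => w s ω) t}
      ≤ ENNReal.ofReal (Real.exp (-a / 2)) := by
  set M : ℕ → Ω → ℝ≥0∞ := fun t ω => ENNReal.ofReal
    (mixtureProcess σ (Matrix.of (Λ ω)) (fun s => z s ω) (fun s => w s ω) t) with hMdef
  have hΛt : ∀ t, Measurable[ℱ t] Λ := fun t => hΛm.mono (ℱ.mono (Nat.zero_le t)) le_rfl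
  have hzt : ∀ t, ∀ s ≤ t, Measurable[ℱ t] (z s) := fun t s h => (hz s).mono (ℱ.mono h) le_rfl
  have hwt : ∀ t, ∀ s < t, Measurable[ℱ t] (w s) := fun t s h => (hw s).mono (ℱ.mono h) le_rfl
  have hMm : ∀ t, Measurable[ℱ t] (M t) := fun t =>
    (measurable_mixtureProcess σ (hΛt t) (fun s h => hzt t s h.le) (hwt t)).ennreal_ofReal
  have hstep : ∀ t, ∀ F, MeasurableSet[ℱ t] F →
      ∫⁻ ω in F, M (t + 1) ω ∂P ≤ ∫⁻ ω in F, M t ω ∂P := by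
    intro t F hF
    have hwm : Measurable (w t) := (hw t).mono (ℱ.le _) le_rfl
    have hprob : IsProbabilityMeasure (P.map (w t)) :=
      Measure.isProbabilityMeasure_map hwm.aemeasurable
    set q : Ω → ℝ := fun ω =>
      z t ω ⬝ᵥ (gramMat (Matrix.of (Λ ω)) (fun s => z s ω) t)⁻¹ *ᵥ z t ω with hq
    set b : Ω → ℝ := fun ω =>
      z t ω ⬝ᵥ (gramMat (Matrix.of (Λ ω)) (fun s => z s ω) t)⁻¹ *ᵥ
        noiseSum (fun s => z s ω) (fun s => w s ω) t with hb
    have hg := measurable_gramMat (hΛt t) (fun s h => hzt t s (le_of_lt h))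
    have hn := measurable_noiseSum (fun s h => hzt t s (le_of_lt h)) (hwt t)
    have hqm : Measurable[ℱ t] q :=
      measurable_dotProduct_inv_mulVec.comp (hg.prodMk ((hz t).prodMk (hz t)))
    have hbm : Measurable[ℱ t] b :=
      measurable_dotProduct_inv_mulVec.comp (hg.prodMk ((hz t).prodMk hn))
    -- The factor depends on the past only through `q` and `b`; together with the process restricted
    -- to `F` they are frozen while the fresh noise is integrated out.
    set T : Ω → ℝ≥0∞ × ℝ × ℝ := fun ω => (F.indicator (M t) ω, q ω, b ω) with hT
    have hTm : Measurable[ℱ t] T := ((hMm t).indicator hF).prodMk (hqm.prodMk hbm)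
    set R : ℝ → ℝ → ℝ → ℝ≥0∞ := fun q b y => ENNReal.ofReal ((Real.sqrt (1 + q))⁻¹ *
        Real.exp ((2 * y * b + q * y ^ 2 - b ^ 2) / (1 + q) / (2 * σ ^ 2))) with hR
    have hRm : Measurable fun p : (ℝ≥0∞ × ℝ × ℝ) × ℝ => p.1.1 * R p.1.2.1 p.1.2.2 p.2 := by
      simp only [hR]
      fun_prop
    have hkey : ∀ ω, F.indicator (M (t + 1)) ω = (T ω).1 * R (T ω).2.1 (T ω).2.2 (w t ω) := by
      intro ω
      by_cases hω : ω ∈ F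
      · simp only [hT, hR, Set.indicator_of_mem hω, hMdef]
        rw [mixtureProcess_succ σ (hΛ ω), ENNReal.ofReal_mul]
        unfold mixtureProcess
        positivity
      · simp [hT, Set.indicator_of_notMem hω]
    rw [← lintegral_indicator (ℱ.le t _ hF), ← lintegral_indicator (ℱ.le t _ hF)]
    rw [lintegral_congr hkey, lintegral_comp_of_indep (ℱ.le t) hTm hwm (hind t) hRm]
    refine lintegral_mono fun ω => ?_
    have hA := gramMat_posDef (hΛ ω) (fun s => z s ω) t
    have hq0 : 0 ≤ q ω := hA.inv.dotProduct_nonneg _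
    -- Cauchy–Schwarz for `A⁻¹`, which covers a vanishing regressor.
    have hqb : q ω = 0 → b ω = 0 := by
      intro h
      have hcs := hA.inv.sq_dotProduct_le (z t ω) ((gramMat (Matrix.of (Λ ω)) (fun s => z s ω) t)⁻¹
        *ᵥ noiseSum (fun s => z s ω) (fun s => w s ω) t)
      have h1 : z t ω ⬝ᵥ (gramMat (Matrix.of (Λ ω)) (fun s => z s ω) t)⁻¹ *ᵥ z t ω = 0 := h
      rw [h1, zero_mul] at hcs
      exact pow_eq_zero_iff two_ne_zero |>.1 (le_antisymm hcs (sq_nonneg _))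
    have h1 : Measurable (R (q ω) (b ω)) := by
      simp only [hR]
      fun_prop
    rw [lintegral_const_mul _ h1]
    refine mul_le_of_le_one_right' ?_
    refine lintegral_mixture_le_one hσ hq0 hqb _ fun l => ?_
    rw [lintegral_map (by fun_prop) hwm]
    exact hsub t l
  -- The process starts at `1`. Being at least `exp (a/2)` means, after taking logarithms, that the
  -- quadratic form is at least `σ² (a + log (det ratio))`.
  have hville := ville_inequality (P := P) ℱ hMm hstep (ENNReal.ofReal (Real.exp (a / 2)))
  have hM0 : ∫⁻ ω, M 0 ω ∂P = 1 := by
    have : ∀ ω, M 0 ω = 1 := by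
      intro ω
      have h1 : (Matrix.of (Λ ω)).det ≠ 0 := (hΛ ω).det_pos.ne'
      simp [hMdef, mixtureProcess, gramMat, noiseSum, div_self h1]
    simp [this]
  rw [hM0] at hville
  have hsubset : {ω | ∃ t, σ ^ 2 * (a + Real.log ((gramMat (Matrix.of (Λ ω)) (fun s => z s ω) t).det
          / (Matrix.of (Λ ω)).det)) <
        noiseSum (fun s => z s ω) (fun s => w s ω) t ⬝ᵥ
          (gramMat (Matrix.of (Λ ω)) (fun s => z s ω) t)⁻¹ *ᵥ
            noiseSum (fun s => z s ω) (fun s => w s ω) t} ⊆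
      {ω | ∃ t, ENNReal.ofReal (Real.exp (a / 2)) ≤ M t ω} := by
    rintro ω ⟨t, ht⟩
    refine ⟨t, ENNReal.ofReal_le_ofReal ?_⟩
    have hA := (gramMat_posDef (hΛ ω) (fun s => z s ω) t).det_pos
    have hL := (hΛ ω).det_pos
    unfold mixtureProcess
    generalize (gramMat (Matrix.of (Λ ω)) (fun s => z s ω) t).det = D at *
    generalize noiseSum (fun s => z s ω) (fun s => w s ω) t ⬝ᵥ
          (gramMat (Matrix.of (Λ ω)) (fun s => z s ω) t)⁻¹ *ᵥ
            noiseSum (fun s => z s ω) (fun s => w s ω) t = Q at *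
    generalize (Matrix.of (Λ ω)).det = D₀ at *
    have h1 : Real.sqrt (D₀ / D) = Real.exp (-(Real.log (D / D₀) / 2)) := by
      rw [Real.sqrt_eq_rpow, Real.rpow_def_of_pos (by positivity), ← inv_div D D₀, Real.log_inv]
      congr 1
      ring
    rw [h1, ← Real.exp_add]
    apply Real.exp_le_exp.2
    have h2 : (a + Real.log (D / D₀)) / 2 ≤ Q / (2 * σ ^ 2) := by
      rw [div_le_div_iff₀ (by norm_num) (by positivity)]
      nlinarith
    linarith
  refine (measure_mono hsubset).trans ?_
  have h1 : ENNReal.ofReal (Real.exp (-a / 2)) * ENNReal.ofReal (Real.exp (a / 2)) = 1 := by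
    rw [← ENNReal.ofReal_mul (Real.exp_nonneg _), ← Real.exp_add]
    have : -a / 2 + a / 2 = 0 := by ring
    simp [this]
  calc P {ω | ∃ t, ENNReal.ofReal (Real.exp (a / 2)) ≤ M t ω}
      = ENNReal.ofReal (Real.exp (-a / 2)) * (ENNReal.ofReal (Real.exp (a / 2)) *
          P {ω | ∃ t, ENNReal.ofReal (Real.exp (a / 2)) ≤ M t ω}) := by
        rw [← mul_assoc, h1, one_mul]
    _ ≤ ENNReal.ofReal (Real.exp (-a / 2)) * 1 := by gcongr
    _ = _ := mul_one _

end SelfNormalized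

/-! ### Nets on the unit sphere. -/

section SphereNet

variable {d : ℕ}

/-- Volume comparison: balls of radius `ε/2` around the points are disjoint and lie in the ball of
radius `1 + ε/2`. -/
theorem card_le_of_separated_sphere {ε : ℝ} (hε : 0 < ε) (C : Finset (EuclideanSpace ℝ (Fin d)))
    (hC : ∀ x ∈ C, ‖x‖ = 1) (hsep : ∀ x ∈ C, ∀ y ∈ C, x ≠ y → ε < dist x y) :
    (C.card : ℝ) ≤ (1 + 2 / ε) ^ d := by
  set v := (volume : Measure (EuclideanSpace ℝ (Fin d))) with hv
  have hball : ∀ (x : EuclideanSpace ℝ (Fin d)) {r : ℝ}, 0 < r →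
      v (Metric.ball x r) = ENNReal.ofReal (r ^ d) * v (Metric.ball 0 1) := by
    intro x r hr
    have := v.addHaar_ball_of_pos x hr
    rwa [finrank_euclideanSpace, Fintype.card_fin] at this
  have hdisj : (C : Set (EuclideanSpace ℝ (Fin d))).PairwiseDisjoint
      fun x => Metric.ball x (ε / 2) := by
    intro x hx y hy hxy
    refine Metric.ball_disjoint_ball ?_
    linarith [hsep x hx y hy hxy]
  have hsub : (⋃ x ∈ C, Metric.ball x (ε / 2)) ⊆
      Metric.ball (0 : EuclideanSpace ℝ (Fin d)) (1 + ε / 2) := by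
    intro y hy
    simp only [Set.mem_iUnion, Metric.mem_ball] at hy
    obtain ⟨x, hx, h⟩ := hy
    rw [Metric.mem_ball]
    calc dist y 0 ≤ dist y x + dist x 0 := dist_triangle _ _ _
      _ < ε / 2 + 1 := by rw [dist_zero_right, hC x hx]; linarith
      _ = 1 + ε / 2 := add_comm _ _
  have h1 := measure_mono (μ := v) hsub
  rw [measure_biUnion_finset hdisj (fun x _ => measurableSet_ball), hball 0 (by positivity),
    Finset.sum_congr rfl (fun x _ => hball x (by positivity : 0 < ε / 2)), Finset.sum_const,
    nsmul_eq_mul, ← mul_assoc] at h1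
  have hpos : v (Metric.ball 0 1) ≠ 0 := (Metric.measure_ball_pos v 0 one_pos).ne'
  have hfin : v (Metric.ball 0 1) ≠ ⊤ := measure_ball_lt_top.ne
  have h2 := (ENNReal.mul_le_mul_iff_left hpos hfin).1 h1
  rw [← ENNReal.ofReal_natCast, ← ENNReal.ofReal_mul (by positivity),
    ENNReal.ofReal_le_ofReal_iff (by positivity)] at h2
  have h3 : (1 + 2 / ε) ^ d = (1 + ε / 2) ^ d / (ε / 2) ^ d := by
    rw [← div_pow]
    congr 1
    field_simp
    ring
  rw [h3, le_div_iff₀ (by positivity)]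
  exact h2

/-- A separated set of maximal size is a net of resolution `2 / M`, since an uncovered point could
be added. Writing the resolution as a product keeps `M = 0` meaningful, which occurs when the
regressor bound vanishes. -/
theorem exists_sphere_net (hd : 1 ≤ d) {M : ℝ} (hM : 0 ≤ M) :
    ∃ C : Finset (EuclideanSpace ℝ (Fin d)), (C.card : ℝ) ≤ (1 + M) ^ d ∧
      (∀ y ∈ C, ‖y‖ = 1) ∧ ∀ x, ‖x‖ = 1 → ∃ y ∈ C, M * ‖x - y‖ ≤ 2 := by
  classical
  -- For `M = 0` a single unit vector will do; its existence needs `d ≥ 1`.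
  rcases hM.eq_or_lt with h0 | h0
  · refine ⟨{EuclideanSpace.single ⟨0, hd⟩ 1}, by simp [← h0], by simp, fun x _ => ?_⟩
    exact ⟨_, Finset.mem_singleton_self _, by simp [← h0]⟩
  · have hε : 0 < 2 / M := by positivity
    set A : Set ℕ := {k | ∃ C : Finset (EuclideanSpace ℝ (Fin d)), C.card = k ∧
      (∀ y ∈ C, ‖y‖ = 1) ∧ ∀ x ∈ C, ∀ y ∈ C, x ≠ y → 2 / M < dist x y} with hA
    have hcard : ∀ C : Finset (EuclideanSpace ℝ (Fin d)), (∀ y ∈ C, ‖y‖ = 1) →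
        (∀ x ∈ C, ∀ y ∈ C, x ≠ y → 2 / M < dist x y) → (C.card : ℝ) ≤ (1 + M) ^ d := by
      intro C h1 h2
      have := card_le_of_separated_sphere hε C h1 h2
      rwa [div_div_cancel₀ (by norm_num)] at this
    have hbdd : BddAbove A := by
      refine ⟨⌊(1 + M) ^ d⌋₊, ?_⟩
      rintro k ⟨C, rfl, h1, h2⟩
      exact Nat.le_floor (hcard C h1 h2)
    have hne : A.Nonempty := ⟨0, ∅, rfl, by simp, by simp⟩
    obtain ⟨C, hk, h1, h2⟩ := Nat.sSup_mem hne hbdd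
    refine ⟨C, hcard C h1 h2, h1, fun x hx => ?_⟩
    by_contra! hcon
    have hfar : ∀ y ∈ C, 2 / M < dist x y := by
      intro y hy
      rw [dist_eq_norm, div_lt_iff₀ h0]
      linarith [hcon y hy]
    have hxC : x ∉ C := fun h => by
      have := hfar x h
      rw [dist_self] at this
      linarith
    have hmem : C.card + 1 ∈ A := by
      refine ⟨insert x C, Finset.card_insert_of_notMem hxC, ?_, ?_⟩
      · intro y hy
        rcases Finset.mem_insert.1 hy with rfl | hy
        exacts [hx, h1 y hy]
      · intro u hu v hv huv
        rcases Finset.mem_insert.1 hu with hu' | hu' <;> rcases Finset.mem_insert.1 hv with hv' | hv'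
        · exact absurd (hu'.trans hv'.symm) huv
        · rw [hu']; exact hfar v hv'
        · rw [hv', dist_comm]; exact hfar u hu'
        · exact h2 u hu' v hv' huv
    have := le_csSup hbdd hmem
    omega

/-- A lower bound for a Gram quadratic form on a net extends to the whole sphere. -/
theorem gram_lower_bound_of_net {ι : Type*} (s : Finset ι) (z : ι → EuclideanSpace ℝ (Fin d))
    {B m M : ℝ} (hB : ∑ i ∈ s, ‖z i‖ ^ 2 ≤ B) (hm : 0 ≤ m) (hM : m * M = 4 * B)
    {C : Finset (EuclideanSpace ℝ (Fin d))} (hC1 : ∀ y ∈ C, ‖y‖ = 1)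
    (hC : ∀ x, ‖x‖ = 1 → ∃ y ∈ C, M * ‖x - y‖ ≤ 2)
    (hlow : ∀ y ∈ C, 2 * m ≤ ∑ i ∈ s, inner ℝ y (z i) ^ 2)
    (x : EuclideanSpace ℝ (Fin d)) (hx : ‖x‖ = 1) :
    m ≤ ∑ i ∈ s, inner ℝ x (z i) ^ 2 := by
  obtain ⟨y, hy, hxy⟩ := hC x hx
  -- The difference of squares factors as `-⟨x - y, z⟩⟨x + y, z⟩`, so on the sphere each summand is
  -- Lipschitz with constant `2|z|²`.
  have h1 : ∀ i ∈ s, inner ℝ y (z i) ^ 2 - inner ℝ x (z i) ^ 2 ≤ 2 * ‖x - y‖ * ‖z i‖ ^ 2 := by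
    intro i _
    have e : inner ℝ y (z i) ^ 2 - inner ℝ x (z i) ^ 2
        = -(inner ℝ (x - y) (z i) * inner ℝ (x + y) (z i)) := by
      rw [inner_sub_left, inner_add_left]
      ring
    rw [e]
    have h2 : ‖x + y‖ ≤ 2 := by
      have := norm_add_le x y
      rw [hx, hC1 y hy] at this
      linarith
    calc -(inner ℝ (x - y) (z i) * inner ℝ (x + y) (z i))
        ≤ |inner ℝ (x - y) (z i) * inner ℝ (x + y) (z i)| := neg_le_abs _
      _ ≤ (‖x - y‖ * ‖z i‖) * (‖x + y‖ * ‖z i‖) := by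
          rw [abs_mul]
          gcongr <;> exact abs_real_inner_le_norm _ _
      _ ≤ (‖x - y‖ * ‖z i‖) * (2 * ‖z i‖) := by gcongr
      _ = _ := by ring
  -- The total loss is at most `2B|x - y|`. Since `m M = 4B` and `M|x - y| ≤ 2`, it is at most `m`,
  -- which takes the net bound from `2m` down to `m`.
  have h2 := Finset.sum_le_sum h1
  rw [Finset.sum_sub_distrib, ← Finset.mul_sum] at h2
  have h3 := mul_le_mul_of_nonneg_left hB (by positivity : 0 ≤ 2 * ‖x - y‖)
  have h4 := mul_le_mul_of_nonneg_left hxy hm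
  have h5 := hlow y hy
  have h6 : 4 * B * ‖x - y‖ = m * (M * ‖x - y‖) := by rw [← hM, mul_assoc]
  linarith

end SphereNet

/-! ### Chernoff bound with conditional probabilities. -/

section Counting

variable {Ω α β : Type*} {mΩ : MeasurableSpace Ω} [MeasurableSpace α] [MeasurableSpace β]
  {P : Measure Ω} [IsProbabilityMeasure P]

open Classical in
/-- Multiplicative Chernoff bound for events with conditional probability at least `p`. -/
theorem measure_count_lt_le (ℱ : Filtration ℕ mΩ) {T : ℕ → Ω → α} {Y : ℕ → Ω → β}
    (hT : ∀ t, Measurable[ℱ t] (T t)) (hY : ∀ t, Measurable[ℱ (t + 1)] (Y t))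
    (hind : ∀ t, Indep (ℱ t) (MeasurableSpace.comap (Y t) inferInstance) P)
    {C : Set (α × β)} (hC : MeasurableSet C) {p : ℝ} (hp : 0 ≤ p)
    (hprob : ∀ t a, ENNReal.ofReal p ≤ P.map (Y t) {y | (a, y) ∈ C}) (N : ℕ) :
    P {ω | (((Finset.range N).filter fun s => (T s ω, Y s ω) ∈ C).card : ℝ) < p * N / 2} ≤
      ENNReal.ofReal (Real.exp (-((1 - Real.log 2) * p * N / 2))) := by
  -- Each success halves the product, that is, the exponential parameter is `log 2`. The conditional
  -- mean of a factor is then at most `1 - p/2 ≤ exp (-p/2)`.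
  set r : α × β → ℝ≥0∞ := fun x => if x ∈ C then 2⁻¹ else 1 with hr
  have hrm : Measurable r := Measurable.ite hC measurable_const measurable_const
  have hrs : ∀ a, Measurable fun y => r (a, y) := fun a => hrm.comp measurable_prodMk_left
  set K : ℕ → Ω → ℝ≥0∞ := fun t ω => ∏ s ∈ Finset.range t, r (T s ω, Y s ω) with hK
  have hKm : ∀ t, Measurable[ℱ t] (K t) := by
    intro t
    refine Finset.measurable_prod _ fun s hs => ?_
    have hs' : s + 1 ≤ t := Finset.mem_range.1 hs
    exact hrm.comp (((hT s).mono (ℱ.mono (by omega)) le_rfl).prodMk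
      ((hY s).mono (ℱ.mono hs') le_rfl))
  have hr1 : ∀ t a, ∫⁻ y, r (a, y) ∂(P.map (Y t)) ≤ ENNReal.ofReal (Real.exp (-(p / 2))) := by
    intro t a
    have hYm : Measurable (Y t) := (hY t).mono (ℱ.le _) le_rfl
    have : IsProbabilityMeasure (P.map (Y t)) := Measure.isProbabilityMeasure_map hYm.aemeasurable
    have hCa : MeasurableSet {y | (a, y) ∈ C} := measurable_prodMk_left hC
    have h1 : ∫⁻ y, r (a, y) ∂(P.map (Y t)) + 2⁻¹ * P.map (Y t) {y | (a, y) ∈ C} = 1 := by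
      rw [← setLIntegral_const, ← lintegral_indicator hCa,
        ← lintegral_add_left (hrs a)]
      have : ∀ y, r (a, y) + {y | (a, y) ∈ C}.indicator (fun _ => (2 : ℝ≥0∞)⁻¹) y = 1 := by
        intro y
        by_cases h : (a, y) ∈ C
        · simp [hr, h, ENNReal.inv_two_add_inv_two]
        · simp [hr, h]
      simp [this]
    have h2 : ENNReal.ofReal (p / 2) ≤ 2⁻¹ * P.map (Y t) {y | (a, y) ∈ C} := by
      have : ENNReal.ofReal (p / 2) = 2⁻¹ * ENNReal.ofReal p := by
        rw [div_eq_inv_mul, ENNReal.ofReal_mul (by norm_num), ENNReal.ofReal_inv_of_pos (by norm_num)]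
        simp
      rw [this]
      gcongr
      exact hprob t a
    have h3 : ∫⁻ y, r (a, y) ∂(P.map (Y t)) ≤ 1 - ENNReal.ofReal (p / 2) := by
      refine ENNReal.le_sub_of_add_le_right ENNReal.ofReal_ne_top ?_
      rw [← h1]
      gcongr
    refine h3.trans ?_
    rw [← ENNReal.ofReal_one, ← ENNReal.ofReal_sub _ (by positivity)]
    apply ENNReal.ofReal_le_ofReal
    linarith [Real.add_one_le_exp (-(p / 2))]
  have hint : ∀ t : ℕ, ∫⁻ ω, K t ω ∂P ≤ ENNReal.ofReal (Real.exp (-(p / 2) * t)) := by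
    intro t
    induction t with
    | zero => simp [hK]
    | succ t ih =>
      have hΦ : Measurable fun x : (ℝ≥0∞ × α) × β => x.1.1 * r (x.1.2, x.2) :=
        measurable_fst.fst.mul (hrm.comp (measurable_fst.snd.prodMk measurable_snd))
      have h1 : ∫⁻ ω, K (t + 1) ω ∂P =
          ∫⁻ ω, ∫⁻ y, K t ω * r (T t ω, y) ∂(P.map (Y t)) ∂P := by
        rw [← lintegral_comp_of_indep (ℱ.le t) ((hKm t).prodMk (hT t))
          ((hY t).mono (ℱ.le _) le_rfl) (hind t) hΦ]
        simp only [hK, Finset.prod_range_succ]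
      rw [h1]
      calc ∫⁻ ω, ∫⁻ y, K t ω * r (T t ω, y) ∂(P.map (Y t)) ∂P
          ≤ ∫⁻ ω, K t ω * ENNReal.ofReal (Real.exp (-(p / 2))) ∂P := by
            refine lintegral_mono fun ω => ?_
            rw [lintegral_const_mul _ (hrs _)]
            gcongr
            exact hr1 t _
        _ = (∫⁻ ω, K t ω ∂P) * ENNReal.ofReal (Real.exp (-(p / 2))) :=
            lintegral_mul_const _ ((hKm t).mono (ℱ.le _) le_rfl)
        _ ≤ ENNReal.ofReal (Real.exp (-(p / 2) * t)) * ENNReal.ofReal (Real.exp (-(p / 2))) := by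
            gcongr
        _ = _ := by
            rw [← ENNReal.ofReal_mul (Real.exp_nonneg _), ← Real.exp_add]
            congr 2
            push_cast
            ring
  have hsub : {ω | (((Finset.range N).filter fun s => (T s ω, Y s ω) ∈ C).card : ℝ) < p * N / 2} ⊆
      {ω | ENNReal.ofReal (Real.exp (-(Real.log 2 * p * N / 2))) ≤ K N ω} := by
    intro ω hω
    have hω' : (((Finset.range N).filter fun s => (T s ω, Y s ω) ∈ C).card : ℝ) < p * N / 2 := hω
    change ENNReal.ofReal (Real.exp (-(Real.log 2 * p * N / 2))) ≤ K N ω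
    have h1 : K N ω = ENNReal.ofReal (Real.exp (-(Real.log 2 *
        ((Finset.range N).filter fun s => (T s ω, Y s ω) ∈ C).card))) := by
      simp only [hK, hr]
      rw [Finset.prod_ite, Finset.prod_const, Finset.prod_const_one, mul_one]
      rw [show (2 : ℝ≥0∞)⁻¹ = ENNReal.ofReal (Real.exp (-Real.log 2)) by
        rw [Real.exp_neg, Real.exp_log (by norm_num), ENNReal.ofReal_inv_of_pos (by norm_num)]
        simp]
      rw [← ENNReal.ofReal_pow (Real.exp_nonneg _), ← Real.exp_nat_mul]
      congr 2
      ring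
    rw [h1]
    apply ENNReal.ofReal_le_ofReal
    apply Real.exp_le_exp.2
    have := mul_le_mul_of_nonneg_left hω'.le (Real.log_nonneg (by norm_num : (1 : ℝ) ≤ 2))
    linarith
  refine (measure_mono hsub).trans ?_
  -- Markov at level `2^(-pN/2)`: dividing `exp (-pN/2)` by it produces the rate `(1 - log 2) p /
  -- 2`.
  refine (meas_ge_le_lintegral_div ((hKm N).mono (ℱ.le _) le_rfl).aemeasurable
    (by simp [Real.exp_pos]) ENNReal.ofReal_ne_top).trans ?_
  refine (ENNReal.div_le_div_right (hint N) _).trans ?_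
  rw [← ENNReal.ofReal_div_of_pos (Real.exp_pos _), ← Real.exp_sub]
  apply ENNReal.ofReal_le_ofReal
  apply Real.exp_le_exp.2
  linarith

end Counting

/-! ### Noise filtration and fresh noise. -/

section Independence

variable {Ω α α' β β' : Type*} {mΩ : MeasurableSpace Ω} [MeasurableSpace α] [MeasurableSpace α']
  [MeasurableSpace β] [MeasurableSpace β'] {P : Measure Ω} [IsProbabilityMeasure P]

/-- Independence is given within each noise sequence and between the two, but needed between past
and next values. Under these hypotheses the four variables have product law, and Tonelli allows them
to be regrouped. -/
theorem ProbabilityTheory.IndepFun.prodMk_prodMk_swap {A : Ω → α} {A' : Ω → α'} {B : Ω → β}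
    {B' : Ω → β'} (hA : Measurable A) (hA' : Measurable A') (hB : Measurable B)
    (hB' : Measurable B') (hAA : IndepFun A A' P) (hBB : IndepFun B B' P)
    (hAB : IndepFun (fun ω => (A ω, A' ω)) (fun ω => (B ω, B' ω)) P) :
    IndepFun (fun ω => (A ω, B ω)) (fun ω => (B' ω, A' ω)) P := by
  have := Measure.isProbabilityMeasure_map (μ := P) hA.aemeasurable
  have := Measure.isProbabilityMeasure_map (μ := P) hA'.aemeasurable
  have := Measure.isProbabilityMeasure_map (μ := P) hB.aemeasurable
  have := Measure.isProbabilityMeasure_map (μ := P) hB'.aemeasurable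
  have h1 : IndepFun A B P := hAB.comp measurable_fst measurable_fst
  have h2 : IndepFun B' A' P := hAB.symm.comp measurable_snd measurable_snd
  have e1 := (indepFun_iff_map_prod_eq_prod_map_map hA.aemeasurable hA'.aemeasurable).1 hAA
  have e2 := (indepFun_iff_map_prod_eq_prod_map_map hB.aemeasurable hB'.aemeasurable).1 hBB
  have e3 := (indepFun_iff_map_prod_eq_prod_map_map (hA.prodMk hA').aemeasurable
    (hB.prodMk hB').aemeasurable).1 hAB
  have e4 := (indepFun_iff_map_prod_eq_prod_map_map hA.aemeasurable hB.aemeasurable).1 h1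
  have e5 := (indepFun_iff_map_prod_eq_prod_map_map hB'.aemeasurable hA'.aemeasurable).1 h2
  rw [e1, e2] at e3
  rw [indepFun_iff_map_prod_eq_prod_map_map (hA.prodMk hB).aemeasurable
    (hB'.prodMk hA').aemeasurable, e4, e5]
  refine Measure.ext_of_lintegral _ fun f hf => ?_
  rw [lintegral_map hf ((hA.prodMk hB).prodMk (hB'.prodMk hA'))]
  have hg : Measurable fun x : (α × α') × (β × β') => f ((x.1.1, x.2.1), (x.2.2, x.1.2)) := by
    fun_prop
  have e6 : ∫⁻ ω, f ((A ω, B ω), (B' ω, A' ω)) ∂P =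
      ∫⁻ x, f ((x.1.1, x.2.1), (x.2.2, x.1.2))
        ∂(P.map fun ω => ((A ω, A' ω), (B ω, B' ω))) := by
    rw [lintegral_map hg ((hA.prodMk hA').prodMk (hB.prodMk hB'))]
  rw [e6, e3, lintegral_prod _ hg.aemeasurable, lintegral_prod _ hf.aemeasurable,
    lintegral_prod _ (by fun_prop), lintegral_prod _ (by fun_prop)]
  refine lintegral_congr fun a => ?_
  rw [lintegral_lintegral_swap (by fun_prop), lintegral_prod _ (by fun_prop)]
  refine lintegral_congr fun b => ?_
  rw [lintegral_prod _ (by fun_prop)]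

end Independence

namespace ClosedLoopSystem

variable {n m d q : ℕ} {sys : ClosedLoopSystem n m d q} {Ω : Type*} {mΩ : MeasurableSpace Ω}
  {P : Measure Ω} {W : ℕ → Ω → sys.noiseSet} {S : ℕ → Ω → sys.explSet}
  {μw : Measure sys.noiseSet} {μs : Measure sys.explSet} {σw : ℝ}

/-- The noise up to time `t`. -/
def noiseHist (W : ℕ → Ω → sys.noiseSet) (S : ℕ → Ω → sys.explSet) (t : ℕ) (ω : Ω) :
    (Finset.range t → sys.noiseSet) × (Finset.range (t + 1) → sys.explSet) :=
  (fun i => W (i + 1) ω, fun i => S i ω)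

theorem measurable_noiseHist {mΩ' : MeasurableSpace Ω} {t : ℕ}
    (hW : ∀ i < t, Measurable (W (i + 1))) (hS : ∀ i ≤ t, Measurable (S i)) :
    Measurable (noiseHist W S t) :=
  (measurable_pi_lambda _ fun i => hW _ (Finset.mem_range.1 i.2)).prodMk
    (measurable_pi_lambda _ fun i => hS _ (Nat.lt_succ_iff.1 (Finset.mem_range.1 i.2)))

theorem comap_noise_measurable {t i : ℕ} (hi : i < t) :
    Measurable[MeasurableSpace.comap (noiseHist W S t) inferInstance] (W (i + 1)) := by
  have h : W (i + 1) = (fun x : (Finset.range t → sys.noiseSet) ×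
      (Finset.range (t + 1) → sys.explSet) => x.1 ⟨i, Finset.mem_range.2 hi⟩) ∘ noiseHist W S t :=
    rfl
  rw [h]
  exact Measurable.comp (by fun_prop) (comap_measurable _)

theorem comap_expl_measurable {t i : ℕ} (hi : i ≤ t) :
    Measurable[MeasurableSpace.comap (noiseHist W S t) inferInstance] (S i) := by
  have h : S i = (fun x : (Finset.range t → sys.noiseSet) ×
      (Finset.range (t + 1) → sys.explSet) => x.2 ⟨i, Finset.mem_range.2 (by omega)⟩)
        ∘ noiseHist W S t := rfl
  rw [h]
  exact Measurable.comp (by fun_prop) (comap_measurable _)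

/-- The filtration generated by the noise. -/
def noiseFiltration (hW : ∀ i, Measurable (W (i + 1))) (hS : ∀ i, Measurable (S i)) :
    Filtration ℕ mΩ where
  seq t := MeasurableSpace.comap (noiseHist W S t) inferInstance
  mono' := by
    intro s t hst
    refine measurable_iff_comap_le.1 (measurable_noiseHist
      (mΩ' := MeasurableSpace.comap (noiseHist W S t) inferInstance) ?_ ?_)
    · exact fun i hi => comap_noise_measurable (lt_of_lt_of_le hi hst)
    · exact fun i hi => comap_expl_measurable (hi.trans hst)
  le' := fun t => measurable_iff_comap_le.1
    (measurable_noiseHist (fun i _ => hW i) (fun i _ => hS i))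

theorem ProcessNoise.measurable_succ (h : sys.ProcessNoise P W S μw σw) (i : ℕ) :
    Measurable (W (i + 1)) := h.measurable _ (by omega)

variable [IsProbabilityMeasure P]

theorem indepFun_noiseHist (hexpl : sys.ExplNoise P S μs) (hnoise : sys.ProcessNoise P W S μw σw)
    (t : ℕ) : IndepFun (noiseHist W S t) (fun ω => (S (t + 1) ω, W (t + 1) ω)) P := by
  have hW := hnoise.measurable_succ
  have hS := hexpl.measurable
  have h1 : IndepFun (fun ω (i : Finset.range t) => W (i + 1) ω) (W (t + 1)) P :=
    (hnoise.indep.indepFun_finset (Finset.range t) {t} (by simp) hW).comp measurable_id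
      (measurable_pi_apply (⟨t, Finset.mem_singleton_self t⟩ : ({t} : Finset ℕ)))
  have h2 : IndepFun (fun ω (i : Finset.range (t + 1)) => S i ω) (S (t + 1)) P :=
    (hexpl.indep.indepFun_finset (Finset.range (t + 1)) {t + 1} (by simp) hS).comp measurable_id
      (measurable_pi_apply (⟨t + 1, Finset.mem_singleton_self (t + 1)⟩ : ({t + 1} : Finset ℕ)))
  refine IndepFun.prodMk_prodMk_swap (measurable_pi_lambda _ fun i => hW i) (hW t)
    (measurable_pi_lambda _ fun i => hS i) (hS (t + 1)) h1 h2 ?_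
  exact hnoise.indep_expl.comp
    (φ := fun x : ℕ → sys.noiseSet => ((fun i : Finset.range t => x i), x t))
    (ψ := fun x : ℕ → sys.explSet => ((fun i : Finset.range (t + 1) => x i), x (t + 1)))
    (by fun_prop) (by fun_prop)

theorem indep_noiseFiltration (hexpl : sys.ExplNoise P S μs)
    (hnoise : sys.ProcessNoise P W S μw σw) (t : ℕ) :
    Indep (noiseFiltration hnoise.measurable_succ hexpl.measurable t)
      (MeasurableSpace.comap (fun ω => (S (t + 1) ω, W (t + 1) ω)) inferInstance) P :=
  indepFun_noiseHist hexpl hnoise t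

theorem map_expl_noise (hexpl : sys.ExplNoise P S μs)
    (hnoise : sys.ProcessNoise P W S μw σw) (t : ℕ) :
    P.map (fun ω => (S (t + 1) ω, W (t + 1) ω)) = μs.prod μw := by
  have h : IndepFun (S (t + 1)) (W (t + 1)) P :=
    (hnoise.indep_expl.comp (measurable_pi_apply t) (measurable_pi_apply (t + 1))).symm
  rw [(indepFun_iff_map_prod_eq_prod_map_map (hexpl.measurable _).aemeasurable
    (hnoise.measurable_succ t).aemeasurable).1 h, hexpl.law, hnoise.law _ (by omega)]

end ClosedLoopSystem

/-! ### Normal equations and measurability of the closed loop. -/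

namespace ClosedLoopSystem

open Matrix

variable {n m d q : ℕ} (sys : ClosedLoopSystem n m d q)

theorem toEuclideanLin_transpose_single (i : Fin d) (j : Fin n) (τ : ℝ)
    (z : EuclideanSpace ℝ (Fin d)) :
    Matrix.toEuclideanLin (Matrix.single i j τ).transpose z =
      (τ * z i) • EuclideanSpace.single j (1 : ℝ) := by
  ext k
  rw [Matrix.toLpLin_apply]
  simp only [Matrix.mulVec, dotProduct, Matrix.transpose_apply, Matrix.single_apply,
    PiLp.smul_apply, smul_eq_mul]
  rw [Finset.sum_eq_single i (by intro b _ hb; simp [Ne.symm hb]) (by simp)]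
  by_cases h : j = k
  · simp [h]
  · simp [h, Ne.symm h]

theorem matFrobNorm_sq {a b : ℕ} (A : Matrix (Fin a) (Fin b) ℝ) :
    matFrobNorm A ^ 2 = ∑ i, ∑ j, A i j ^ 2 :=
  Real.sq_sqrt (Finset.sum_nonneg fun _ _ => Finset.sum_nonneg fun _ _ => sq_nonneg _)

theorem matFrobNorm_add_single_sq {a b : ℕ} (A : Matrix (Fin a) (Fin b) ℝ) (i : Fin a) (j : Fin b)
    (τ : ℝ) : matFrobNorm (A + Matrix.single i j τ) ^ 2
      = matFrobNorm A ^ 2 + 2 * τ * A i j + τ ^ 2 := by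
  rw [matFrobNorm_sq, matFrobNorm_sq]
  have h : ∀ k l, (A + Matrix.single i j τ) k l ^ 2 = A k l ^ 2
      + (if k = i then (if l = j then 2 * τ * A k l + τ ^ 2 else 0) else 0) := by
    intro k l
    rw [Matrix.add_apply, Matrix.single_apply]
    by_cases hk : k = i <;> by_cases hl : l = j
    · simp [hk, hl]; ring
    · simp [hk, hl, Ne.symm hl]
    · simp [hk, hl, Ne.symm hk]
    · simp [hk, Ne.symm hk]
  simp_rw [h, Finset.sum_add_distrib]
  simp [add_assoc]

/-- The cost is quadratic, so moving one entry is expanded exactly. Minimality then forces the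
linear coefficient to vanish by a discriminant argument, without derivatives. -/
theorem rlsCost_add_single (path : ℕ → sys.stateSet × sys.ctrlSet) (t : ℕ)
    (θ : Matrix (Fin d) (Fin n) ℝ) (i : Fin d) (j : Fin n) (τ : ℝ) :
    sys.rlsCost path t (θ + Matrix.single i j τ) = sys.rlsCost path t θ
      + 2 * τ * (sys.γ * θ i j - ∑ s ∈ Finset.Icc 1 t, sys.regressor path s i *
        ((path s).1 - Matrix.toEuclideanLin θ.transpose (sys.regressor path s)
          - sys.f (path (s - 1)).1 (path (s - 1)).2 : EuclideanSpace ℝ (Fin n)) j)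
      + τ ^ 2 * (sys.γ + ∑ s ∈ Finset.Icc 1 t, sys.regressor path s i ^ 2) := by
  unfold rlsCost
  rw [matFrobNorm_add_single_sq]
  have h : ∀ s, ‖((path s).1 : EuclideanSpace ℝ (Fin n))
      - Matrix.toEuclideanLin (θ + Matrix.single i j τ).transpose (sys.regressor path s)
      - sys.f (path (s - 1)).1 (path (s - 1)).2‖ ^ 2 =
      ‖((path s).1 : EuclideanSpace ℝ (Fin n))
      - Matrix.toEuclideanLin θ.transpose (sys.regressor path s)
      - sys.f (path (s - 1)).1 (path (s - 1)).2‖ ^ 2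
      - 2 * τ * (sys.regressor path s i * ((path s).1
          - Matrix.toEuclideanLin θ.transpose (sys.regressor path s)
          - sys.f (path (s - 1)).1 (path (s - 1)).2 : EuclideanSpace ℝ (Fin n)) j)
      + τ ^ 2 * sys.regressor path s i ^ 2 := by
    intro s
    rw [Matrix.transpose_add, map_add, LinearMap.add_apply, toEuclideanLin_transpose_single]
    set a : EuclideanSpace ℝ (Fin n) := (path s).1
          - Matrix.toEuclideanLin θ.transpose (sys.regressor path s)
          - sys.f (path (s - 1)).1 (path (s - 1)).2 with ha
    have e : ((path s).1 : EuclideanSpace ℝ (Fin n)) -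
        (Matrix.toEuclideanLin θ.transpose (sys.regressor path s)
          + (τ * sys.regressor path s i) • EuclideanSpace.single j (1 : ℝ))
        - sys.f (path (s - 1)).1 (path (s - 1)).2
        = a - (τ * sys.regressor path s i) • EuclideanSpace.single j (1 : ℝ) := by
      rw [ha]; abel
    rw [e, norm_sub_sq_real, inner_smul_right, norm_smul, EuclideanSpace.inner_single_right]
    simp only [PiLp.norm_single, norm_one, mul_one, conj_trivial, one_mul,
      Real.norm_eq_abs, sq_abs]
    ring
  simp_rw [h, Finset.sum_add_distrib, Finset.sum_sub_distrib, ← Finset.mul_sum]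
  ring

/-- First-order optimality of the regularised least squares estimate. -/
theorem estimate_stationary (path : ℕ → sys.stateSet × sys.ctrlSet) {t : ℕ} (ht : t ≠ 0)
    (i : Fin d) (j : Fin n) :
    sys.γ * sys.estimate path t i j = ∑ s ∈ Finset.Icc 1 t, sys.regressor path s i *
        ((path s).1 - Matrix.toEuclideanLin (sys.estimate path t).transpose (sys.regressor path s)
          - sys.f (path (s - 1)).1 (path (s - 1)).2 : EuclideanSpace ℝ (Fin n)) j := by
  have h : ∀ τ : ℝ, _ := fun τ => sys.estimate_isMin path ht
    (sys.estimate path t + Matrix.single i j τ)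
  simp_rw [rlsCost_add_single] at h
  have hQ : 0 ≤ sys.γ + ∑ s ∈ Finset.Icc 1 t, sys.regressor path s i ^ 2 :=
    add_nonneg sys.γ_pos.le (Finset.sum_nonneg fun _ _ => sq_nonneg _)
  set Q := sys.γ + ∑ s ∈ Finset.Icc 1 t, sys.regressor path s i ^ 2
  rw [← sub_eq_zero]
  set L := sys.γ * sys.estimate path t i j - _ with hL
  have h2 : ∀ τ : ℝ, 0 ≤ Q * (τ * τ) + 2 * L * τ + 0 := by
    intro τ
    have := h τ
    linarith
  have h3 := discrim_le_zero h2
  unfold discrim at h3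
  have h4 : (2 * L) ^ 2 ≤ 0 := by linarith
  have h5 : 2 * L = 0 := pow_eq_zero_iff two_ne_zero |>.1 (le_antisymm h4 (sq_nonneg _))
  linarith

theorem toEuclideanLin_transpose_apply (θ : Matrix (Fin d) (Fin n) ℝ)
    (z : EuclideanSpace ℝ (Fin d)) (j : Fin n) :
    Matrix.toEuclideanLin θ.transpose z j = ∑ k, θ k j * z k := by
  rw [Matrix.toLpLin_apply]
  simp [Matrix.mulVec, dotProduct]

/-- Regularised Gram matrix of the first `t` regressors. -/
def regGram (path : ℕ → sys.stateSet × sys.ctrlSet) (t : ℕ) : Matrix (Fin d) (Fin d) ℝ :=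
  gramMat (sys.γ • 1) (fun s => (sys.regressor path (s + 1) : EuclideanSpace ℝ (Fin d)).ofLp) t

theorem regGram_apply (path : ℕ → sys.stateSet × sys.ctrlSet) (t : ℕ) (x : Fin d → ℝ) (i : Fin d) :
    (sys.regGram path t *ᵥ x) i = sys.γ * x i + ∑ s ∈ Finset.Icc 1 t,
      sys.regressor path s i * ∑ k, x k * sys.regressor path s k := by
  rw [regGram, gramMat, add_mulVec, Pi.add_apply, smul_mulVec, one_mulVec, Pi.smul_apply,
    smul_eq_mul, sum_mulVec, Finset.sum_apply, Finset.range_eq_Ico,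
    Finset.sum_Ico_add' (f := fun s => (vecMulVec (sys.regressor path s).ofLp
      (sys.regressor path s).ofLp *ᵥ x) i) (c := 1), ← Finset.Ico_succ_right_eq_Icc]
  simp only [vecMulVec_mulVec_eq_smul, Pi.smul_apply, smul_eq_mul, dotProduct]
  congr 1
  refine Finset.sum_congr (by simp) fun s _ => ?_
  rw [mul_comm]
  congr 1
  exact Finset.sum_congr rfl fun k _ => mul_comm _ _

/-- Normal equations. -/
theorem regGram_mulVec_estimate (path : ℕ → sys.stateSet × sys.ctrlSet) {t : ℕ} (ht : t ≠ 0)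
    (j : Fin n) :
    sys.regGram path t *ᵥ (fun i => sys.estimate path t i j) = fun i =>
      ∑ s ∈ Finset.Icc 1 t, sys.regressor path s i *
        ((path s).1 - sys.f (path (s - 1)).1 (path (s - 1)).2 : EuclideanSpace ℝ (Fin n)) j := by
  funext i
  rw [regGram_apply, sys.estimate_stationary path ht i j, ← Finset.sum_add_distrib]
  refine Finset.sum_congr rfl fun s _ => ?_
  rw [PiLp.sub_apply, PiLp.sub_apply, PiLp.sub_apply, toEuclideanLin_transpose_apply]
  ring

theorem regGram_posDef (path : ℕ → sys.stateSet × sys.ctrlSet) (t : ℕ) :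
    (sys.regGram path t).PosDef :=
  gramMat_posDef (posDef_of_le (isHermitian_smul_one _) sys.γ_pos
    fun x => (dotProduct_smul_one_mulVec _ x).ge) _ t

/-- The estimate is defined by an arbitrary choice among minimisers. Invertibility of the
regularised Gram matrix gives it a closed form, and this is what makes it a measurable function of
the path. -/
theorem estimate_eq_inv_mulVec (path : ℕ → sys.stateSet × sys.ctrlSet) {t : ℕ} (ht : t ≠ 0)
    (i : Fin d) (j : Fin n) :
    sys.estimate path t i j = ((sys.regGram path t)⁻¹ *ᵥ fun i =>
      ∑ s ∈ Finset.Icc 1 t, sys.regressor path s i *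
        ((path s).1 - sys.f (path (s - 1)).1 (path (s - 1)).2 : EuclideanSpace ℝ (Fin n)) j) i := by
  rw [← sys.regGram_mulVec_estimate path ht j, (sys.regGram_posDef path t).inv_mulVec]

variable {sys}

section Measurability

variable {Ω : Type*} {mΩ' : MeasurableSpace Ω}

theorem measurable_regressor (hm : sys.MeasurableMaps) {t : ℕ}
    {p : Ω → ℕ → sys.stateSet × sys.ctrlSet} (hp : ∀ s ≤ t, Measurable fun ω => p ω s) {s : ℕ}
    (hs : s ≤ t + 1) : Measurable fun ω => sys.regressor (p ω) s :=
  hm.ψ.comp (hp (s - 1) (by omega))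

theorem measurable_toEuclideanLin {a b : ℕ} (A : Matrix (Fin a) (Fin b) ℝ) :
    Measurable (Matrix.toEuclideanLin A) :=
  (LinearMap.continuous_of_finiteDimensional (Matrix.toEuclideanLin A)).measurable

theorem measurable_next (hm : sys.MeasurableMaps) :
    Measurable fun x : (sys.stateSet × sys.ctrlSet) × sys.noiseSet =>
      sys.next x.1.1 x.1.2 x.2 := by
  refine Measurable.subtype_mk ?_
  unfold g
  exact ((hm.f.comp measurable_fst).add
    ((measurable_toEuclideanLin _).comp (hm.ψ.comp measurable_fst))).add
      (measurable_subtype_coe.comp measurable_snd)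

theorem measurable_estimate (hm : sys.MeasurableMaps) {t : ℕ}
    {p : Ω → ℕ → sys.stateSet × sys.ctrlSet} (hp : ∀ s ≤ t, Measurable fun ω => p ω s) :
    Measurable fun ω => (fun i j => sys.estimate (p ω) t i j : Fin d → Fin n → ℝ) := by
  rcases eq_or_ne t 0 with rfl | ht
  · simp only [estimate, if_true]
    exact measurable_const
  refine measurable_pi_lambda _ fun i => measurable_pi_lambda _ fun j => ?_
  simp_rw [sys.estimate_eq_inv_mulVec _ ht]
  have hz : ∀ s ≤ t, Measurable fun ω => sys.regressor (p ω) s := fun s hs =>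
    measurable_regressor hm hp (by omega)
  have hz' : ∀ s ≤ t, Measurable fun ω => (sys.regressor (p ω) s).ofLp := fun s hs =>
    (by fun_prop : Measurable fun x : EuclideanSpace ℝ (Fin d) => x.ofLp).comp (hz s hs)
  have hG : Measurable fun ω => (fun i j => sys.regGram (p ω) t i j : Fin d → Fin d → ℝ) :=
    measurable_gramMat (Λ := fun _ => (sys.γ • (1 : Matrix (Fin d) (Fin d) ℝ)))
      (z := fun s ω => (sys.regressor (p ω) (s + 1)).ofLp) measurable_const
      fun s hs => hz' (s + 1) hs
  simp only [mulVec, dotProduct]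
  refine Finset.measurable_sum _ fun k _ => Measurable.mul ((measurable_inv_of i k).comp hG) ?_
  refine Finset.measurable_sum _ fun s hs => ?_
  have hs' := (Finset.mem_Icc.1 hs).2
  have hx : Measurable fun ω => ((p ω s).1 - sys.f (p ω (s - 1)).1 (p ω (s - 1)).2 :
      EuclideanSpace ℝ (Fin n)) :=
    (measurable_subtype_coe.comp (hp s hs').fst).sub (hm.f.comp (hp (s - 1) (by omega)))
  refine Measurable.mul ?_ ?_
  · exact (measurable_pi_apply k).comp (hz' s hs')
  · exact (by fun_prop : Measurable fun x : EuclideanSpace ℝ (Fin n) => x j).comp hx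

variable {W : ℕ → Ω → sys.noiseSet} {S : ℕ → Ω → sys.explSet} (x₀ : sys.stateSet)

theorem path_succ (w : ℕ → sys.noiseSet) (s : ℕ → sys.explSet) (t : ℕ) :
    sys.path x₀ w s (t + 1) =
      (sys.next (sys.path x₀ w s t).1 (sys.path x₀ w s t).2 (w (t + 1)),
        sys.α (sys.next (sys.path x₀ w s t).1 (sys.path x₀ w s t).2 (w (t + 1))) (s (t + 1))
          (sys.estimate (sys.path x₀ w s) t)) := by
  have h : sys.estimate (sys.path x₀ w s) t = sys.estimate (sys.hist x₀ w s t) t :=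
    sys.estimate_congr fun i hi => (sys.hist_eq_path x₀ _ _ hi).symm
  rw [h]
  simp only [path, hist, Function.update_self]

theorem measurable_path (hm : sys.MeasurableMaps) {t : ℕ} (hW : ∀ i < t, Measurable (W (i + 1)))
    (hS : ∀ i ≤ t, Measurable (S i)) {s : ℕ} (hs : s ≤ t) :
    Measurable fun ω => sys.path x₀ (fun i => W i ω) (fun i => S i ω) s := by
  induction t generalizing s with
  | zero =>
    obtain rfl : s = 0 := by omega
    refine measurable_const.prodMk (hm.α.comp (measurable_const.prodMk
      ((hS 0 le_rfl).prodMk measurable_const)))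
  | succ t ih =>
    have ih' : ∀ s ≤ t, Measurable fun ω => sys.path x₀ (fun i => W i ω) (fun i => S i ω) s :=
      fun s hs => ih (fun i hi => hW i (by omega)) (fun i hi => hS i (by omega)) hs
    rcases Nat.lt_or_ge s (t + 1) with h | h
    · exact ih' s (by omega)
    · obtain rfl : s = t + 1 := by omega
      simp_rw [path_succ]
      have hx := (measurable_next hm).comp ((ih' t le_rfl).prodMk (hW t (by omega)))
      refine hx.prodMk ?_
      exact hm.α.comp (hx.prodMk ((hS (t + 1) le_rfl).prodMk (measurable_estimate hm ih')))

end Measurability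

section ErrorBound

variable (x₀ : sys.stateSet) (w : ℕ → sys.noiseSet) (s : ℕ → sys.explSet)

/-- Normalised regressors of the closed loop, indexed from zero. -/
def normRegressor (t : ℕ) : Fin d → ℝ :=
  (Real.sqrt sys.γ)⁻¹ • (sys.regressor (sys.path x₀ w s) (t + 1)).ofLp

/-- Coordinate `j` of the process noise, indexed from zero. -/
def noiseCoord (j : Fin n) (t : ℕ) : ℝ := (w (t + 1) : EuclideanSpace ℝ (Fin n)) j

theorem regGram_path (t : ℕ) : sys.regGram (sys.path x₀ w s) t
    = sys.γ • gramMat 1 (normRegressor x₀ w s) t := by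
  rw [regGram, gramMat, gramMat, smul_add, Finset.smul_sum]
  congr 1
  refine Finset.sum_congr rfl fun i _ => ?_
  rw [normRegressor, smul_vecMulVec, vecMulVec_smul, smul_smul, smul_smul]
  have h := Real.mul_self_sqrt sys.γ_pos.le
  have h0 : Real.sqrt sys.γ ≠ 0 := (Real.sqrt_pos.2 sys.γ_pos).ne'
  have : sys.γ * (Real.sqrt sys.γ)⁻¹ * (Real.sqrt sys.γ)⁻¹ = 1 := by
    nth_rewrite 1 [← h]
    field_simp
  rw [this, one_smul]

/-- Error equation of the regularised least squares estimate. -/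
theorem gramMat_mulVec_error {t : ℕ} (ht : t ≠ 0) (j : Fin n) :
    gramMat 1 (normRegressor x₀ w s) t *ᵥ
        (fun i => (sys.estimate (sys.path x₀ w s) t - sys.θstar) i j) =
      (Real.sqrt sys.γ)⁻¹ • noiseSum (normRegressor x₀ w s) (noiseCoord w j) t
        - fun i => sys.θstar i j := by
  have h1 := sys.regGram_mulVec_estimate (sys.path x₀ w s) ht j
  have hγ := sys.γ_pos
  have h2 : sys.regGram (sys.path x₀ w s) t *ᵥ
      (fun i => (sys.estimate (sys.path x₀ w s) t - sys.θstar) i j) =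
      sys.γ • ((Real.sqrt sys.γ)⁻¹ • noiseSum (normRegressor x₀ w s) (noiseCoord w j) t
        - fun i => sys.θstar i j) := by
    have e : (fun i => (sys.estimate (sys.path x₀ w s) t - sys.θstar) i j) =
        (fun i => sys.estimate (sys.path x₀ w s) t i j) - fun i => sys.θstar i j := rfl
    rw [e, mulVec_sub, h1]
    funext i
    rw [Pi.sub_apply, regGram_apply, Pi.smul_apply, Pi.sub_apply, Pi.smul_apply, noiseSum,
      Finset.sum_apply, Finset.range_eq_Ico]
    have h3 : ∀ k : ℕ, (noiseCoord w j k • normRegressor x₀ w s k) i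
        = (Real.sqrt sys.γ)⁻¹ * ((w (k + 1) : EuclideanSpace ℝ (Fin n)) j *
            sys.regressor (sys.path x₀ w s) (k + 1) i) := by
      intro k
      simp only [noiseCoord, normRegressor, Pi.smul_apply, smul_eq_mul]
      ring
    simp_rw [h3]
    rw [← Finset.mul_sum, Finset.sum_Ico_add' (f := fun k => (w k : EuclideanSpace ℝ (Fin n)) j *
            sys.regressor (sys.path x₀ w s) k i) (c := 1)]
    have h4 : Finset.Ico (0 + 1) (t + 1) = Finset.Icc 1 t := by ext; simp
    have h5 : ∀ k ∈ Finset.Icc 1 t, sys.regressor (sys.path x₀ w s) k i *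
        ((sys.path x₀ w s k).1 - sys.f (sys.path x₀ w s (k - 1)).1 (sys.path x₀ w s (k - 1)).2 :
          EuclideanSpace ℝ (Fin n)) j =
        (w k : EuclideanSpace ℝ (Fin n)) j * sys.regressor (sys.path x₀ w s) k i +
        sys.regressor (sys.path x₀ w s) k i *
          ∑ l, sys.θstar l j * sys.regressor (sys.path x₀ w s) k l := by
      intro k hk
      obtain ⟨k, rfl⟩ : ∃ l, k = l + 1 := ⟨k - 1, by have := (Finset.mem_Icc.1 hk).1; omega⟩
      have e2 : ((sys.path x₀ w s (k + 1)).1 - sys.f (sys.path x₀ w s (k + 1 - 1)).1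
          (sys.path x₀ w s (k + 1 - 1)).2 : EuclideanSpace ℝ (Fin n)) =
          Matrix.toEuclideanLin sys.θstar.transpose (sys.regressor (sys.path x₀ w s) (k + 1))
            + w (k + 1) := by
        rw [path_succ]
        simp only [next, ClosedLoopSystem.g, regressor, Nat.add_sub_cancel]
        abel
      rw [e2, PiLp.add_apply, toEuclideanLin_transpose_apply]
      ring
    rw [h4, Finset.sum_congr rfl h5, Finset.sum_add_distrib]
    have h6 : sys.γ * (Real.sqrt sys.γ)⁻¹ * (Real.sqrt sys.γ)⁻¹ = 1 := by
      have h := Real.mul_self_sqrt sys.γ_pos.le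
      have h0 : Real.sqrt sys.γ ≠ 0 := (Real.sqrt_pos.2 sys.γ_pos).ne'
      nth_rewrite 1 [← h]
      field_simp
    simp only [smul_eq_mul]
    rw [mul_sub, ← mul_assoc, ← mul_assoc, h6]
    ring
  rw [regGram_path, smul_mulVec] at h2
  exact smul_right_injective _ hγ.ne' h2

end ErrorBound

end ClosedLoopSystem

/-! ### Deterministic operator norm bound. -/

section EuclideanNorm

open Matrix

theorem norm_toLp_sq {k : ℕ} (x : Fin k → ℝ) : ‖WithLp.toLp 2 x‖ ^ 2 = x ⬝ᵥ x := by
  rw [EuclideanSpace.real_norm_sq_eq]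
  simp [dotProduct, sq]

theorem matFrobNorm_nonneg {a b : ℕ} (A : Matrix (Fin a) (Fin b) ℝ) : 0 ≤ matFrobNorm A :=
  Real.sqrt_nonneg _

theorem norm_toEuclideanLin_le_matFrobNorm {a b : ℕ} (A : Matrix (Fin a) (Fin b) ℝ)
    (v : EuclideanSpace ℝ (Fin b)) : ‖Matrix.toEuclideanLin A v‖ ≤ matFrobNorm A * ‖v‖ := by
  refine le_of_sq_le_sq ?_ (mul_nonneg (matFrobNorm_nonneg A) (norm_nonneg _))
  rw [mul_pow, EuclideanSpace.real_norm_sq_eq, EuclideanSpace.real_norm_sq_eq,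
    ClosedLoopSystem.matFrobNorm_sq, Finset.sum_mul]
  refine Finset.sum_le_sum fun i _ => ?_
  rw [Matrix.toLpLin_apply]
  exact Finset.sum_mul_sq_le_sq_mul_sq Finset.univ (A i) v

/-- For the regularisation bias: `V ≥ h` gives `|V⁻¹ x| ≤ |x| / h`, which is weakened to `|x| / √h`
by `h ≥ 1` so that bias and noise share one denominator. -/
theorem Matrix.inv_mulVec_sq_le_of_one_le {d : ℕ} {V : Matrix (Fin d) (Fin d) ℝ} (hV : V.PosDef)
    {h : ℝ} (h1 : 1 ≤ h) (hle : ∀ x, h * (x ⬝ᵥ x) ≤ x ⬝ᵥ V *ᵥ x) (x : Fin d → ℝ) :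
    h * ((V⁻¹ *ᵥ x) ⬝ᵥ (V⁻¹ *ᵥ x)) ≤ x ⬝ᵥ x := by
  have h2 := hle (V⁻¹ *ᵥ x)
  rw [hV.mulVec_inv] at h2
  generalize V⁻¹ *ᵥ x = y at h2 ⊢
  have h3 := dotProduct_sq_le y x
  have hx := dotProduct_self_nonneg' x
  have hy := dotProduct_self_nonneg' y
  have h4 : (h * (y ⬝ᵥ y)) * (h * (y ⬝ᵥ y)) ≤ (y ⬝ᵥ y) * (x ⬝ᵥ x) := by
    have h5 : (0 : ℝ) ≤ h * (y ⬝ᵥ y) := by positivity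
    nlinarith [mul_le_mul h2 h2 h5 (h5.trans h2)]
  rcases hy.eq_or_lt with h0 | h0
  · rw [← h0, mul_zero]
    exact hx
  · have h5 : h * (h * (y ⬝ᵥ y)) ≤ x ⬝ᵥ x := by
      refine le_of_mul_le_mul_right ?_ h0
      nlinarith [h4]
    nlinarith [mul_le_mul_of_nonneg_right h1 (by positivity : 0 ≤ h * (y ⬝ᵥ y))]

/-- Operator norm bound for a matrix with columns `V⁻¹ (r Sⱼ - Tⱼ)`. -/
theorem matOpNorm_le_of_columns {d n : ℕ} {V : Matrix (Fin d) (Fin d) ℝ} (hV : V.PosDef)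
    {h r b : ℝ} (h1 : 1 ≤ h) (hr : 0 ≤ r) (hle : ∀ x, h * (x ⬝ᵥ x) ≤ x ⬝ᵥ V *ᵥ x)
    {E T : Matrix (Fin d) (Fin n) ℝ} {S : Fin n → Fin d → ℝ} (hb : 0 ≤ b)
    (hS : ∀ j, h * ((V⁻¹ *ᵥ S j) ⬝ᵥ (V⁻¹ *ᵥ S j)) ≤ b ^ 2)
    (hE : ∀ j, V *ᵥ (fun i => E i j) = r • S j - fun i => T i j) :
    matOpNorm E ≤ 1 / Real.sqrt h * (r * (Real.sqrt n * b) + matFrobNorm T) := by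
  have hh : 0 < Real.sqrt h := Real.sqrt_pos.2 (by linarith)
  have hT := matFrobNorm_nonneg T
  refine ContinuousLinearMap.opNorm_le_bound _ (by positivity) fun v => ?_
  have hcol : (Matrix.toEuclideanLin E v).ofLp = V⁻¹ *ᵥ (r • (∑ j, v j • S j) - T *ᵥ v.ofLp) := by
    rw [Matrix.toLpLin_apply, ← hV.inv_mulVec (E *ᵥ v.ofLp)]
    change V⁻¹ *ᵥ (V *ᵥ (E *ᵥ v.ofLp)) = _
    congr 1
    have e1 : E *ᵥ v.ofLp = ∑ j, v j • fun i => E i j := by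
      funext i
      simp [mulVec, dotProduct, mul_comm]
    have e2 : T *ᵥ v.ofLp = ∑ j, v j • fun i => T i j := by
      funext i
      simp [mulVec, dotProduct, mul_comm]
    rw [e1, e2, mulVec_sum, Finset.smul_sum, ← Finset.sum_sub_distrib]
    refine Finset.sum_congr rfl fun j _ => ?_
    rw [mulVec_smul, hE, smul_sub, smul_comm]
  have hnorm : ∀ x : Fin d → ℝ, ∀ B, 0 ≤ B → h * (x ⬝ᵥ x) ≤ B ^ 2 →
      ‖WithLp.toLp 2 x‖ ≤ 1 / Real.sqrt h * B := by
    intro x B hB hx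
    rw [one_div_mul_eq_div, le_div_iff₀ hh]
    refine le_of_sq_le_sq ?_ hB
    rw [mul_pow, norm_toLp_sq, Real.sq_sqrt (by linarith), mul_comm]
    exact hx
  have hv : ‖Matrix.toEuclideanLin E v‖ ≤
      r * ‖WithLp.toLp 2 (V⁻¹ *ᵥ ∑ j, v j • S j)‖ + ‖WithLp.toLp 2 (V⁻¹ *ᵥ (T *ᵥ v.ofLp))‖ := by
    have e : Matrix.toEuclideanLin E v = r • WithLp.toLp 2 (V⁻¹ *ᵥ ∑ j, v j • S j)
        - WithLp.toLp 2 (V⁻¹ *ᵥ (T *ᵥ v.ofLp)) := by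
      rw [← WithLp.toLp_ofLp 2 (Matrix.toEuclideanLin E v), hcol, mulVec_sub, mulVec_smul]
      rfl
    rw [e]
    refine (norm_sub_le _ _).trans ?_
    rw [norm_smul, Real.norm_of_nonneg hr]
  have hT2 : ‖WithLp.toLp 2 (V⁻¹ *ᵥ (T *ᵥ v.ofLp))‖ ≤ 1 / Real.sqrt h * (matFrobNorm T * ‖v‖) := by
    refine hnorm _ _ (by positivity) ?_
    refine (Matrix.inv_mulVec_sq_le_of_one_le hV h1 hle _).trans ?_
    rw [← norm_toLp_sq]
    have := norm_toEuclideanLin_le_matFrobNorm T v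
    rw [Matrix.toLpLin_apply] at this
    exact pow_le_pow_left₀ (norm_nonneg _) this 2
  have hSj : ∀ j, ‖WithLp.toLp 2 (V⁻¹ *ᵥ S j)‖ ≤ 1 / Real.sqrt h * b := fun j =>
    hnorm _ _ hb (hS j)
  have hS2 : ‖WithLp.toLp 2 (V⁻¹ *ᵥ ∑ j, v j • S j)‖ ≤
      1 / Real.sqrt h * (Real.sqrt n * b) * ‖v‖ := by
    have e : WithLp.toLp 2 (V⁻¹ *ᵥ ∑ j, v j • S j) = ∑ j, v j • WithLp.toLp 2 (V⁻¹ *ᵥ S j) := by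
      rw [mulVec_sum, WithLp.toLp_sum]
      refine Finset.sum_congr rfl fun j _ => ?_
      rw [mulVec_smul]
      rfl
    -- Passing from columns to the operator norm by Cauchy–Schwarz costs `√n`; this is the factor
    -- `n` under the root of the error bound.
    have hsum : ∑ j, |v j| ≤ Real.sqrt n * ‖v‖ := by
      refine le_of_sq_le_sq ?_ (by positivity)
      have := Finset.sum_mul_sq_le_sq_mul_sq Finset.univ (fun _ => (1 : ℝ)) (fun j => |v j|)
      rw [mul_pow, Real.sq_sqrt (by positivity), EuclideanSpace.real_norm_sq_eq]
      simpa using this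
    rw [e]
    calc ‖∑ j, v j • WithLp.toLp 2 (V⁻¹ *ᵥ S j)‖
        ≤ ∑ j, ‖v j • WithLp.toLp 2 (V⁻¹ *ᵥ S j)‖ := norm_sum_le _ _
      _ ≤ ∑ j, |v j| * (1 / Real.sqrt h * b) := by
          refine Finset.sum_le_sum fun j _ => ?_
          rw [norm_smul, Real.norm_eq_abs]
          exact mul_le_mul_of_nonneg_left (hSj j) (abs_nonneg _)
      _ = (∑ j, |v j|) * (1 / Real.sqrt h * b) := by rw [Finset.sum_mul]
      _ ≤ (Real.sqrt n * ‖v‖) * (1 / Real.sqrt h * b) := by gcongr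
      _ = _ := by ring
  calc ‖Matrix.toEuclideanLin E v‖
      ≤ r * (1 / Real.sqrt h * (Real.sqrt n * b) * ‖v‖)
        + 1 / Real.sqrt h * (matFrobNorm T * ‖v‖) :=
        hv.trans (add_le_add (mul_le_mul_of_nonneg_left hS2 hr) hT2)
    _ = _ := by ring

end EuclideanNorm

namespace ClosedLoopSystem

open Matrix

variable {n m d q : ℕ} {sys : ClosedLoopSystem n m d q}

/-- Deterministic error bound on the event where the excitation and self-normalised bounds hold. -/
theorem matOpNorm_error_le (hd : 1 ≤ d) (x₀ : sys.stateSet) (w : ℕ → sys.noiseSet)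
    (s : ℕ → sys.explSet) (t : ℕ) {g κ a σ : ℝ} (hg0 : 0 ≤ g) (hσ : 0 ≤ σ)
    (ha : 2 * Real.log 3 ≤ a)
    (hlow : ∀ x : Fin d → ℝ, g * (x ⬝ᵥ x) ≤
      ∑ k ∈ Finset.range t, (normRegressor x₀ w s (k + 1) ⬝ᵥ x) ^ 2)
    (hup : ∑ k ∈ Finset.range t, normRegressor x₀ w s (k + 1) ⬝ᵥ normRegressor x₀ w s (k + 1) ≤ κ)
    (hSN : ∀ j : Fin n,
      noiseSum (normRegressor x₀ w s) (noiseCoord w j) (t + 1) ⬝ᵥ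
        (gramMat (priorMat d (normRegressor x₀ w s 0)) (normRegressor x₀ w s) (t + 1))⁻¹ *ᵥ
          noiseSum (normRegressor x₀ w s) (noiseCoord w j) (t + 1) ≤
      σ ^ 2 * (a + Real.log ((gramMat (priorMat d (normRegressor x₀ w s 0))
        (normRegressor x₀ w s) (t + 1)).det / (priorMat d (normRegressor x₀ w s 0)).det))) :
    matOpNorm (sys.estimate (sys.path x₀ w s) (t + 1) - sys.θstar) ≤
      1 / Real.sqrt (sys.γ * (1 + g)) * (Real.sqrt sys.γ * matFrobNorm sys.θstar
        + σ * Real.sqrt (n * (a + d * Real.log (1 + κ)))) := by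
  set z := normRegressor x₀ w s with hz
  set G : Matrix (Fin d) (Fin d) ℝ := ∑ k ∈ Finset.range t, vecMulVec (z (k + 1)) (z (k + 1))
    with hG
  have hgram : ∀ Λ : Matrix (Fin d) (Fin d) ℝ, gramMat Λ z (t + 1) = Λ + vecMulVec (z 0) (z 0) + G := by
    intro Λ
    rw [gramMat, Finset.sum_range_succ', add_comm (∑ k ∈ Finset.range t, _), ← add_assoc]
  have hGq : ∀ x : Fin d → ℝ, x ⬝ᵥ G *ᵥ x = ∑ k ∈ Finset.range t, (z (k + 1) ⬝ᵥ x) ^ 2 := by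
    intro x
    rw [hG, sum_mulVec, dotProduct_sum]
    exact Finset.sum_congr rfl fun k _ => dotProduct_vecMulVec_self _ _
  have hGh : G.IsHermitian := by
    rw [hG, Matrix.IsHermitian, conjTranspose_sum]
    exact Finset.sum_congr rfl fun k _ => isHermitian_vecMulVec_self _
  have hg : ∀ x, g * (x ⬝ᵥ x) ≤ x ⬝ᵥ G *ᵥ x := fun x => by rw [hGq]; exact hlow x
  have htr : G.trace ≤ κ := by
    rw [hG, trace_sum]
    simpa only [trace_vecMulVec] using hup
  have hκ : ∀ x, x ⬝ᵥ G *ᵥ x ≤ κ * (x ⬝ᵥ x) := by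
    intro x
    rw [hGq]
    calc ∑ k ∈ Finset.range t, (z (k + 1) ⬝ᵥ x) ^ 2
        ≤ ∑ k ∈ Finset.range t, (z (k + 1) ⬝ᵥ z (k + 1)) * (x ⬝ᵥ x) :=
          Finset.sum_le_sum fun k _ => dotProduct_sq_le _ _
      _ ≤ κ * (x ⬝ᵥ x) := by
          rw [← Finset.sum_mul]
          exact mul_le_mul_of_nonneg_right hup (dotProduct_self_nonneg' x)
  have hκ0 : 0 ≤ κ := le_trans (Finset.sum_nonneg fun k _ => dotProduct_self_nonneg' _) hup
  have hlog : 0 ≤ Real.log (1 + κ) := Real.log_nonneg (by linarith)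
  have hlog3 : 0 < Real.log 3 := Real.log_pos (by norm_num)
  have hB : 0 ≤ a + d * Real.log (1 + κ) := add_nonneg (by linarith) (by positivity)
  -- The first regressor is kept apart from `G`: neither the lower bound `g` nor the upper bound `κ`
  -- involves it.
  have hV : ((1 : Matrix (Fin d) (Fin d) ℝ) + vecMulVec (z 0) (z 0) + G).PosDef := by
    simpa using posDef_smul_one_add_vecMulVec_add (z := z 0) hGh hg hg0 zero_lt_one zero_le_one
  have hVle : ∀ x, (1 + g) * (x ⬝ᵥ x) ≤
      x ⬝ᵥ ((1 : Matrix (Fin d) (Fin d) ℝ) + vecMulVec (z 0) (z 0) + G) *ᵥ x := by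
    intro x
    have h1 := quadForm_smul_one_add_vecMulVec_add (G := G) (z := z 0) 1 1 x
    rw [one_smul, one_smul] at h1
    rw [h1]
    nlinarith [hg x, sq_nonneg (z 0 ⬝ᵥ x)]
  have hcols := matOpNorm_le_of_columns hV (h := 1 + g) (r := (Real.sqrt sys.γ)⁻¹)
    (b := Real.sqrt (σ ^ 2 * (a + d * Real.log (1 + κ)))) (by linarith) (by positivity) hVle
    (E := sys.estimate (sys.path x₀ w s) (t + 1) - sys.θstar) (T := sys.θstar)
    (S := fun j => noiseSum z (noiseCoord w j) (t + 1)) (Real.sqrt_nonneg _)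
    (fun j => by
      rw [Real.sq_sqrt (mul_nonneg (sq_nonneg σ) hB)]
      refine inv_mulVec_sq_le_of_priorMat hd hGh hg0 hg hκ htr ha (sq_nonneg σ) ?_
      have := hSN j
      rw [hgram] at this
      exact this)
    (fun j => by
      rw [← hgram]
      exact gramMat_mulVec_error x₀ w s (Nat.succ_ne_zero t) j)
  refine hcols.trans (le_of_eq ?_)
  have hγ := sys.γ_pos
  have hγ' : Real.sqrt sys.γ ≠ 0 := (Real.sqrt_pos.2 hγ).ne'
  have hg' : Real.sqrt (1 + g) ≠ 0 := (Real.sqrt_pos.2 (by linarith)).ne'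
  rw [Real.sqrt_mul (sq_nonneg σ), Real.sqrt_sq hσ, Real.sqrt_mul hγ.le,
    Real.sqrt_mul (by positivity : (0 : ℝ) ≤ n)]
  field_simp
  ring

end ClosedLoopSystem

/-! ### Bounds on noise, states and regressors. -/

section Tail

variable {Ω : Type*} {mΩ : MeasurableSpace Ω} {P : Measure Ω}

/-- Two-sided sub-Gaussian tail bound, including the degenerate variance `0`. -/
theorem measure_abs_gt_le_of_hasSubgaussianMGF {Y : Ω → ℝ} {σ : ℝ} (hσ : 0 ≤ σ)
    [IsProbabilityMeasure P]
    (hY : HasSubgaussianMGF Y ⟨σ ^ 2, sq_nonneg σ⟩ P) {L : ℝ} (hL : 1 ≤ L) :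
    P {ω | σ * Real.sqrt (2 * Real.log L) < |Y ω|} ≤ ENNReal.ofReal (2 / L) := by
  have hL0 : 0 < L := by linarith
  rcases hσ.eq_or_lt with rfl | hσ0
  · have h0 : Y =ᵐ[P] 0 := by
      refine HasSubgaussianMGF.ae_eq_zero_of_hasSubgaussianMGF_zero ?_
      have e : (⟨(0 : ℝ) ^ 2, sq_nonneg 0⟩ : ℝ≥0) = 0 := by
        ext
        simp
      rwa [e] at hY
    have : P {ω | 0 * Real.sqrt (2 * Real.log L) < |Y ω|} = 0 := by
      refine measure_mono_null (fun ω hω => ?_) (ae_iff.1 h0)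
      simpa using hω
    rw [this]
    exact zero_le
  have hlog := Real.log_nonneg hL
  set ε := σ * Real.sqrt (2 * Real.log L) with hε
  have hε0 : 0 ≤ ε := by positivity
  have hexp : Real.exp (-ε ^ 2 / (2 * σ ^ 2)) = 1 / L := by
    have : -ε ^ 2 / (2 * σ ^ 2) = -Real.log L := by
      rw [hε, mul_pow, Real.sq_sqrt (by positivity)]
      field_simp
    rw [this, Real.exp_neg, Real.exp_log hL0, one_div]
  have h1 := hY.measure_ge_le hε0
  have h2 := hY.neg.measure_ge_le hε0
  change P.real _ ≤ Real.exp (-ε ^ 2 / (2 * σ ^ 2)) at h1 h2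
  rw [hexp] at h1 h2
  have h3 : P {ω | ε < |Y ω|} ≤ P {ω | ε ≤ Y ω} + P {ω | ε ≤ (-Y) ω} := by
    refine (measure_mono fun ω hω => ?_).trans (measure_union_le _ _)
    rcases lt_abs.1 (show ε < |Y ω| from hω) with h | h
    · exact Or.inl h.le
    · exact Or.inr h.le
  refine h3.trans ?_
  have e : 2 / L = 1 / L + 1 / L := by ring
  rw [e, ENNReal.ofReal_add (by positivity) (by positivity), ← ofReal_measureReal,
    ← ofReal_measureReal]
  exact add_le_add (ENNReal.ofReal_le_ofReal h1) (ENNReal.ofReal_le_ofReal h2)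

end Tail

/-- `∑ₖ b / k² ≤ b π² / 6` in `ℝ≥0∞`. -/
theorem tsum_ofReal_div_sq_le {b : ℝ} (hb : 0 ≤ b) :
    ∑' k : ℕ, ENNReal.ofReal (b / ((k : ℝ) + 1) ^ 2) ≤ ENNReal.ofReal (b * (Real.pi ^ 2 / 6)) := by
  have h1 : HasSum (fun k : ℕ => (1 : ℝ) / ((k + 1 : ℕ) : ℝ) ^ 2) (Real.pi ^ 2 / 6) := by
    have := (hasSum_nat_add_iff' (f := fun k : ℕ => (1 : ℝ) / (k : ℝ) ^ 2) 1).2 hasSum_zeta_two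
    simpa using this
  have h2 : HasSum (fun k : ℕ => b / ((k : ℝ) + 1) ^ 2) (b * (Real.pi ^ 2 / 6)) := by
    refine (h1.mul_left b).congr_fun fun k => ?_
    push_cast
    ring
  rw [← h2.tsum_eq, ENNReal.ofReal_tsum_of_nonneg (fun k => by positivity) h2.summable]

namespace ClosedLoopSystem

variable {n m d q : ℕ} {sys : ClosedLoopSystem n m d q} {Ω : Type*} {mΩ : MeasurableSpace Ω}
  {P : Measure Ω} {W : ℕ → Ω → sys.noiseSet} {S : ℕ → Ω → sys.explSet}
  {μw : Measure sys.noiseSet} {μs : Measure sys.explSet} {σw : ℝ}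

theorem ProcessNoise.hasSubgaussianMGF_coord (hnoise : sys.ProcessNoise P W S μw σw)
    {t : ℕ} (ht : 1 ≤ t) (j : Fin n) :
    HasSubgaussianMGF (fun ω => (W t ω : EuclideanSpace ℝ (Fin n)) j)
      ⟨σw ^ 2, sq_nonneg σw⟩ P := by
  have h := hnoise.subGaussian t ht (EuclideanSpace.single j 1) (by simp)
  simpa [EuclideanSpace.inner_single_left] using h

theorem one_le_wBar_arg (hn : 1 ≤ n) {δ : ℝ} (hδ : 0 < δ) (hδ1 : δ ≤ 1) {t : ℕ} (ht : 1 ≤ t) :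
    1 ≤ n * Real.pi ^ 2 * (t : ℝ) ^ 2 / (3 * δ) := by
  have h1 : (1 : ℝ) ≤ n := by exact_mod_cast hn
  have h2 : (1 : ℝ) ≤ t := by exact_mod_cast ht
  have h3 := Real.pi_gt_three
  have h4 : (1 : ℝ) ≤ (t : ℝ) ^ 2 := one_le_pow₀ h2
  have h5 : (3 : ℝ) ≤ Real.pi ^ 2 := by nlinarith
  rw [le_div_iff₀ (by positivity)]
  calc 1 * (3 * δ) ≤ 1 * 3 * 1 := by linarith
    _ ≤ _ := by gcongr

theorem wBar_nonneg (hσw : 0 ≤ σw) (t : ℕ) (δ : ℝ) : 0 ≤ wBar n σw t δ := by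
  unfold wBar
  split_ifs
  · exact le_rfl
  · exact mul_nonneg hσw (Real.sqrt_nonneg _)

theorem wBar_mono (hn : 1 ≤ n) (hσw : 0 ≤ σw) {δ : ℝ} (hδ : 0 < δ) (hδ1 : δ ≤ 1) {s t : ℕ}
    (h1 : 1 ≤ s) (h2 : s ≤ t) : wBar n σw s δ ≤ wBar n σw t δ := by
  rw [wBar, wBar, if_neg (by omega), if_neg (by omega)]
  have h3 := one_le_wBar_arg hn hδ hδ1 h1
  gcongr

/-- Uniform-in-time bound on the process noise. -/
theorem ProcessNoise.measure_norm_gt_wBar_le [IsProbabilityMeasure P] (hn : 1 ≤ n) (hσw : 0 ≤ σw)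
    (hnoise : sys.ProcessNoise P W S μw σw) {δ : ℝ} (hδ : 0 < δ) (hδ1 : δ ≤ 1) :
    P {ω | ∃ t, 1 ≤ t ∧ wBar n σw t δ < ‖(W t ω : EuclideanSpace ℝ (Fin n))‖} ≤
      ENNReal.ofReal δ := by
  have hn0 : (0 : ℝ) < n := by exact_mod_cast hn
  -- If `|W|` exceeds `w̄`, some coordinate exceeds `w̄ / √n`. The `n` two-sided tails `2 / L` add
  -- up to `6δ / (π² (k + 1)²)`, which sums to `δ` over time.
  have hstep : ∀ k : ℕ, P {ω | wBar n σw (k + 1) δ < ‖(W (k + 1) ω : EuclideanSpace ℝ (Fin n))‖} ≤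
      ENNReal.ofReal (6 * δ / Real.pi ^ 2 / ((k : ℝ) + 1) ^ 2) := by
    intro k
    set L := n * Real.pi ^ 2 * ((k + 1 : ℕ) : ℝ) ^ 2 / (3 * δ) with hL
    have hL1 : 1 ≤ L := one_le_wBar_arg hn hδ hδ1 (by omega)
    have hlog := Real.log_nonneg hL1
    have hsub : {ω | wBar n σw (k + 1) δ < ‖(W (k + 1) ω : EuclideanSpace ℝ (Fin n))‖} ⊆
        ⋃ j : Fin n, {ω | σw * Real.sqrt (2 * Real.log L) <
          |(W (k + 1) ω : EuclideanSpace ℝ (Fin n)) j|} := by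
      intro ω hω
      by_contra hcon
      simp only [Set.mem_iUnion, Set.mem_ofPred_eq, not_exists, not_lt] at hcon hω
      refine absurd hω (not_lt.2 ?_)
      rw [wBar, if_neg (by omega), ← hL]
      refine le_of_sq_le_sq ?_ (by positivity)
      rw [EuclideanSpace.real_norm_sq_eq, mul_pow, Real.sq_sqrt (by positivity)]
      calc ∑ j, (W (k + 1) ω : EuclideanSpace ℝ (Fin n)) j ^ 2
          ≤ ∑ j : Fin n, (σw * Real.sqrt (2 * Real.log L)) ^ 2 := by
            refine Finset.sum_le_sum fun j _ => ?_
            rw [← sq_abs]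
            exact pow_le_pow_left₀ (abs_nonneg _) (hcon j) 2
        _ = σw ^ 2 * (2 * n * Real.log L) := by
            rw [mul_pow, Real.sq_sqrt (by positivity)]
            simp
            ring
    calc _ ≤ ∑ j : Fin n, P {ω | σw * Real.sqrt (2 * Real.log L) <
            |(W (k + 1) ω : EuclideanSpace ℝ (Fin n)) j|} :=
          (measure_mono hsub).trans (measure_iUnion_fintype_le _ _)
      _ ≤ ∑ j : Fin n, ENNReal.ofReal (2 / L) := Finset.sum_le_sum fun j _ =>
          measure_abs_gt_le_of_hasSubgaussianMGF hσw
            (hnoise.hasSubgaussianMGF_coord (by omega) j) hL1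
      _ = _ := by
          rw [Finset.sum_const, Finset.card_univ, Fintype.card_fin, nsmul_eq_mul,
            ← ENNReal.ofReal_natCast, ← ENNReal.ofReal_mul (by positivity), hL]
          congr 1
          have := Real.pi_pos
          push_cast
          field_simp
          norm_num
  have hsub : {ω | ∃ t, 1 ≤ t ∧ wBar n σw t δ < ‖(W t ω : EuclideanSpace ℝ (Fin n))‖} ⊆
      ⋃ k : ℕ, {ω | wBar n σw (k + 1) δ < ‖(W (k + 1) ω : EuclideanSpace ℝ (Fin n))‖} := by
    rintro ω ⟨t, ht, h⟩
    obtain ⟨k, rfl⟩ : ∃ k, t = k + 1 := ⟨t - 1, by omega⟩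
    exact Set.mem_iUnion.2 ⟨k, h⟩
  have hpi := Real.pi_pos
  refine (measure_mono hsub).trans ((measure_iUnion_le _).trans
    ((ENNReal.tsum_le_tsum hstep).trans ((tsum_ofReal_div_sq_le (by positivity)).trans_eq ?_)))
  congr 1
  field_simp

/-- Along each outcome the closed loop is an open-loop solution driven by its own controls, so the
input-to-state bound applies pathwise. -/
theorem path_fst_eq_detSol (x₀ : sys.stateSet) (w : ℕ → sys.noiseSet) (s : ℕ → sys.explSet)
    (t : ℕ) : (sys.path x₀ w s t).1 = sys.detSol x₀ (fun i => (sys.path x₀ w s i).2) w t := by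
  induction t with
  | zero => rfl
  | succ t ih =>
    rw [path_succ, detSol, ← ih]

variable {D : GrowthData}

theorem norm_path_snd_le (hctrl : sys.ConstrainedControls D) (x₀ : sys.stateSet)
    (w : ℕ → sys.noiseSet) (s : ℕ → sys.explSet) (t : ℕ) :
    ‖((sys.path x₀ w s t).2 : EuclideanSpace ℝ (Fin m))‖ ≤ D.umax := by
  cases t with
  | zero => exact hctrl.bound _ _ _
  | succ t =>
    rw [path_succ]
    exact hctrl.bound _ _ _

theorem _root_.ClassKInfty.mono {h : ℝ → ℝ} (hh : ClassKInfty h) {a b : ℝ} (ha : 0 ≤ a)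
    (hab : a ≤ b) : h a ≤ h b :=
  hh.strictMonoOn.monotoneOn ha (Set.mem_Ici.2 (ha.trans hab)) hab

theorem _root_.ClassKInfty.nonneg {h : ℝ → ℝ} (hh : ClassKInfty h) {a : ℝ} (ha : 0 ≤ a) :
    0 ≤ h a := by
  rw [← hh.map_zero]
  exact hh.mono le_rfl ha

theorem norm_path_fst_le_xBar (hn : 1 ≤ n) (hσw : 0 ≤ σw) (hstate : sys.InputToStateBound D)
    (hctrl : sys.ConstrainedControls D) (x₀ : sys.stateSet) {w : ℕ → sys.noiseSet}
    (s : ℕ → sys.explSet) {δ : ℝ} (hδ : 0 < δ) (hδ1 : δ ≤ 1) {t : ℕ} (ht : 1 ≤ t)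
    (hw : ∀ i, 1 ≤ i → ‖(w i : EuclideanSpace ℝ (Fin n))‖ ≤ wBar n σw i δ) :
    ‖((sys.path x₀ w s t).1 : EuclideanSpace ℝ (Fin n))‖ ≤ sys.xBar D σw t δ x₀ := by
  rw [path_fst_eq_detSol]
  refine (hstate.bound t ht _ _ _).trans ?_
  unfold xBar
  have h1 : ∑ i ∈ Finset.range t, D.σ₁ ‖((sys.path x₀ w s i).2 : EuclideanSpace ℝ (Fin m))‖ ≤
      t * D.σ₁ D.umax := by
    calc _ ≤ ∑ i ∈ Finset.range t, D.σ₁ D.umax := Finset.sum_le_sum fun i _ =>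
          hstate.σ₁.mono (norm_nonneg _) (norm_path_snd_le hctrl x₀ w s i)
      _ = _ := by simp
  have h2 : ∑ i ∈ Finset.Icc 1 t, D.σ₂ ‖(w i : EuclideanSpace ℝ (Fin n))‖ ≤
      t * D.σ₂ (wBar n σw t δ) := by
    calc _ ≤ ∑ i ∈ Finset.Icc 1 t, D.σ₂ (wBar n σw t δ) := by
          refine Finset.sum_le_sum fun i hi => ?_
          obtain ⟨hi1, hi2⟩ := Finset.mem_Icc.1 hi
          exact hstate.σ₂.1.mono (norm_nonneg _)
            ((hw i hi1).trans (wBar_mono hn hσw hδ hδ1 hi1 hi2))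
      _ = _ := by simp
  have h3 := hstate.χ₃.1.mono
    (Finset.sum_nonneg fun i _ => hstate.σ₁.nonneg (norm_nonneg _)) h1
  have h4 := hstate.χ₄.1.mono
    (Finset.sum_nonneg fun i _ => hstate.σ₂.1.nonneg (norm_nonneg _)) h2
  linarith

/-- The restriction `t ≥ 2` is essential: `Z(1)` involves `x₀`, and `x̄(0)` need not dominate
`|x₀|`, as the state bound is assumed at positive times only. -/
theorem norm_regressor_le_zBar (hn : 1 ≤ n) (hσw : 0 ≤ σw) (hstate : sys.InputToStateBound D)
    (hctrl : sys.ConstrainedControls D) (hfeat : sys.APBFeatures D) (x₀ : sys.stateSet)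
    {w : ℕ → sys.noiseSet} (s : ℕ → sys.explSet) {δ : ℝ} (hδ : 0 < δ) (hδ1 : δ ≤ 1) {t : ℕ}
    (ht : 2 ≤ t) (hw : ∀ i, 1 ≤ i → ‖(w i : EuclideanSpace ℝ (Fin n))‖ ≤ wBar n σw i δ) :
    ‖sys.regressor (sys.path x₀ w s) t‖ ≤ sys.zBar D σw t δ x₀ := by
  refine (hfeat.bound _ _).trans ?_
  unfold zBar
  refine hfeat.mono (Real.sqrt_nonneg _) (Real.sqrt_nonneg _) (Real.sqrt_le_sqrt ?_)
  have h1 := norm_path_fst_le_xBar hn hσw hstate hctrl x₀ s hδ hδ1 (t := t - 1) (by omega) hw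
  have h2 := norm_path_snd_le hctrl x₀ w s (t - 1)
  gcongr

end ClosedLoopSystem

open Matrix in
theorem measurable_priorMat {Ω : Type*} {mΩ : MeasurableSpace Ω} {d : ℕ} {z : Ω → Fin d → ℝ}
    (hz : Measurable z) : Measurable fun ω => (fun i j => priorMat d (z ω) i j) := by
  have hzi : ∀ i, Measurable fun ω => z ω i := fun i => (measurable_pi_apply i).comp hz
  refine measurable_pi_lambda _ fun i => measurable_pi_lambda _ fun j => ?_
  unfold priorMat
  split_ifs with hd
  · exact measurable_const
  · have hset : MeasurableSet {ω | z ω ⬝ᵥ z ω ≤ 1} := by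
      refine measurableSet_le ?_ measurable_const
      simp only [dotProduct]
      fun_prop
    have e : (fun ω => (if z ω ⬝ᵥ z ω ≤ 1 then (1 / 2 : ℝ) • (1 : Matrix (Fin d) (Fin d) ℝ)
        else (3 / 4 : ℝ) • 1 + vecMulVec (z ω) (z ω)) i j) =
        fun ω => if z ω ⬝ᵥ z ω ≤ 1 then ((1 / 2 : ℝ) • (1 : Matrix (Fin d) (Fin d) ℝ)) i j
          else ((3 / 4 : ℝ) • (1 : Matrix (Fin d) (Fin d) ℝ)) i j + z ω i * z ω j := by
      funext ω
      split_ifs <;> rfl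
    rw [e]
    exact Measurable.ite hset measurable_const (by fun_prop)

/-! ### Probabilities of the excitation and noise events. -/

namespace ClosedLoopSystem

variable {n m d q : ℕ} {sys : ClosedLoopSystem n m d q} {Ω : Type*} {mΩ : MeasurableSpace Ω}
  {P : Measure Ω} {W : ℕ → Ω → sys.noiseSet} {S : ℕ → Ω → sys.explSet}
  {μw : Measure sys.noiseSet} {μs : Measure sys.explSet} {σw : ℝ} [IsProbabilityMeasure P]

section Excitation

variable {c p : ℝ}

/-- In each direction, the regressors are exciting except on an exponentially small event. -/
theorem measure_excitation_lt_le (hexpl : sys.ExplNoise P S μs) (hmeas : sys.MeasurableMaps)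
    (hnoise : sys.ProcessNoise P W S μw σw) (hc : 0 < c) (hp : 0 < p)
    (hexc : sys.GloballyExcited μs μw c p) (x₀ : sys.stateSet)
    {ζ : EuclideanSpace ℝ (Fin d)} (hζ : ‖ζ‖ = 1) (N : ℕ) :
    P {ω | ∑ s ∈ Finset.range N, inner ℝ ζ (sys.regressor (sys.path x₀ (fun i => W i ω)
        (fun i => S i ω)) (s + 2)) ^ 2 < c * p * N / 2} ≤
      ENNReal.ofReal (Real.exp (-((1 - Real.log 2) * p * N / 2))) := by
  classical
  set ℱ := noiseFiltration hnoise.measurable_succ hexpl.measurable with hℱ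
  set pth : Ω → ℕ → sys.stateSet × sys.ctrlSet :=
    fun ω => sys.path x₀ (fun i => W i ω) (fun i => S i ω) with hpth
  -- What is frozen at time `t` is `X(t)`, `U(t)` and `θ̂(t)`; with the fresh pair `(S(t+1),
  -- W(t+1))` it determines the regressor `Z(t+2)`.
  set T : ℕ → Ω → (sys.stateSet × sys.ctrlSet) × (Fin d → Fin n → ℝ) :=
    fun t ω => (pth ω t, fun i j => sys.estimate (pth ω) t i j) with hTdef
  set Y : ℕ → Ω → sys.explSet × sys.noiseSet := fun t ω => (S (t + 1) ω, W (t + 1) ω) with hY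
  have hpm : ∀ t, ∀ s ≤ t, Measurable[ℱ t] fun ω => pth ω s := fun t s hs =>
    measurable_path (mΩ' := ℱ t) x₀ hmeas (fun i hi => comap_noise_measurable hi)
      (fun i hi => comap_expl_measurable hi) hs
  have hTm : ∀ t, Measurable[ℱ t] (T t) := fun t =>
    Measurable.prodMk (hpm t t le_rfl) (measurable_estimate (mΩ' := ℱ t) hmeas (hpm t))
  have hYm : ∀ t, Measurable[ℱ (t + 1)] (Y t) := fun t =>
    Measurable.prodMk (comap_expl_measurable le_rfl) (comap_noise_measurable (Nat.lt_succ_self t))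
  set Φ : ((sys.stateSet × sys.ctrlSet) × (Fin d → Fin n → ℝ)) × (sys.explSet × sys.noiseSet) →
      EuclideanSpace ℝ (Fin d) := fun a =>
    sys.ψ (sys.next a.1.1.1 a.1.1.2 a.2.2)
      (sys.α (sys.next a.1.1.1 a.1.1.2 a.2.2) a.2.1 (Matrix.of a.1.2)) with hΦ
  have hnext : Measurable fun a : ((sys.stateSet × sys.ctrlSet) × (Fin d → Fin n → ℝ)) ×
      (sys.explSet × sys.noiseSet) => sys.next a.1.1.1 a.1.1.2 a.2.2 :=
    (measurable_next hmeas).comp (g := fun x : (sys.stateSet × sys.ctrlSet) × sys.noiseSet =>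
      sys.next x.1.1 x.1.2 x.2) (by fun_prop : Measurable fun a : ((sys.stateSet × sys.ctrlSet) ×
        (Fin d → Fin n → ℝ)) × (sys.explSet × sys.noiseSet) => (a.1.1, a.2.2))
  have hΦm : Measurable Φ := hmeas.ψ.comp (hnext.prodMk (hmeas.α.comp
    (hnext.prodMk ((by fun_prop : Measurable fun a : ((sys.stateSet × sys.ctrlSet) ×
      (Fin d → Fin n → ℝ)) × (sys.explSet × sys.noiseSet) => (a.2.1, a.1.2))))))
  set C : Set (((sys.stateSet × sys.ctrlSet) × (Fin d → Fin n → ℝ)) ×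
    (sys.explSet × sys.noiseSet)) := {a | c ≤ |inner ℝ ζ (Φ a)| ^ 2} with hC
  have hCm : MeasurableSet C := by
    refine measurableSet_le measurable_const ?_
    have : Measurable fun a => inner ℝ ζ (Φ a) := Measurable.inner measurable_const hΦm
    exact (measurable_abs.comp this).pow_const 2
  have hprob : ∀ t a, ENNReal.ofReal p ≤ P.map (Y t) {y | (a, y) ∈ C} := by
    rintro t ⟨⟨x, u⟩, ϑ⟩
    rw [hY, map_expl_noise hexpl hnoise]
    -- The noiseless successor is a state by the closure of the dynamics at `w = 0`, so excitation
    -- holds at every step with the current estimate as `ϑ`.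
    refine (hexc (Matrix.of ϑ) (sys.g x u 0) (sys.g_mem x u 0 (Or.inr rfl)) ζ hζ).trans
      (measure_mono ?_)
    rintro ⟨s, w⟩ ⟨h, hcw⟩
    have e : (⟨sys.g x u 0 + (w : EuclideanSpace ℝ (Fin n)), h⟩ : sys.stateSet) =
        sys.next x u w := by
      apply Subtype.ext
      simp [next, g]
    change c ≤ |inner ℝ ζ (Φ (((x, u), ϑ), (s, w)))| ^ 2
    simp only [hΦ, ← e]
    exact hcw
  have hreg : ∀ t ω, Φ (T t ω, Y t ω) = sys.regressor (pth ω) (t + 2) := by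
    intro t ω
    rw [regressor, show t + 2 - 1 = t + 1 from rfl, hpth]
    simp only [path_succ]
    rfl
  have hcount := measure_count_lt_le (P := P) ℱ hTm hYm
    (fun t => indep_noiseFiltration hexpl hnoise t) hCm hp.le hprob N
  refine (measure_mono fun ω hω => ?_).trans hcount
  simp only [Set.mem_ofPred_eq] at hω ⊢
  refine lt_of_mul_lt_mul_left (lt_of_le_of_lt ?_ (hω.trans_eq (by ring :
    c * p * N / 2 = c * (p * N / 2)))) hc.le
  rw [mul_comm, ← nsmul_eq_mul]
  refine le_trans (Finset.card_nsmul_le_sum _ (fun s => inner ℝ ζ (sys.regressor (pth ω) (s + 2)) ^ 2)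
    c fun s hs => ?_) (Finset.sum_le_sum_of_subset_of_nonneg (Finset.filter_subset _ _)
      fun i _ _ => sq_nonneg _)
  have h := (Finset.mem_filter.1 hs).2
  rw [hC, Set.mem_ofPred_eq, hreg, sq_abs] at h
  exact h

/-- Lower bound on the Gram matrix, uniformly over directions. -/
theorem measure_gram_lt_le (hd : 1 ≤ d) (hexpl : sys.ExplNoise P S μs)
    (hmeas : sys.MeasurableMaps)
    (hnoise : sys.ProcessNoise P W S μw σw) (hc : 0 < c) (hp : 0 < p)
    (hexc : sys.GloballyExcited μs μw c p) (x₀ : sys.stateSet) {B : ℝ} (hB : 0 ≤ B) {N : ℕ}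
    (hN : 1 ≤ N) :
    P {ω | ∑ s ∈ Finset.range N, ‖sys.regressor (sys.path x₀ (fun i => W i ω)
        (fun i => S i ω)) (s + 2)‖ ^ 2 ≤ B ∧ ∃ x : EuclideanSpace ℝ (Fin d), ‖x‖ = 1 ∧
      ∑ s ∈ Finset.range N, inner ℝ x (sys.regressor (sys.path x₀ (fun i => W i ω)
        (fun i => S i ω)) (s + 2)) ^ 2 < c * p * N / 4} ≤
      ENNReal.ofReal ((1 + 16 * B / (c * p * N)) ^ d *
        Real.exp (-((1 - Real.log 2) * p * N / 2))) := by
  have hN0 : (0 : ℝ) < N := by exact_mod_cast hN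
  -- With `m = c p N / 4` this gives `m M = 4B`, and `2m` is the level controlled on the net. A
  -- deterministic `B` keeps the size of the net deterministic.
  set M := 16 * B / (c * p * N) with hM
  have hM0 : 0 ≤ M := by positivity
  obtain ⟨C, hcard, hC1, hC⟩ := exists_sphere_net hd hM0
  have hsub : {ω | ∑ s ∈ Finset.range N, ‖sys.regressor (sys.path x₀ (fun i => W i ω)
        (fun i => S i ω)) (s + 2)‖ ^ 2 ≤ B ∧ ∃ x : EuclideanSpace ℝ (Fin d), ‖x‖ = 1 ∧
      ∑ s ∈ Finset.range N, inner ℝ x (sys.regressor (sys.path x₀ (fun i => W i ω)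
        (fun i => S i ω)) (s + 2)) ^ 2 < c * p * N / 4} ⊆
      ⋃ y ∈ C, {ω | ∑ s ∈ Finset.range N, inner ℝ y (sys.regressor (sys.path x₀ (fun i => W i ω)
        (fun i => S i ω)) (s + 2)) ^ 2 < c * p * N / 2} := by
    rintro ω ⟨hω, x, hx, hlt⟩
    by_contra hcon
    simp only [Set.mem_iUnion, Set.mem_ofPred_eq, not_exists, not_lt] at hcon
    refine absurd hlt (not_lt.2 (gram_lower_bound_of_net (M := M) (C := C) _ _ hω (by positivity)
      ?_ hC1 hC (fun y hy => ?_) x hx))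
    · rw [hM]
      field_simp
      norm_num
    · have := hcon y hy
      linarith
  refine (measure_mono hsub).trans ((measure_biUnion_finset_le _ _).trans
    ((Finset.sum_le_sum fun y hy => measure_excitation_lt_le hexpl hmeas hnoise hc hp hexc x₀
      (hC1 y hy) N).trans ?_))
  rw [Finset.sum_const, nsmul_eq_mul, ← ENNReal.ofReal_natCast,
    ← ENNReal.ofReal_mul (by positivity)]
  exact ENNReal.ofReal_le_ofReal (by gcongr)

end Excitation

section Noise

/-- Self-normalised bound for the noise of the closed loop. -/
theorem measure_selfNormalized_lt_le (hn : 1 ≤ n) (hexpl : sys.ExplNoise P S μs)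
    (hmeas : sys.MeasurableMaps) (hnoise : sys.ProcessNoise P W S μw σw) (hσw : 0 ≤ σw)
    (x₀ : sys.stateSet) {δ : ℝ} (hδ : 0 < δ) :
    P {ω | ∃ j t, σw ^ 2 * (2 * Real.log (n / δ) + Real.log
        ((gramMat (priorMat d (normRegressor x₀ (fun i => W i ω) (fun i => S i ω) 0))
          (normRegressor x₀ (fun i => W i ω) (fun i => S i ω)) t).det /
          (priorMat d (normRegressor x₀ (fun i => W i ω) (fun i => S i ω) 0)).det)) <
      noiseSum (normRegressor x₀ (fun i => W i ω) (fun i => S i ω))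
          (noiseCoord (fun i => W i ω) j) t ⬝ᵥ
        (gramMat (priorMat d (normRegressor x₀ (fun i => W i ω) (fun i => S i ω) 0))
          (normRegressor x₀ (fun i => W i ω) (fun i => S i ω)) t)⁻¹.mulVec
        (noiseSum (normRegressor x₀ (fun i => W i ω) (fun i => S i ω))
          (noiseCoord (fun i => W i ω) j) t)} ≤ ENNReal.ofReal δ := by
  have hn0 : (0 : ℝ) < n := by exact_mod_cast hn
  -- Without variance the noise vanishes almost surely, and the strict inequality would read `0 <
  -- 0`.
  rcases hσw.eq_or_lt with rfl | hσ
  · have h0 : ∀ᵐ ω ∂P, ∀ t j, noiseCoord (fun i => W i ω) j t = 0 := by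
      refine ae_all_iff.2 fun t => ae_all_iff.2 fun j => ?_
      have h := hnoise.hasSubgaussianMGF_coord (t := t + 1) (by omega) j
      have e : (⟨(0 : ℝ) ^ 2, sq_nonneg 0⟩ : ℝ≥0) = 0 := by
        ext
        simp
      rw [e] at h
      exact h.ae_eq_zero_of_hasSubgaussianMGF_zero
    refine le_of_eq_of_le (measure_mono_null (fun ω hω => ?_) (ae_iff.1 h0)) zero_le
    intro hcon
    obtain ⟨j, t, h⟩ := hω
    have : noiseSum (normRegressor x₀ (fun i => W i ω) (fun i => S i ω))
          (noiseCoord (fun i => W i ω) j) t = 0 := by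
      simp [noiseSum, hcon]
    rw [this] at h
    simp at h
  set ℱ := noiseFiltration hnoise.measurable_succ hexpl.measurable with hℱ
  have hz : ∀ t, Measurable[ℱ t]
      fun ω => normRegressor x₀ (fun i => W i ω) (fun i => S i ω) t := fun t => by
    have h1 : Measurable[ℱ t] fun ω => sys.regressor (sys.path x₀ (fun i => W i ω)
        (fun i => S i ω)) (t + 1) :=
      measurable_regressor (mΩ' := ℱ t) hmeas (fun s hs => measurable_path (mΩ' := ℱ t) x₀ hmeas
        (fun i hi => comap_noise_measurable hi) (fun i hi => comap_expl_measurable hi) hs) le_rfl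
    exact (by fun_prop : Measurable fun x : EuclideanSpace ℝ (Fin d) =>
      (Real.sqrt sys.γ)⁻¹ • x.ofLp).comp h1
  have hcoord : ∀ j : Fin n, Measurable fun x : sys.noiseSet => (x : EuclideanSpace ℝ (Fin n)) j :=
    fun j => (by fun_prop : Measurable fun x : EuclideanSpace ℝ (Fin n) => x j).comp
      measurable_subtype_coe
  have hj : ∀ j : Fin n, _ := fun j => self_normalized_bound (P := P) ℱ hσ
    (Λ := fun ω => (fun i j => priorMat d (normRegressor x₀ (fun i => W i ω) (fun i => S i ω) 0) i j))
    (measurable_priorMat (mΩ := ℱ 0) (hz 0)) (fun ω => priorMat_posDef _) hz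
    (w := fun t ω => noiseCoord (fun i => W i ω) j t)
    (fun t => (hcoord j).comp (comap_noise_measurable (Nat.lt_succ_self t)))
    (fun t => by
      refine indep_of_indep_of_le_right (indep_noiseFiltration hexpl hnoise t) ?_
      exact measurable_iff_comap_le.1 (Measurable.comp
        (g := fun y : sys.explSet × sys.noiseSet => (y.2 : EuclideanSpace ℝ (Fin n)) j)
        ((hcoord j).comp measurable_snd) (comap_measurable _)))
    (fun t l => by
      have h := hnoise.hasSubgaussianMGF_coord (t := t + 1) (by omega) j
      have h1 := h.mgf_le l
      have h2 := h.integrable_exp_mul l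
      exact (ofReal_integral_eq_lintegral_ofReal h2
        (ae_of_all _ fun ω => (Real.exp_pos _).le)).symm.trans_le (ENNReal.ofReal_le_ofReal h1))
    (2 * Real.log (n / δ))
  -- The level `a = 2 log (n / δ)` gives each coordinate failure probability `exp (-a/2) = δ / n`.
  have hsum : ∑ j : Fin n, ENNReal.ofReal (Real.exp (-(2 * Real.log (n / δ)) / 2)) =
      ENNReal.ofReal δ := by
    have : Real.exp (-(2 * Real.log (n / δ)) / 2) = δ / n := by
      rw [show -(2 * Real.log (n / δ)) / 2 = -Real.log (n / δ) by ring, Real.exp_neg,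
        Real.exp_log (by positivity), inv_div]
    rw [this, Finset.sum_const, Finset.card_univ, Fintype.card_fin, nsmul_eq_mul,
      ← ENNReal.ofReal_natCast, ← ENNReal.ofReal_mul hn0.le]
    congr 1
    field_simp
  rw [← hsum]
  refine le_trans ?_ ((measure_iUnion_fintype_le P _).trans (Finset.sum_le_sum fun j _ => hj j))
  refine measure_mono ?_
  rintro ω ⟨j, t, h⟩
  exact Set.mem_iUnion.2 ⟨j, t, h⟩

end Noise

end ClosedLoopSystem

/-! ### Burn-in condition and union over time. -/

/-- Exponentiating the burn-in inequality: net size times Chernoff tail is at most `1 / R`. -/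
theorem one_add_pow_mul_exp_le_of_burnin {p A R t : ℝ} {d : ℕ} (hp : 0 < p) (hA : 0 ≤ A)
    (hR : 0 < R)
    (h : 2 / ((1 - Real.log 2) * p) * (d * Real.log (1 + A) + Real.log R) + 1 ≤ t) :
    (1 + A) ^ d * Real.exp (-((1 - Real.log 2) * p * (t - 1) / 2)) ≤ 1 / R := by
  have hl : 0 < 1 - Real.log 2 := by linarith [Real.log_two_lt_d9]
  have hk : 0 < (1 - Real.log 2) * p := by positivity
  have h1 : d * Real.log (1 + A) + Real.log R ≤ (1 - Real.log 2) * p * (t - 1) / 2 := by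
    have h2 : 2 / ((1 - Real.log 2) * p) * (d * Real.log (1 + A) + Real.log R) ≤ t - 1 := by
      linarith
    rw [div_mul_eq_mul_div, div_le_iff₀ hk] at h2
    linarith
  have h3 := Real.exp_le_exp.2 h1
  rw [Real.exp_add, Real.exp_log hR, ← Real.log_pow, Real.exp_log (by positivity)] at h3
  rw [Real.exp_neg, ← div_eq_mul_inv, div_le_div_iff₀ (Real.exp_pos _) hR, one_mul]
  exact h3

namespace ClosedLoopSystem

variable {n m d q : ℕ} {sys : ClosedLoopSystem n m d q} {Ω : Type*} {mΩ : MeasurableSpace Ω}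
  {P : Measure Ω} {W : ℕ → Ω → sys.noiseSet} {S : ℕ → Ω → sys.explSet}
  {μw : Measure sys.noiseSet} {μs : Measure sys.explSet} {σw : ℝ} {D : GrowthData}
  {c p : ℝ} {x₀ : sys.stateSet} {δ : ℝ}

variable (sys D σw c p δ x₀) in
/-- The condition defining the burn-in time. -/
def BurnedIn (T : ℕ) : Prop :=
  ∀ t : ℕ, T ≤ t →
    2 / ((1 - Real.log 2) * p) *
        (d * Real.log (1 + 16 * (∑ i ∈ Finset.Icc 1 t, sys.zBar D σw i (δ / 3) x₀ ^ 2)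
            / (c * p * ((t : ℝ) - 1)))
          + Real.log (Real.pi ^ 2 * ((t : ℝ) - T + 1) ^ 2 / (2 * δ))) + 1 ≤ (t : ℝ)

/-- A nonempty set in `ℕ∞` contains its infimum, so the burn-in time itself satisfies the defining
condition. -/
theorem exists_burnedIn_of_Tburnin_lt_top (h : sys.Tburnin D σw c p δ x₀ < ⊤) :
    ∃ T : ℕ, 1 ≤ T ∧ sys.BurnedIn σw D c p x₀ δ T ∧ sys.Tburnin D σw c p δ x₀ = T := by
  have hne : {T' : ℕ∞ | ∃ T : ℕ, T' = T ∧ 1 ≤ T ∧ sys.BurnedIn σw D c p x₀ δ T}.Nonempty := by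
    by_contra hcon
    rw [Set.not_nonempty_iff_eq_empty] at hcon
    refine absurd h (not_lt.2 ?_)
    change ⊤ ≤ sInf {T' : ℕ∞ | ∃ T : ℕ, T' = T ∧ 1 ≤ T ∧ sys.BurnedIn σw D c p x₀ δ T}
    rw [hcon, sInf_empty]
  obtain ⟨T, h1, h2, h3⟩ := csInf_mem hne
  exact ⟨T, h2, h3, h1⟩

/-- At `t = T = 1` the quotient by zero is `0`, so only `log (π² / (2δ)) > 0` remains and the
condition fails. Hence at least one regressor after the first is available from the burn-in on. -/
theorem BurnedIn.two_le (hp : 0 < p) (hδ : 0 < δ) (hδ1 : δ < 1) {T : ℕ} (hT : 1 ≤ T)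
    (h : sys.BurnedIn σw D c p x₀ δ T) : 2 ≤ T := by
  by_contra hcon
  obtain rfl : T = 1 := by omega
  have h1 := h 1 le_rfl
  have hl : 0 < 1 - Real.log 2 := by linarith [Real.log_two_lt_d9]
  have hpi : 3 < Real.pi := Real.pi_gt_three
  have hlog : 0 < Real.log (Real.pi ^ 2 * (((1 : ℕ) : ℝ) - ((1 : ℕ) : ℝ) + 1) ^ 2 / (2 * δ)) := by
    refine Real.log_pos ?_
    rw [lt_div_iff₀ (by positivity)]
    push_cast
    nlinarith
  have h2 : (0 : ℝ) < 2 / ((1 - Real.log 2) * p) := by positivity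
  have h3 := mul_pos h2 hlog
  simp only [Nat.cast_one, sub_self, mul_zero, div_zero, add_zero, Real.log_one, zero_add] at h1 h3
  linarith

/-- Failure probability of the excitation bound after the burn-in time. -/
theorem BurnedIn.measure_gram_lt_le [IsProbabilityMeasure P] (hd : 1 ≤ d)
    (hexpl : sys.ExplNoise P S μs) (hmeas : sys.MeasurableMaps)
    (hnoise : sys.ProcessNoise P W S μw σw) (hc : 0 < c) (hp : 0 < p)
    (hexc : sys.GloballyExcited μs μw c p) (hδ : 0 < δ) (hδ1 : δ < 1) {T : ℕ} (hT : 1 ≤ T)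
    (h : sys.BurnedIn σw D c p x₀ δ T) :
    P {ω | ∃ N : ℕ, T ≤ N + 1 ∧ ∑ s ∈ Finset.range N, ‖sys.regressor (sys.path x₀ (fun i => W i ω)
        (fun i => S i ω)) (s + 2)‖ ^ 2 ≤ ∑ i ∈ Finset.Icc 1 (N + 1), sys.zBar D σw i (δ / 3) x₀ ^ 2 ∧
      ∃ x : EuclideanSpace ℝ (Fin d), ‖x‖ = 1 ∧
      ∑ s ∈ Finset.range N, inner ℝ x (sys.regressor (sys.path x₀ (fun i => W i ω)
        (fun i => S i ω)) (s + 2)) ^ 2 < c * p * N / 4} ≤ ENNReal.ofReal (δ / 3) := by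
  have hT2 := h.two_le hp hδ hδ1 hT
  obtain ⟨M, rfl⟩ : ∃ M, T = M + 1 := ⟨T - 1, by omega⟩
  have hpi := Real.pi_pos
  have hB : ∀ t, 0 ≤ ∑ i ∈ Finset.Icc 1 t, sys.zBar D σw i (δ / 3) x₀ ^ 2 := fun t =>
    Finset.sum_nonneg fun _ _ => sq_nonneg _
  -- At time `t = M + k + 1` there are `t - 1 = M + k` regressors after the first, and `t - T + 1 =
  -- k + 1`. The failure probabilities `2δ / (π² (k + 1)²)` sum to `δ/3`.
  have hexp : ∀ k : ℕ, (1 + 16 * (∑ i ∈ Finset.Icc 1 (M + k + 1), sys.zBar D σw i (δ / 3) x₀ ^ 2) /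
      (c * p * ((M + k : ℕ) : ℝ))) ^ d *
        Real.exp (-((1 - Real.log 2) * p * ((M + k : ℕ) : ℝ) / 2)) ≤
      2 * δ / Real.pi ^ 2 / ((k : ℝ) + 1) ^ 2 := by
    intro k
    have h1 := h (M + k + 1) (by omega)
    have e : (((M + k + 1 : ℕ) : ℝ) - 1) = ((M + k : ℕ) : ℝ) := by push_cast; ring
    have e2 : (((M + k + 1 : ℕ) : ℝ) - ((M + 1 : ℕ) : ℝ) + 1) = (k : ℝ) + 1 := by
      push_cast; ring
    rw [e, e2] at h1
    have hBk := hB (M + k + 1)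
    have h2 := one_add_pow_mul_exp_le_of_burnin hp (by positivity) (by positivity) h1
    rw [e, one_div_div] at h2
    rwa [div_div]
  have hstep := fun k : ℕ => (ClosedLoopSystem.measure_gram_lt_le hd hexpl hmeas hnoise hc hp hexc
    x₀ (hB (M + k + 1)) (N := M + k) (by omega)).trans (ENNReal.ofReal_le_ofReal (hexp k))
  refine le_trans (measure_mono ?_) ((measure_iUnion_le _).trans
    ((ENNReal.tsum_le_tsum hstep).trans ?_))
  · rintro ω ⟨N, hN, h1, h2⟩
    obtain ⟨k, rfl⟩ : ∃ k, N = M + k := ⟨N - M, by omega⟩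
    exact Set.mem_iUnion.2 ⟨k, h1, h2⟩
  · refine (tsum_ofReal_div_sq_le (by positivity)).trans_eq ?_
    congr 1
    field_simp
    norm_num

open Matrix in
/-- The error bound holds at time `t + 1` on the intersection of the good events. -/
theorem matOpNorm_error_le_errBound (hn : 1 ≤ n) (hd : 1 ≤ d) (hσw : 0 ≤ σw) (hc : 0 < c)
    (hp : 0 < p) (hδ : 0 < δ) (hδ1 : δ < 1) (x₀ : sys.stateSet) (w : ℕ → sys.noiseSet)
    (s : ℕ → sys.explSet) (t : ℕ)
    (hlow : ∀ x : EuclideanSpace ℝ (Fin d), ‖x‖ = 1 → c * p * t / 4 ≤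
      ∑ k ∈ Finset.range t, inner ℝ x (sys.regressor (sys.path x₀ w s) (k + 2)) ^ 2)
    (hup : ∑ k ∈ Finset.range t, ‖sys.regressor (sys.path x₀ w s) (k + 2)‖ ^ 2 ≤
      ∑ i ∈ Finset.Icc 1 (t + 1), sys.zBar D σw i (δ / 3) x₀ ^ 2)
    (hSN : ∀ j : Fin n,
      noiseSum (normRegressor x₀ w s) (noiseCoord w j) (t + 1) ⬝ᵥ
        (gramMat (priorMat d (normRegressor x₀ w s 0)) (normRegressor x₀ w s) (t + 1))⁻¹ *ᵥ
          noiseSum (normRegressor x₀ w s) (noiseCoord w j) (t + 1) ≤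
      σw ^ 2 * (2 * Real.log (n / (δ / 3)) +
        Real.log ((gramMat (priorMat d (normRegressor x₀ w s 0))
        (normRegressor x₀ w s) (t + 1)).det / (priorMat d (normRegressor x₀ w s 0)).det))) :
    matOpNorm (sys.estimate (sys.path x₀ w s) (t + 1) - sys.θstar) ≤
      sys.errBound D σw c p (t + 1) δ x₀ := by
  have hγ := sys.γ_pos
  have hn1 : (1 : ℝ) ≤ n := by exact_mod_cast hn
  have hsq : (Real.sqrt sys.γ)⁻¹ ^ 2 = sys.γ⁻¹ := by rw [inv_pow, Real.sq_sqrt hγ.le]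
  have hlow' : ∀ x : Fin d → ℝ, c * p * t / (4 * sys.γ) * (x ⬝ᵥ x) ≤
      ∑ k ∈ Finset.range t, (normRegressor x₀ w s (k + 1) ⬝ᵥ x) ^ 2 := by
    intro x
    set y : EuclideanSpace ℝ (Fin d) := WithLp.toLp 2 x with hy
    have hdot : ∀ k, (normRegressor x₀ w s (k + 1) ⬝ᵥ x) ^ 2 =
        sys.γ⁻¹ * inner ℝ y (sys.regressor (sys.path x₀ w s) (k + 2)) ^ 2 := by
      intro k
      rw [normRegressor, smul_dotProduct, smul_eq_mul, mul_pow, hsq]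
      rfl
    simp_rw [hdot, ← Finset.mul_sum]
    rw [← norm_toLp_sq, ← hy]
    rcases eq_or_ne y 0 with h0 | h0
    · simp [h0]
    · have hny : 0 < ‖y‖ := norm_pos_iff.2 h0
      have h1 := hlow (‖y‖⁻¹ • y) (by rw [norm_smul, norm_inv, norm_norm, inv_mul_cancel₀ hny.ne'])
      simp_rw [real_inner_smul_left, mul_pow, ← Finset.mul_sum] at h1
      rw [inv_pow, inv_mul_eq_div, le_div_iff₀ (by positivity)] at h1
      calc c * p * t / (4 * sys.γ) * ‖y‖ ^ 2 = sys.γ⁻¹ * (c * p * t / 4 * ‖y‖ ^ 2) := by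
            field_simp
        _ ≤ _ := mul_le_mul_of_nonneg_left h1 (by positivity)
  have hup' : ∑ k ∈ Finset.range t,
      normRegressor x₀ w s (k + 1) ⬝ᵥ normRegressor x₀ w s (k + 1) ≤
        sys.γ⁻¹ * ∑ i ∈ Finset.Icc 1 (t + 1), sys.zBar D σw i (δ / 3) x₀ ^ 2 := by
    have hdot : ∀ k, normRegressor x₀ w s (k + 1) ⬝ᵥ normRegressor x₀ w s (k + 1) =
        sys.γ⁻¹ * ‖sys.regressor (sys.path x₀ w s) (k + 2)‖ ^ 2 := by
      intro k
      rw [← norm_toLp_sq, normRegressor, WithLp.toLp_smul, norm_smul, mul_pow, norm_inv, inv_pow,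
        Real.norm_eq_abs, sq_abs, Real.sq_sqrt hγ.le]
    simp_rw [hdot, ← Finset.mul_sum]
    exact mul_le_mul_of_nonneg_left hup (by positivity)
  have ha : 2 * Real.log 3 ≤ 2 * Real.log (n / (δ / 3)) := by
    have : (3 : ℝ) ≤ n / (δ / 3) := by
      rw [le_div_iff₀ (by positivity)]
      linarith
    gcongr
  refine (matOpNorm_error_le hd x₀ w s t (by positivity) hσw ha hlow' hup' hSN).trans_eq ?_
  rw [errBound]
  -- Undoing the normalisation: `g = c p t / (4γ)` gives the denominator, `1 + κ = β_max / γ` the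
  -- logarithm, and `a = 2 log (3n / δ)` the confidence term.
  have e1 : sys.γ * (1 + c * p * t / (4 * sys.γ)) =
      c * p / 4 * (((t + 1 : ℕ) : ℝ) - 1) + sys.γ := by
    push_cast
    field_simp
    ring
  have e2 : sys.βmax D σw (t + 1) (δ / 3) x₀ * sys.γ⁻¹ =
      1 + sys.γ⁻¹ * ∑ i ∈ Finset.Icc 1 (t + 1), sys.zBar D σw i (δ / 3) x₀ ^ 2 := by
    rw [βmax]
    field_simp
    ring
  have e3 : (n : ℝ) / (δ / 3) = 3 * n / δ := by
    field_simp
  rw [e1, e2, e3]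
  congr 4
  ring

/-- With high probability the error bound holds at all times after the burn-in time. -/
theorem measure_error_le_errBound_ge [IsProbabilityMeasure P] (hn : 1 ≤ n) (hd : 1 ≤ d)
    (hσw : 0 ≤ σw) (hexpl : sys.ExplNoise P S μs) (hmeas : sys.MeasurableMaps)
    (hnoise : sys.ProcessNoise P W S μw σw) (hstate : sys.InputToStateBound D)
    (hctrl : sys.ConstrainedControls D) (hfeat : sys.APBFeatures D) (hc : 0 < c) (hp : 0 < p)
    (hexc : sys.GloballyExcited μs μw c p) (hδ : 0 < δ) (hδ1 : δ < 1)
    (htop : sys.Tburnin D σw c p δ x₀ < ⊤) :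
    ENNReal.ofReal (1 - δ) ≤
      P {ω | ∀ t : ℕ, sys.Tburnin D σw c p δ x₀ ≤ (t : ℕ∞) →
        matOpNorm (sys.θhat x₀ W S t ω - sys.θstar) ≤ sys.errBound D σw c p t δ x₀} := by
  obtain ⟨T, hT1, hT, hTeq⟩ := exists_burnedIn_of_Tburnin_lt_top htop
  have hT2 := hT.two_le hp hδ hδ1 hT1
  have hE1 := hnoise.measure_norm_gt_wBar_le hn hσw (δ := δ / 3) (by positivity) (by linarith)
  have hE2 := hT.measure_gram_lt_le hd hexpl hmeas hnoise hc hp hexc hδ hδ1 hT1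
  have hE3 := measure_selfNormalized_lt_le hn hexpl hmeas hnoise hσw x₀ (δ := δ / 3)
    (by positivity)
  set E1 := {ω | ∃ t, 1 ≤ t ∧ wBar n σw t (δ / 3) < ‖(W t ω : EuclideanSpace ℝ (Fin n))‖} with hE1d
  set E2 := {ω | ∃ N : ℕ, T ≤ N + 1 ∧ ∑ s ∈ Finset.range N, ‖sys.regressor (sys.path x₀
        (fun i => W i ω) (fun i => S i ω)) (s + 2)‖ ^ 2 ≤
          ∑ i ∈ Finset.Icc 1 (N + 1), sys.zBar D σw i (δ / 3) x₀ ^ 2 ∧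
      ∃ x : EuclideanSpace ℝ (Fin d), ‖x‖ = 1 ∧
      ∑ s ∈ Finset.range N, inner ℝ x (sys.regressor (sys.path x₀ (fun i => W i ω)
        (fun i => S i ω)) (s + 2)) ^ 2 < c * p * N / 4} with hE2d
  generalize hE3d : {ω | ∃ j t, σw ^ 2 * (2 * Real.log (n / (δ / 3)) + _) < _} = E3 at hE3
  set G := {ω | ∀ t : ℕ, sys.Tburnin D σw c p δ x₀ ≤ (t : ℕ∞) →
        matOpNorm (sys.θhat x₀ W S t ω - sys.θstar) ≤ sys.errBound D σw c p t δ x₀} with hG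
  -- The bound follows from subadditivity of this cover, so measurability of the good event is not
  -- required.
  have hcover : (Set.univ : Set Ω) ⊆ G ∪ (E1 ∪ (E2 ∪ E3)) := by
    intro ω _
    by_contra hcon
    simp only [Set.mem_union, not_or] at hcon
    obtain ⟨h0, h1, h2, h3⟩ := hcon
    refine h0 fun t ht => ?_
    rw [hTeq, Nat.cast_le] at ht
    obtain ⟨N, rfl⟩ : ∃ N, t = N + 1 := ⟨t - 1, by omega⟩
    have hw : ∀ i, 1 ≤ i → ‖(W i ω : EuclideanSpace ℝ (Fin n))‖ ≤ wBar n σw i (δ / 3) := by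
      intro i hi
      by_contra hlt
      exact h1 ⟨i, hi, not_le.1 hlt⟩
    have hup : ∑ k ∈ Finset.range N, ‖sys.regressor (sys.path x₀
        (fun i => W i ω) (fun i => S i ω)) (k + 2)‖ ^ 2 ≤
          ∑ i ∈ Finset.Icc 1 (N + 1), sys.zBar D σw i (δ / 3) x₀ ^ 2 := by
      calc _ ≤ ∑ k ∈ Finset.range N, sys.zBar D σw (k + 2) (δ / 3) x₀ ^ 2 :=
            Finset.sum_le_sum fun k _ => pow_le_pow_left₀ (norm_nonneg _)
              (norm_regressor_le_zBar hn hσw hstate hctrl hfeat x₀ _ (by positivity) (by linarith)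
                (by omega) hw) 2
        _ = ∑ i ∈ Finset.Ico 2 (N + 2), sys.zBar D σw i (δ / 3) x₀ ^ 2 := by
            rw [Finset.range_eq_Ico,
              Finset.sum_Ico_add' (f := fun i => sys.zBar D σw i (δ / 3) x₀ ^ 2), zero_add]
        _ ≤ _ := by
            refine Finset.sum_le_sum_of_subset_of_nonneg (fun i hi => ?_) fun _ _ _ => sq_nonneg _
            rw [Finset.mem_Ico] at hi
            rw [Finset.mem_Icc]
            omega
    refine matOpNorm_error_le_errBound hn hd hσw hc hp hδ hδ1 x₀ _ _ N (fun x hx => ?_) hup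
      fun j => ?_
    · by_contra hlt
      exact h2 ⟨N, ht, hup, x, hx, not_le.1 hlt⟩
    · by_contra hlt
      rw [← hE3d] at h3
      exact h3 ⟨j, N + 1, not_le.1 hlt⟩
  have hbad : P (E1 ∪ (E2 ∪ E3)) ≤ ENNReal.ofReal δ := by
    calc P (E1 ∪ (E2 ∪ E3)) ≤ P E1 + (P E2 + P E3) :=
          (measure_union_le _ _).trans (add_le_add le_rfl (measure_union_le _ _))
      _ ≤ ENNReal.ofReal (δ / 3) + (ENNReal.ofReal (δ / 3) + ENNReal.ofReal (δ / 3)) :=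
          add_le_add hE1 (add_le_add hE2 hE3)
      _ = ENNReal.ofReal δ := by
          rw [← ENNReal.ofReal_add (by positivity) (by positivity),
            ← ENNReal.ofReal_add (by positivity) (by positivity)]
          congr 1
          ring
  rw [ENNReal.ofReal_sub _ hδ.le, ENNReal.ofReal_one, tsub_le_iff_right, ← measure_univ (μ := P)]
  exact (measure_mono hcover).trans ((measure_union_le _ _).trans (add_le_add le_rfl hbad))

end ClosedLoopSystem

/-! ### Subexponential growth and asymptotics. -/

/-- Sequences growing more slowly than every exponential. -/
def SubExpSeq (a : ℕ → ℝ) : Prop :=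
  ∀ ε : ℝ, 0 < ε → ∃ C : ℝ, 0 ≤ C ∧ ∀ t : ℕ, |a t| ≤ C * Real.exp (ε * t)

namespace SubExpSeq

variable {a b : ℕ → ℝ}

/-- The finitely many exceptional times are absorbed into the constant, since the comparison
exponential never vanishes. -/
theorem of_eventually_le (h : ∀ ε : ℝ, 0 < ε → ∀ᶠ t : ℕ in atTop, |a t| ≤ Real.exp (ε * t)) :
    SubExpSeq a := by
  intro ε hε
  have hO : a =O[atTop] fun t : ℕ => Real.exp (ε * t) := by
    refine IsBigO.of_bound 1 ((h ε hε).mono fun t ht => ?_)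
    rwa [Real.norm_eq_abs, Real.norm_of_nonneg (Real.exp_pos _).le, one_mul]
  obtain ⟨C, hC, hb⟩ := bound_of_isBigO_nat_atTop hO
  refine ⟨C, hC.le, fun t => ?_⟩
  have := hb (Real.exp_pos (ε * t)).ne'
  rwa [Real.norm_eq_abs, Real.norm_of_nonneg (Real.exp_pos _).le] at this

theorem const (r : ℝ) : SubExpSeq fun _ => r := by
  intro ε hε
  refine ⟨|r|, abs_nonneg r, fun t => ?_⟩
  exact le_mul_of_one_le_right (abs_nonneg r) (Real.one_le_exp (by positivity))

theorem natCast : SubExpSeq fun t => (t : ℝ) := by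
  intro ε hε
  refine ⟨1 / ε, by positivity, fun t => ?_⟩
  rw [abs_of_nonneg (by positivity), one_div_mul_eq_div, le_div_iff₀ hε]
  linarith [Real.add_one_le_exp (ε * t)]

theorem mono (hb : SubExpSeq b) (h : ∀ t, |a t| ≤ |b t|) : SubExpSeq a := by
  intro ε hε
  obtain ⟨C, hC, hb⟩ := hb ε hε
  exact ⟨C, hC, fun t => (h t).trans (hb t)⟩

theorem add (ha : SubExpSeq a) (hb : SubExpSeq b) : SubExpSeq fun t => a t + b t := by
  intro ε hε
  obtain ⟨C, hC, ha⟩ := ha ε hε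
  obtain ⟨C', hC', hb⟩ := hb ε hε
  refine ⟨C + C', by positivity, fun t => ?_⟩
  rw [add_mul]
  exact (abs_add_le _ _).trans (add_le_add (ha t) (hb t))

theorem mul (ha : SubExpSeq a) (hb : SubExpSeq b) : SubExpSeq fun t => a t * b t := by
  intro ε hε
  obtain ⟨C, hC, ha⟩ := ha (ε / 2) (by positivity)
  obtain ⟨C', hC', hb⟩ := hb (ε / 2) (by positivity)
  refine ⟨C * C', by positivity, fun t => ?_⟩
  have e : C * C' * Real.exp (ε * t) =
      (C * Real.exp (ε / 2 * t)) * (C' * Real.exp (ε / 2 * t)) := by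
    rw [mul_mul_mul_comm, ← Real.exp_add]
    congr 2
    ring
  rw [e, abs_mul]
  exact mul_le_mul (ha t) (hb t) (abs_nonneg _) (by positivity)

theorem pow (ha : SubExpSeq a) (k : ℕ) : SubExpSeq fun t => a t ^ k := by
  induction k with
  | zero => simpa using const 1
  | succ k ih =>
    simp_rw [pow_succ]
    exact ih.mul ha

theorem abs (ha : SubExpSeq a) : SubExpSeq fun t => |a t| := ha.mono fun t => by rw [abs_abs]

theorem sub_one (ha : SubExpSeq a) : SubExpSeq fun t => a (t - 1) := by
  intro ε hε
  obtain ⟨C, hC, ha⟩ := ha ε hε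
  refine ⟨C, hC, fun t => (ha _).trans ?_⟩
  gcongr
  exact Nat.sub_le t 1

theorem sum_Icc (ha : SubExpSeq a) : SubExpSeq fun t => ∑ i ∈ Finset.Icc 1 t, a i := by
  intro ε hε
  obtain ⟨C, hC, ha⟩ := ha (ε / 2) (by positivity)
  obtain ⟨C', hC', hb⟩ := natCast (ε / 2) (by positivity)
  refine ⟨C' * C, by positivity, fun t => ?_⟩
  calc |∑ i ∈ Finset.Icc 1 t, a i| ≤ ∑ i ∈ Finset.Icc 1 t, |a i| := Finset.abs_sum_le_sum_abs _ _
    _ ≤ ∑ i ∈ Finset.Icc 1 t, C * Real.exp (ε / 2 * t) := by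
        refine Finset.sum_le_sum fun i hi => (ha i).trans ?_
        gcongr
        exact (Finset.mem_Icc.1 hi).2
    _ = t * (C * Real.exp (ε / 2 * t)) := by simp
    _ ≤ (C' * Real.exp (ε / 2 * t)) * (C * Real.exp (ε / 2 * t)) := by
        gcongr
        exact (le_abs_self _).trans (hb t)
    _ = C' * C * Real.exp (ε * t) := by
        rw [mul_mul_mul_comm, ← Real.exp_add]
        congr 2
        ring

/-- This is how the growth class is used: the regressor bounds enter the burn-in condition and the
error bound only through a logarithm. -/
theorem log_isLittleO (ha : SubExpSeq a) (h0 : ∀ t, 0 ≤ a t) :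
    (fun t => Real.log (1 + a t)) =o[atTop] fun t : ℕ => (t : ℝ) := by
  refine IsLittleO.of_bound fun ε hε => ?_
  obtain ⟨C, hC, ha⟩ := ha (ε / 2) (by positivity)
  filter_upwards [tendsto_natCast_atTop_atTop.eventually_ge_atTop (2 / ε * Real.log (1 + C))]
    with t ht
  have h1 := h0 t
  rw [Real.norm_of_nonneg (Real.log_nonneg (by linarith)), Real.norm_of_nonneg (by positivity)]
  have h2 : 1 + a t ≤ (1 + C) * Real.exp (ε / 2 * t) := by
    have := Real.one_le_exp (by positivity : 0 ≤ ε / 2 * t)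
    linarith [(le_abs_self _).trans (ha t)]
  have h3 := Real.log_le_log (by linarith) h2
  rw [Real.log_mul (by positivity) (Real.exp_pos _).ne', Real.log_exp] at h3
  rw [div_mul_eq_mul_div, div_le_iff₀ hε] at ht
  linarith

end SubExpSeq

/-- A `k`-SE comparison function is subexponential along sequences of order `t ^ k`. -/
theorem SubExpOrder.subExpSeq {k : ℕ} {h : ℝ → ℝ} (hh : ClassKInfty h) (hs : SubExpOrder k h)
    {A : ℝ} (hA : 0 ≤ A) {x : ℕ → ℝ} (hx : ∀ t, 0 ≤ x t) (hxA : ∀ t, x t ≤ (A * t) ^ k) :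
    SubExpSeq fun t => h (x t) := by
  refine SubExpSeq.of_eventually_le fun ε hε => ?_
  -- Using `A + 1` makes the comparison argument tend to infinity even when `A = 0`.
  have hA1 : 0 < A + 1 := by positivity
  have h1 : Tendsto (fun t : ℕ => (A + 1) * (t : ℝ)) atTop atTop :=
    tendsto_natCast_atTop_atTop.const_mul_atTop hA1
  filter_upwards [h1.eventually (hs.bound (by positivity : 0 < ε / (A + 1)))] with t ht
  rw [abs_of_nonneg (hh.nonneg (hx t))]
  have h2 : x t ≤ ((A + 1) * t) ^ k := (hxA t).trans (by gcongr; linarith)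
  refine (hh.mono (hx t) h2).trans ((Real.le_exp_log _).trans (Real.exp_le_exp.2 ?_))
  rw [Real.norm_eq_abs, Real.norm_of_nonneg (by positivity)] at ht
  refine (le_abs_self _).trans (ht.trans_eq ?_)
  field_simp

theorem exists_le_mul_pow_of_isAPB {h : ℝ → ℝ} (hmono : MonotoneOn h (Set.Ici 0)) (ha : IsAPB h) :
    ∃ C R : ℝ, ∃ k : ℕ, 0 ≤ C ∧ 0 ≤ R ∧ ∀ r, 0 ≤ r → h r ≤ C * (r + R) ^ k := by
  obtain ⟨k, _, hO⟩ := ha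
  obtain ⟨C, hC, hb⟩ := hO.exists_nonneg
  obtain ⟨R, hR⟩ := eventually_atTop.1 hb.bound
  refine ⟨C, max R 0, k, hC, le_max_right _ _, fun r hr => ?_⟩
  have h0 : 0 ≤ r + max R 0 := add_nonneg hr (le_max_right _ _)
  have h1 := hR (r + max R 0) (by linarith [le_max_left R 0])
  rw [Real.norm_eq_abs, Real.norm_of_nonneg (by positivity)] at h1
  exact (hmono hr h0 (by linarith [le_max_right R 0])).trans ((le_abs_self _).trans h1)

namespace ClosedLoopSystem

variable {n m d q : ℕ} {sys : ClosedLoopSystem n m d q} {σw : ℝ} {D : GrowthData}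
  {c p : ℝ} {x₀ : sys.stateSet} {δ : ℝ}

/-- The noise bound grows logarithmically. -/
theorem exists_wBar_le_log (hn : 1 ≤ n) (hσw : 0 ≤ σw) (hδ : 0 < δ) (hδ1 : δ ≤ 1) :
    ∃ A K : ℝ, 0 ≤ A ∧ 0 < K ∧ ∀ t : ℕ, 1 ≤ t → wBar n σw t δ ≤ A + K * Real.log t := by
  set L := n * Real.pi ^ 2 * ((1 : ℕ) : ℝ) ^ 2 / (3 * δ) with hL
  have hL1 : 1 ≤ L := one_le_wBar_arg hn hδ hδ1 le_rfl
  have hlogL := Real.log_nonneg hL1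
  refine ⟨σw * (1 + 2 * n * Real.log L), σw * (4 * n) + 1, by positivity, by positivity,
    fun t ht => ?_⟩
  have ht1 : (1 : ℝ) ≤ t := by exact_mod_cast ht
  have hlogt := Real.log_nonneg ht1
  rw [wBar, if_neg (by omega)]
  have e : n * Real.pi ^ 2 * (t : ℝ) ^ 2 / (3 * δ) = L * (t : ℝ) ^ 2 := by
    rw [hL]
    push_cast
    ring
  rw [e, Real.log_mul (by positivity) (by positivity), Real.log_pow]
  push_cast
  have h1 : Real.sqrt (2 * n * (Real.log L + 2 * Real.log t)) ≤
      1 + 2 * n * (Real.log L + 2 * Real.log t) := by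
    refine Real.sqrt_le_iff.2 ⟨by positivity, ?_⟩
    have : 0 ≤ 2 * n * (Real.log L + 2 * Real.log t) := by positivity
    nlinarith
  calc _ ≤ σw * (1 + 2 * n * (Real.log L + 2 * Real.log t)) := by gcongr
    _ ≤ _ := by linarith

/-- Since `w̄(t) ≤ A + K log t` and `σ₂` is `1`-SE, eventually `σ₂(r) ≤ exp (r / K)`, and evaluating
at a logarithm yields linear growth. The shift by `|R|` makes the estimate valid from `t = 1`; at `t
= 0` both sides vanish. -/
theorem exists_σ₂_wBar_le (hn : 1 ≤ n) (hσw : 0 ≤ σw) (hδ : 0 < δ) (hδ1 : δ ≤ 1)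
    (hstate : sys.InputToStateBound D) :
    ∃ C : ℝ, 0 ≤ C ∧ ∀ t : ℕ, D.σ₂ (wBar n σw t δ) ≤ C * t := by
  obtain ⟨A, K, hA, hK, hw⟩ := exists_wBar_le_log hn hσw hδ hδ1
  have hs := hstate.σ₂.2
  obtain ⟨R, hR⟩ := eventually_atTop.1 (hs.bound (by positivity : 0 < 1 / K))
  have hR0 : 0 ≤ |R| := abs_nonneg R
  refine ⟨Real.exp ((A + |R|) / K), (Real.exp_pos _).le, fun t => ?_⟩
  rcases Nat.eq_zero_or_pos t with rfl | ht
  · simp [wBar, hstate.σ₂.1.map_zero]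
  have ht1 : (1 : ℝ) ≤ t := by exact_mod_cast ht
  have hlogt := Real.log_nonneg ht1
  set r := A + |R| + K * Real.log t with hr
  have hr0 : 0 ≤ r := by positivity
  have h1 := hR r (by
    have : 0 ≤ K * Real.log t := by positivity
    linarith [le_abs_self R])
  rw [pow_one, Real.norm_eq_abs, Real.norm_of_nonneg hr0] at h1
  refine (hstate.σ₂.1.mono (wBar_nonneg hσw t δ) (b := r) ((hw t ht).trans (by linarith))).trans ?_
  refine (Real.le_exp_log _).trans ?_
  calc Real.exp (Real.log (D.σ₂ r)) ≤ Real.exp (1 / K * r) :=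
        Real.exp_le_exp.2 ((le_abs_self _).trans h1)
    _ = Real.exp ((A + |R|) / K) * t := by
        have e := Real.exp_log (by positivity : (0 : ℝ) < t)
        rw [← congrArg (Real.exp ((A + |R|) / K) * ·) e, ← Real.exp_add, hr]
        congr 1
        field_simp

/-- The noise term has argument `t σ₂(w̄(t)) ≤ C t² = (√C t)²`, which is why order `2` is demanded
of `χ₄` and only order `1` of `χ₁` and `χ₃`, whose arguments are linear in `t`. -/
theorem subExpSeq_xBar (hn : 1 ≤ n) (hσw : 0 ≤ σw) (hδ : 0 < δ) (hδ1 : δ ≤ 1)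
    (hstate : sys.InputToStateBound D) (hctrl : sys.ConstrainedControls D) :
    SubExpSeq fun t => sys.xBar D σw t δ x₀ := by
  obtain ⟨C, hC, hw⟩ := exists_σ₂_wBar_le hn hσw hδ hδ1 hstate
  have hσ₁ := hstate.σ₁.nonneg hctrl.umax
  unfold xBar
  refine (((SubExpSeq.add ?_ (SubExpSeq.const _)).add ?_).add ?_).add (SubExpSeq.const _)
  · exact hstate.χ₁.2.subExpSeq hstate.χ₁.1 zero_le_one (fun t => by positivity) (by simp)
  · exact hstate.χ₃.2.subExpSeq hstate.χ₃.1 hσ₁ (fun t => by positivity)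
      (fun t => by rw [pow_one, mul_comm])
  · refine hstate.χ₄.2.subExpSeq hstate.χ₄.1 (Real.sqrt_nonneg C)
      (fun t => mul_nonneg (by positivity) (hstate.σ₂.1.nonneg (wBar_nonneg hσw t δ))) (fun t => ?_)
    rw [mul_pow, Real.sq_sqrt hC]
    calc (t : ℝ) * D.σ₂ (wBar n σw t δ) ≤ t * (C * t) := by gcongr; exact hw t
      _ = _ := by ring

theorem subExpSeq_zBar (hn : 1 ≤ n) (hσw : 0 ≤ σw) (hδ : 0 < δ) (hδ1 : δ ≤ 1)
    (hstate : sys.InputToStateBound D) (hctrl : sys.ConstrainedControls D)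
    (hfeat : sys.APBFeatures D) : SubExpSeq fun t => sys.zBar D σw t δ x₀ := by
  obtain ⟨C, R, k, hC, hR, hb⟩ := exists_le_mul_pow_of_isAPB hfeat.mono hfeat.apb
  have hx := (subExpSeq_xBar (x₀ := x₀) hn hσw hδ hδ1 hstate hctrl).sub_one.abs
  have hu := hctrl.umax
  refine SubExpSeq.mono ((SubExpSeq.const C).mul ((hx.add (SubExpSeq.const (D.umax + R))).pow k))
    fun t => ?_
  unfold zBar
  rw [abs_of_nonneg (hfeat.nonneg _ (Real.sqrt_nonneg _)), abs_of_nonneg (by positivity)]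
  refine (hb _ (Real.sqrt_nonneg _)).trans ?_
  have h1 : Real.sqrt (sys.xBar D σw (t - 1) δ x₀ ^ 2 + D.umax ^ 2) ≤
      |sys.xBar D σw (t - 1) δ x₀| + D.umax := by
    refine Real.sqrt_le_iff.2 ⟨by positivity, ?_⟩
    rw [add_sq, sq_abs]
    have : 0 ≤ 2 * |sys.xBar D σw (t - 1) δ x₀| * D.umax := by positivity
    linarith
  refine mul_le_mul_of_nonneg_left (pow_le_pow_left₀ (by positivity) ?_ k) hC
  linarith

theorem subExpSeq_sum_zBar_sq (hn : 1 ≤ n) (hσw : 0 ≤ σw) (hδ : 0 < δ) (hδ1 : δ ≤ 1)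
    (hstate : sys.InputToStateBound D) (hctrl : sys.ConstrainedControls D)
    (hfeat : sys.APBFeatures D) :
    SubExpSeq fun t => ∑ i ∈ Finset.Icc 1 t, sys.zBar D σw i δ x₀ ^ 2 :=
  ((subExpSeq_zBar hn hσw hδ hδ1 hstate hctrl hfeat).pow 2).sum_Icc

/-- The burn-in time is finite. -/
theorem Tburnin_lt_top (hn : 1 ≤ n) (hσw : 0 ≤ σw) (hstate : sys.InputToStateBound D)
    (hctrl : sys.ConstrainedControls D) (hfeat : sys.APBFeatures D) (hc : 0 < c) (hp : 0 < p)
    (hδ : 0 < δ) (hδ1 : δ < 1) : sys.Tburnin D σw c p δ x₀ < ⊤ := by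
  set s : ℕ → ℝ := fun t => ∑ i ∈ Finset.Icc 1 t, sys.zBar D σw i (δ / 3) x₀ ^ 2 with hs
  have hs0 : ∀ t, 0 ≤ s t := fun t => Finset.sum_nonneg fun _ _ => sq_nonneg _
  have hsub : SubExpSeq fun t => 16 / (c * p) * s t := (SubExpSeq.const _).mul
    (subExpSeq_sum_zBar_sq hn hσw (by positivity) (by linarith) hstate hctrl hfeat)
  have hl : 0 < 1 - Real.log 2 := by linarith [Real.log_two_lt_d9]
  set k := 2 / ((1 - Real.log 2) * p) with hk
  have hk0 : 0 < k := by positivity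
  have hpi := Real.pi_pos
  have hlogt : (fun t : ℕ => Real.log (t : ℝ)) =o[atTop] fun t : ℕ => (t : ℝ) :=
    Real.isLittleO_log_id_atTop.comp_tendsto tendsto_natCast_atTop_atTop
  have hconst : ∀ r : ℝ, (fun _ : ℕ => r) =o[atTop] fun t : ℕ => (t : ℝ) := fun r =>
    (isLittleO_const_id_atTop r).comp_tendsto tendsto_natCast_atTop_atTop
  have hlog := hsub.log_isLittleO fun t => mul_nonneg (by positivity) (hs0 t)
  -- A majorant of the right-hand side that does not involve `T` is `o(t)`, hence eventually at most
  -- `t`; this removes the circularity in choosing `T`.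
  have hall := ((((hlog.const_mul_left (d : ℝ)).add ((hconst (Real.log (Real.pi ^ 2 / (2 * δ)))).add
    (hlogt.const_mul_left 2))).const_mul_left k).add (hconst 1)).bound one_pos
  obtain ⟨T₀, hT₀⟩ := eventually_atTop.1 hall
  have hmem : sys.BurnedIn σw D c p x₀ δ (max T₀ 2) := by
    intro t ht
    have ht2 : 2 ≤ t := (le_max_right _ _).trans ht
    have ht2' : (2 : ℝ) ≤ t := by exact_mod_cast ht2
    have hTt : ((max T₀ 2 : ℕ) : ℝ) ≤ t := by exact_mod_cast ht
    have hT2 : (2 : ℝ) ≤ ((max T₀ 2 : ℕ) : ℝ) := by exact_mod_cast le_max_right _ _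
    have h1 := hT₀ t ((le_max_left _ _).trans ht)
    rw [Real.norm_eq_abs, Real.norm_of_nonneg (by positivity), one_mul] at h1
    refine le_trans ?_ ((le_abs_self _).trans h1)
    have e1 : Real.log (1 + 16 * (∑ i ∈ Finset.Icc 1 t, sys.zBar D σw i (δ / 3) x₀ ^ 2)
        / (c * p * ((t : ℝ) - 1))) ≤ Real.log (1 + 16 / (c * p) * s t) := by
      have hst := hs0 t
      have h2 : 16 * s t / (c * p * ((t : ℝ) - 1)) ≤ 16 / (c * p) * s t := by
        rw [div_mul_eq_mul_div]
        refine div_le_div_of_nonneg_left (by positivity) (by positivity) ?_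
        exact le_mul_of_one_le_right (by positivity) (by linarith)
      have h3 : 0 ≤ 16 * s t / (c * p * ((t : ℝ) - 1)) :=
        div_nonneg (by positivity) (mul_nonneg (by positivity) (by linarith))
      exact Real.log_le_log (by linarith) (by linarith)
    have e2 : Real.log (Real.pi ^ 2 * ((t : ℝ) - (max T₀ 2 : ℕ) + 1) ^ 2 / (2 * δ)) ≤
        Real.log (Real.pi ^ 2 / (2 * δ)) + 2 * Real.log t := by
      have h2 : 0 < (t : ℝ) - (max T₀ 2 : ℕ) + 1 := by linarith
      have h3 : (t : ℝ) - (max T₀ 2 : ℕ) + 1 ≤ t := by linarith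
      have e : Real.log (Real.pi ^ 2 / (2 * δ)) + 2 * Real.log t =
          Real.log (Real.pi ^ 2 * (t : ℝ) ^ 2 / (2 * δ)) := by
        rw [mul_div_right_comm, Real.log_mul (by positivity) (by positivity), Real.log_pow]
        norm_num
      rw [e]
      refine Real.log_le_log (by positivity) ?_
      gcongr
    gcongr
  refine lt_of_le_of_lt (sInf_le ⟨max T₀ 2, rfl, ?_, hmem⟩) (ENat.natCast_lt_top _)
  exact le_trans (by norm_num) (le_max_right _ _)

/-- The error bound converges to zero. -/
theorem tendsto_errBound (hn : 1 ≤ n) (hσw : 0 ≤ σw) (hstate : sys.InputToStateBound D)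
    (hctrl : sys.ConstrainedControls D) (hfeat : sys.APBFeatures D) (hc : 0 < c) (hp : 0 < p)
    (hδ : 0 < δ) (hδ1 : δ < 1) :
    Tendsto (fun t : ℕ => sys.errBound D σw c p t δ x₀) atTop (𝓝 0) := by
  have hγ := sys.γ_pos
  set s : ℕ → ℝ := fun t => ∑ i ∈ Finset.Icc 1 t, sys.zBar D σw i (δ / 3) x₀ ^ 2 with hs
  have hs0 : ∀ t, 0 ≤ s t := fun t => Finset.sum_nonneg fun _ _ => sq_nonneg _
  have hsub : SubExpSeq fun t => sys.γ⁻¹ * s t := (SubExpSeq.const _).mul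
    (subExpSeq_sum_zBar_sq hn hσw (by positivity) (by linarith) hstate hctrl hfeat)
  have hconst : ∀ r : ℝ, (fun _ : ℕ => r) =o[atTop] fun t : ℕ => (t : ℝ) := fun r =>
    (isLittleO_const_id_atTop r).comp_tendsto tendsto_natCast_atTop_atTop
  have hlog := hsub.log_isLittleO fun t => mul_nonneg (by positivity) (hs0 t)
  have hnum := ((hconst (Real.log (3 * n / δ))).add
    (hlog.const_mul_left ((d : ℝ) / 2))).const_mul_left (2 * (n : ℝ))
  set num : ℕ → ℝ := fun t => 2 * n * (Real.log (3 * n / δ) +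
    d / 2 * Real.log (1 + sys.γ⁻¹ * s t)) with hnumd
  set den : ℕ → ℝ := fun t => c * p / 4 * ((t : ℝ) - 1) + sys.γ with hden
  have hdent : Tendsto den atTop atTop := by
    refine tendsto_atTop_add_const_right _ _ (Tendsto.const_mul_atTop (by positivity) ?_)
    exact tendsto_atTop_add_const_right _ _ tendsto_natCast_atTop_atTop
  -- The denominator grows linearly while the numerator under the root is `o(t)`. The constant comes
  -- from `t ≤ 2 (t - 1)` for `t ≥ 2`.
  have hO : (fun t : ℕ => (t : ℝ)) =O[atTop] den := by
    refine IsBigO.of_bound (8 / (c * p)) ?_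
    filter_upwards [eventually_ge_atTop 2] with t ht
    have ht2' : (2 : ℝ) ≤ t := by exact_mod_cast ht
    have h1 : c * p / 4 * ((t : ℝ) - 1) ≤ den t := by
      rw [hden]
      linarith
    have h2 : 0 ≤ c * p / 4 * ((t : ℝ) - 1) := mul_nonneg (by positivity) (by linarith)
    rw [Real.norm_of_nonneg (by positivity), Real.norm_of_nonneg (h2.trans h1)]
    calc (t : ℝ) ≤ 2 * (t - 1) := by linarith
      _ = 8 / (c * p) * (c * p / 4 * ((t : ℝ) - 1)) := by field_simp; ring
      _ ≤ _ := by gcongr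
  have hratio : Tendsto (fun t => num t / den t) atTop (𝓝 0) :=
    (hnum.trans_isBigO hO).tendsto_div_nhds_zero
  have hsqrt : Tendsto (fun t => Real.sqrt (num t / den t)) atTop (𝓝 0) := by
    have := (Real.continuous_sqrt.tendsto 0).comp hratio
    rwa [Real.sqrt_zero] at this
  have hinv : Tendsto (fun t => (Real.sqrt (den t))⁻¹) atTop (𝓝 0) :=
    (Real.tendsto_sqrt_atTop.comp hdent).inv_tendsto_atTop
  have hlim : Tendsto (fun t => (Real.sqrt (den t))⁻¹ *
      (Real.sqrt sys.γ * matFrobNorm sys.θstar) + σw * Real.sqrt (num t / den t)) atTop (𝓝 0) := by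
    have := (hinv.mul_const (Real.sqrt sys.γ * matFrobNorm sys.θstar)).add (hsqrt.const_mul σw)
    simpa using this
  refine hlim.congr' ?_
  filter_upwards [hdent.eventually_ge_atTop 0] with t ht
  have e : sys.βmax D σw t (δ / 3) x₀ * sys.γ⁻¹ = 1 + sys.γ⁻¹ * s t := by
    rw [βmax, hs]
    field_simp
    ring
  rw [errBound, e, Real.sqrt_div' _ ht]
  change _ = 1 / Real.sqrt (den t) * (Real.sqrt sys.γ * matFrobNorm sys.θstar +
    σw * Real.sqrt (num t))
  ring

/-- Under global excitation every predicted state is excited. -/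
theorem Texcited_stateSet_eq_top : sys.Texcited D σw sys.stateSet δ x₀ = ⊤ := by
  refine sSup_eq_top.2 fun b hb => ?_
  lift b to ℕ using hb.ne
  refine ⟨((b + 1 : ℕ) : ℕ∞), ⟨b + 1, rfl, by omega, ?_⟩, by exact_mod_cast Nat.lt_succ_self b⟩
  rintro y ⟨x, u, _, _, rfl⟩
  exact sys.g_mem x u 0 (Or.inr rfl)

end ClosedLoopSystem

end

theorem corollary1 {n m d q : ℕ} (hn : 1 ≤ n) (hd : 1 ≤ d)
    {Ω : Type*} [MeasurableSpace Ω] (P : Measure Ω) [IsProbabilityMeasure P]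
    (sys : ClosedLoopSystem n m d q)
    (W : ℕ → Ω → sys.noiseSet) (S : ℕ → Ω → sys.explSet)
    (μw : Measure sys.noiseSet) (μs : Measure sys.explSet)
    (σw : ℝ) (hσw : 0 ≤ σw)
    (hexpl : sys.ExplNoise P S μs)
    (hmeas : sys.MeasurableMaps)
    (hnoise : sys.ProcessNoise P W S μw σw)
    (D : GrowthData)
    (hstate : sys.InputToStateBound D)
    (hctrl : sys.ConstrainedControls D)
    (hfeat : sys.APBFeatures D)
    (c p : ℝ) (hc : 0 < c) (hp : 0 < p)
    (hexc : sys.GloballyExcited μs μw c p)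
    (x₀ : sys.stateSet) (δ : ℝ) (hδ₀ : 0 < δ) (hδ₁ : δ < 1) :
    sys.Tburnin D σw c p δ x₀ < ⊤ ∧
    sys.Texcited D σw sys.stateSet δ x₀ = ⊤ ∧
    ENNReal.ofReal (1 - δ) ≤
      P {ω | ∀ t : ℕ, sys.Tburnin D σw c p δ x₀ ≤ (t : ℕ∞) →
        matOpNorm (sys.θhat x₀ W S t ω - sys.θstar) ≤ sys.errBound D σw c p t δ x₀} ∧
    Tendsto (fun t : ℕ => sys.errBound D σw c p t δ x₀) atTop (𝓝 0) :=
  have htop := ClosedLoopSystem.Tburnin_lt_top hn hσw hstate hctrl hfeat hc hp hδ₀ hδ₁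
  ⟨htop, ClosedLoopSystem.Texcited_stateSet_eq_top,
    ClosedLoopSystem.measure_error_le_errBound_ge hn hd hσw hexpl hmeas hnoise hstate hctrl hfeat
      hc hp hexc hδ₀ hδ₁ htop,
    ClosedLoopSystem.tendsto_errBound hn hσw hstate hctrl hfeat hc hp hδ₀ hδ₁⟩
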